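/- Let $N\ge 1$ and let $\Omega\subset\mathbb R^N$ be a bounded domain. Let $p_1,q_1,\gamma_1,c_3,c_4>0$ and put $\delta_1=\frac{p_1+1}{\gamma_1+1}$; assume $1\le\delta_1<2$. Then there is a constant $c>0$, depending only on $\Omega$ and on $p_1,q_1,\gamma_1,c_3,c_4$, with the following property. Let $a\in C([0,\infty))$ with $a(0)=0$ and $a(s)>0$ for $s>0$, and let $h\in C((0,\infty))\cap L^1_{\rm loc}([0,\infty))$ with $h>0$ on $(0,\infty)$. Put $H(v)=\int_0^v h(r)\,dr$ and $F(v)=h(v)a(v)$ for $v\ge 0$, where $F$ is assumed to be locally Lipschitz and nondecreasing on $[0,\infty)$ with $F(0)=0$. Assume that for all $s\in[0,\infty)$ the following derivatives exist (one-sided at $s=0$) and satisfy $$[H^{p_1}F]'(s)\ \ge\ c_3\,H(s)^{q_1},\qquad [H^{\gamma_1+1}]'(s)\ \le\ c_4\,H(s)^{q_1/2}.$$ Let $t_0\in\mathbb R$ and let $u\ge 0$ be a (possibly unbounded) strong solution of $$[H(u)]_t-F(u)\Delta u\le 0\ \text{ in }\Omega\times(t_0,\infty),\qquad u(\cdot,t_0)=u_0\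 \text{ on }\Omega,\qquad u=0\ \text{ on }\partial\Omega\times(t_0,\infty).$$ This means: $[H(u)]_t\in L^2(\Omega\times(t_0,\infty))$ and $H(u(\cdot,t))=H(u_0)+\int_{t_0}^t[H(u)]_t(\cdot,s)\,ds$ a.e. in $\Omega$ for every $t\ge t_0$; for a.e. $t>t_0$ the function $u(\cdot,t)$ and its distributional Laplacian $\Delta u(\cdot,t)$ lie in $L^1_{\rm loc}(\Omega)$; $F(u)\Delta u\in L^2(\Omega\times(t_0,\infty))$; the differential inequality holds a.e. in $\Omega\times(t_0,\infty)$; and the boundary condition holds in the sense that $H(u(\cdot,t))^{p_1}F(u(\cdot,t))\in W^{1,2}_0(\Omega)$ for a.e. $t>t_0$. Assume $H(u_0)\in L^{p_1+1}(\Omega)$. Then $$Y(t)=\int_\Omega H(u(x,t))^{p_1+1}\,dx$$ is finite for every $t\ge t_0$, it is absolutely continuous on $[t_0,T]$ for every $T\ge t_0$, and $$Y'(t)+c\,Y(t)^{2/\delta_1}\le 0$$ at every $t>t_0$ at which $Y$ is differentiable, hence for a.e. $t>t_0$. If $Y_0:=Y(t_0)>0$, then $$Y(t)\le\Big[c\,\tfrac{2-\delta_1}{\delta_1}(t-t_0)+Y_0^{-\frac{2-\delta_1}{\delta_1}}\Big]^{-\frac{\delta_1}{2-\delta_1}}\qquad\text{for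 all }t\ge t_0 .$$ In every case $\lim_{t\to\infty}Y(t)=0$. -/

import Mathlib

open MeasureTheory Set Filter Topology
open scoped ContDiff

noncomputable section

namespace EinsteinModel

/-- Euclidean space of dimension `N`. -/
abbrev Euc (N : ℕ) : Type := EuclideanSpace ℝ (Fin N)

/-- Smooth real functions with compact support inside `Ω`. -/
structure IsTestFunction {N : ℕ} (Ω : Set (Euc N)) (φ : Euc N → ℝ) : Prop where
  contDiff : ContDiff ℝ ∞ φ
  hasCompactSupport : HasCompactSupport φ
  tsupport_subset : tsupport φ ⊆ Ω

/-- `g` is the weak gradient of `f` in the open set `Ω`. -/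
structure HasWeakGradient {N : ℕ} (Ω : Set (Euc N)) (f : Euc N → ℝ) (g : Euc N → Euc N) :
    Prop where
  locInt : LocallyIntegrableOn f Ω
  locInt_grad : LocallyIntegrableOn g Ω
  integral_eq : ∀ φ : Euc N → ℝ, IsTestFunction Ω φ →
    ∫ x in Ω, f x • gradient φ x = -∫ x in Ω, φ x • g x

/-- `l` is the weak (distributional) Laplacian of `f` in the open set `Ω`; both functions are
locally integrable in `Ω`. -/
structure HasWeakLaplacian {N : ℕ} (Ω : Set (Euc N)) (f l : Euc N → ℝ) : Prop where
  locInt : LocallyIntegrableOn f Ω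
  locInt_lap : LocallyIntegrableOn l Ω
  integral_eq : ∀ φ : Euc N → ℝ, IsTestFunction Ω φ →
    ∫ x in Ω, f x * (Laplacian.laplacian φ : Euc N → ℝ) x = ∫ x in Ω, φ x * l x

/-- `f` belongs to `W₀^{1,2}(Ω)`: it lies in `W^{1,2}(Ω)` and is a limit, in the norm of
`W^{1,2}(Ω)`, of smooth functions with compact support in `Ω`. -/
def MemW012 {N : ℕ} (Ω : Set (Euc N)) (f : Euc N → ℝ) : Prop :=
  ∃ g : Euc N → Euc N, HasWeakGradient Ω f g ∧
    MemLp f 2 (volume.restrict Ω) ∧ MemLp g 2 (volume.restrict Ω) ∧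
    ∀ ε : ENNReal, 0 < ε → ∃ φ : Euc N → ℝ, IsTestFunction Ω φ ∧
      eLpNorm (fun x => f x - φ x) 2 (volume.restrict Ω) < ε ∧
      eLpNorm (fun x => g x - gradient φ x) 2 (volume.restrict Ω) < ε

/-- `H(v) = ∫₀^v h(r) dr`. -/
def H (h : ℝ → ℝ) (v : ℝ) : ℝ := ∫ r in (0 : ℝ)..v, h r

/-- `F(v) = h(v) a(v)`. -/
def F (h a : ℝ → ℝ) (v : ℝ) : ℝ := h v * a v

/-- The standing conditions on the weight `h` and on the diffusion coefficient `a`.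
Only their values on `[0, ∞)` matter. -/
structure IsModel (h a : ℝ → ℝ) : Prop where
  h_cont : ContinuousOn h (Ioi 0)
  h_pos : ∀ s : ℝ, 0 < s → 0 < h s
  h_locInt : LocallyIntegrableOn h (Ici 0)
  a_cont : ContinuousOn a (Ici 0)
  a_zero : a 0 = 0
  a_pos : ∀ s : ℝ, 0 < s → 0 < a s
  F_lipschitz : LocallyLipschitzOn (Ici 0) (F h a)
  F_mono : MonotoneOn (F h a) (Ici 0)
  F_zero : F h a 0 = 0

/-- `[H^p F]'(s) ≥ c₃ H(s)^q` for all `s ≥ 0` (with the one-sided derivative at `0`). -/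
def LowerStructure (h a : ℝ → ℝ) (p q c₃ : ℝ) : Prop :=
  ∀ s : ℝ, 0 ≤ s →
    DifferentiableWithinAt ℝ (fun r => H h r ^ p * F h a r) (Ici 0) s ∧
    c₃ * H h s ^ q ≤ derivWithin (fun r => H h r ^ p * F h a r) (Ici 0) s

/-- `[H^{γ+1}]'(s) ≤ c₄ H(s)^β` for all `s ≥ 0` (with the one-sided derivative at `0`). -/
def UpperStructure (h : ℝ → ℝ) (γ β c₄ : ℝ) : Prop :=
  ∀ s : ℝ, 0 ≤ s →
    DifferentiableWithinAt ℝ (fun r => H h r ^ (γ + 1)) (Ici 0) s ∧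
    derivWithin (fun r => H h r ^ (γ + 1)) (Ici 0) s ≤ c₄ * H h s ^ β

/-- `u` is a nonnegative, possibly unbounded, strong solution of
`[H(u)]_t - F(u) Δu ≤ 0` in `Ω × (t₀, ∞)` with `u(·, t₀) = u₀`. The function `w` is the time
derivative `[H(u)]_t ∈ L²(Ω × (t₀, ∞))`, in the sense that `t ↦ H(u(·, t))` is its
primitive starting from `H(u₀)`. The function `l` is the weak Laplacian of `u` in the space
variable, with `F(u) Δu ∈ L²(Ω × (t₀, ∞))`. The inequality holds almost everywhere.
The boundary condition is the separate predicate `ZeroBoundary`. -/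
def IsStrongSolution {N : ℕ} (Ω : Set (Euc N)) (h a : ℝ → ℝ) (t₀ : ℝ)
    (u₀ : Euc N → ℝ) (u : Euc N → ℝ → ℝ) : Prop :=
  AEStronglyMeasurable (fun z : Euc N × ℝ => u z.1 z.2) (volume.restrict (Ω ×ˢ Ioi t₀)) ∧
  (∀ t : ℝ, t₀ ≤ t → ∀ᵐ x ∂volume.restrict Ω, 0 ≤ u x t) ∧
  (∀ᵐ x ∂volume.restrict Ω, u x t₀ = u₀ x) ∧
  ∃ w l : Euc N × ℝ → ℝ,
    MemLp w 2 (volume.restrict (Ω ×ˢ Ioi t₀)) ∧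
    (∀ t : ℝ, t₀ ≤ t → ∀ᵐ x ∂volume.restrict Ω,
      H h (u x t) = H h (u₀ x) + ∫ s in t₀..t, w (x, s)) ∧
    (∀ᵐ t ∂volume.restrict (Ioi t₀),
      HasWeakLaplacian Ω (fun x => u x t) (fun x => l (x, t))) ∧
    MemLp (fun z : Euc N × ℝ => F h a (u z.1 z.2) * l z) 2
      (volume.restrict (Ω ×ˢ Ioi t₀)) ∧
    (∀ᵐ z ∂volume.restrict (Ω ×ˢ Ioi t₀), w z - F h a (u z.1 z.2) * l z ≤ 0)

/-- The homogeneous boundary condition on `∂Ω × (t₀, ∞)`, in the sense of traces: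
`H(u)^p F(u) ∈ W₀^{1,2}(Ω)` for almost every time. (The function `s ↦ H(s)^p F(s)` is
nonnegative and vanishes exactly at `s = 0`.) -/
def ZeroBoundary {N : ℕ} (Ω : Set (Euc N)) (h a : ℝ → ℝ) (p t₀ : ℝ)
    (u : Euc N → ℝ → ℝ) : Prop :=
  ∀ᵐ t ∂volume.restrict (Ioi t₀),
    MemW012 Ω (fun x => H h (u x t) ^ p * F h a (u x t))

/-- `Y(t) = ∫_Ω H(u(x, t))^{p+1} dx`. -/
def Y {N : ℕ} (Ω : Set (Euc N)) (h : ℝ → ℝ) (p : ℝ) (u : Euc N → ℝ → ℝ) (t : ℝ) : ℝ :=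
  ∫ x in Ω, H h (u x t) ^ (p + 1)

end EinsteinModel

end

/-! ### Calculus for smooth functions: Laplacian, Green's identity, Poincaré's inequality -/

noncomputable section

namespace EinsteinModel

open ContinuousLinearMap
open scoped Convolution

variable {N : ℕ}

/-! Formally, multiply the inequality by `(p + 1) H(u)^p` and integrate. With `G = H^p F` this gives
`Y' ≤ (p + 1) ∫ G(u) Δu = -(p + 1) ∫ G'(u) |∇u|²`, where `u = 0` on the boundary removes the
boundary term. The structure conditions give `|∇ H(u)^{γ+1}|² ≤ c₄² H(u)^q |∇u|² ≤ (c₄²/c₃) G'(u)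
|∇u|²`. Poincaré's inequality for `H(u)^{γ+1}` and Hölder's inequality, with exponent `θ = 2/δ₁`
satisfying `(p + 1) θ = 2 (γ + 1)`, turn the dissipation into a multiple of `Y^θ`. Since `θ > 1`,
the scalar inequality integrates to algebraic decay.

The difficulty is regularity. At a fixed time the slice `U` has only a weak Laplacian `l`, it may be
unbounded, and no gradient of it is assumed; only `V = G(U)` lies in `W₀^{1,2}`. The inverse `K` of
`G` need not be Lipschitz near zero, so `U = K(V)` has no direct chain rule. Four devices replace
the formal computation.

Kato's inequality (`HasWeakLaplacian.integral_convex_comp`) moves the Laplacian from `U` to a test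
function through a convex cut-off `j` which vanishes near zero. Then `j(U) = T(V)` with `T = j ∘ K`
Lipschitz, and the test function `S(φₙ)` with `φₙ → V` can be inserted. Derivatives of Lipschitz
functions are never used: `T` is replaced by Steklov averages, whose derivatives are difference
quotients. This is `ApproxW012.integral_flux_le`.

The structure conditions enter only as an inequality between increments, `IsAdmissible.sq_sub_le`,
which matches those difference quotients. With Poincaré's inequality it yields the energy estimate
`IsSlice.flux_le` for a smooth truncation `S(G(U))`.

To pass from `S(G(U))` to the multiplier `min(H(U), k)^p F(U)`, the flux over every set `{U > σ}`
with `σ > 0` is shown to be nonpositive. By the layer cake formula `∫ P(U) l ≤ 0` for every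
continuous nondecreasing `P` with `P(0) = 0` and `P(U) l` integrable
(`IsSlice.integral_mul_nonpos`). Applied to the difference of the two multipliers this gives
`IsSlice.truncated_le`; applied to the difference of two truncation levels it gives monotonicity in
`k`.

In time, the chain rule holds for truncated powers because their derivatives are bounded. The
truncated dissipation rates are nonnegative and increase with `k`, so monotone convergence
(`exists_dissipation`) gives finiteness and absolute continuity of `Y`, and a rate `D` which
dominates all truncated ones. The bound `D ≥ c Y^θ` is `IsSlice.rpow_integral_le`, and `IsDecaying`
draws the scalar conclusions. -/

/-- The `i`-th standard basis vector. -/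
abbrev bvec (i : Fin N) : Euc N := EuclideanSpace.basisFun (Fin N) ℝ i

theorem laplacian_eq_sum {f : Euc N → ℝ} (hf : ContDiff ℝ 2 f) (x : Euc N) :
    (Laplacian.laplacian f : Euc N → ℝ) x
      = ∑ i : Fin N, fderiv ℝ (fun y => fderiv ℝ f y (bvec i)) x (bvec i) := by
  have h := InnerProductSpace.laplacian_eq_iteratedFDeriv_orthonormalBasis f
    (EuclideanSpace.basisFun (Fin N) ℝ)
  rw [h]
  refine Finset.sum_congr rfl fun i _ => ?_
  rw [iteratedFDeriv_two_apply]
  have hd : DifferentiableAt ℝ (fderiv ℝ f) x :=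
    (hf.fderiv_right (m := 1) (by norm_num)).differentiable (by norm_num) x
  simp [bvec, fderiv_clm_apply hd (differentiableAt_const _)]

theorem sum_fderiv_mul_fderiv (f g : Euc N → ℝ) (x : Euc N) :
    ∑ i : Fin N, fderiv ℝ f x (bvec i) * fderiv ℝ g x (bvec i)
      = inner ℝ (gradient f x) (gradient g x) := by
  rw [← (EuclideanSpace.basisFun (Fin N) ℝ).sum_inner_mul_inner]
  refine Finset.sum_congr rfl fun i _ => ?_
  rw [real_inner_comm (gradient g x)]
  simp [gradient, bvec]

theorem norm_gradient (f : Euc N → ℝ) (x : Euc N) : ‖gradient f x‖ = ‖fderiv ℝ f x‖ := by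
  simp [gradient]

theorem continuous_gradient {f : Euc N → ℝ} (hf : ContDiff ℝ 1 f) : Continuous (gradient f) := by
  have := hf.continuous_fderiv one_ne_zero
  unfold gradient
  fun_prop

theorem hasCompactSupport_gradient {f : Euc N → ℝ} (hf : HasCompactSupport f) :
    HasCompactSupport (gradient f) :=
  (hf.fderiv ℝ).comp_left (g := (InnerProductSpace.toDual ℝ (Euc N)).symm) (map_zero _)

theorem gradient_comp {f : Euc N → ℝ} (hf : Differentiable ℝ f) {S s : ℝ → ℝ}
    (hS : ∀ v, HasDerivAt S (s v) v) (x : Euc N) :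
    gradient (fun y => S (f y)) x = s (f x) • gradient f x := by
  have h : HasFDerivAt (fun y => S (f y)) (s (f x) • fderiv ℝ f x) x :=
    (hS (f x)).comp_hasFDerivAt x (hf x).hasFDerivAt
  simp [gradient, h.fderiv]

theorem integral_mul_fderiv_eq_neg {f g : Euc N → ℝ} (hf : ContDiff ℝ 1 f) (hg : ContDiff ℝ 1 g)
    (hc : HasCompactSupport f ∨ HasCompactSupport g) (v : Euc N) :
    ∫ x, f x * fderiv ℝ g x v = -∫ x, fderiv ℝ f x v * g x := by
  have h1 := hf.continuous_fderiv one_ne_zero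
  have h2 := hg.continuous_fderiv one_ne_zero
  have h3 := hf.continuous
  have h4 := hg.continuous
  apply integral_mul_fderiv_eq_neg_fderiv_mul_of_integrable
  · refine Continuous.integrable_of_hasCompactSupport (by fun_prop) ?_
    rcases hc with hc | hc
    · exact (hc.fderiv_apply ℝ v).mul_right
    · exact hc.mul_left
  · refine Continuous.integrable_of_hasCompactSupport (by fun_prop) ?_
    rcases hc with hc | hc
    · exact hc.mul_right
    · exact (hc.fderiv_apply ℝ v).mul_left
  · refine Continuous.integrable_of_hasCompactSupport (by fun_prop) ?_
    rcases hc with hc | hc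
    · exact hc.mul_right
    · exact hc.mul_left
  · exact fun x _ => hf.differentiable one_ne_zero x
  · exact fun x _ => hg.differentiable one_ne_zero x

/-- Green's first identity without boundary terms. -/
theorem integral_mul_laplacian {f g : Euc N → ℝ} (hf : ContDiff ℝ 1 f) (hg : ContDiff ℝ 2 g)
    (hc : HasCompactSupport f ∨ HasCompactSupport g) :
    ∫ x, f x * (Laplacian.laplacian g : Euc N → ℝ) x
      = -∫ x, inner ℝ (gradient f x) (gradient g x) := by
  have hgi : ∀ i : Fin N, ContDiff ℝ 1 (fun y => fderiv ℝ g y (bvec i)) := fun i =>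
    (hg.fderiv_right (m := 1) (by norm_num)).clm_apply contDiff_const
  have hci : ∀ i : Fin N, HasCompactSupport f ∨
      HasCompactSupport (fun y => fderiv ℝ g y (bvec i)) := fun i =>
    hc.imp id fun h => h.fderiv_apply ℝ _
  simp_rw [laplacian_eq_sum hg, ← sum_fderiv_mul_fderiv, Finset.mul_sum]
  have h1 := hf.continuous_fderiv one_ne_zero
  have h3 := hf.continuous
  have h2 := fun i => (hgi i).continuous_fderiv one_ne_zero
  have h4 := fun i => (hgi i).continuous
  rw [integral_finsetSum, integral_finsetSum, ← Finset.sum_neg_distrib]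
  · exact Finset.sum_congr rfl fun i _ => integral_mul_fderiv_eq_neg hf (hgi i) (hci i) _
  · intro i _
    refine Continuous.integrable_of_hasCompactSupport (by have := h4 i; fun_prop) ?_
    rcases hci i with hc | hc
    · exact (hc.fderiv_apply ℝ _).mul_right
    · exact hc.mul_left
  · intro i _
    refine Continuous.integrable_of_hasCompactSupport (by have := h2 i; fun_prop) ?_
    rcases hci i with hc | hc
    · exact hc.mul_right
    · exact (hc.fderiv_apply ℝ _).mul_left

theorem continuous_laplacian {f : Euc N → ℝ} (hf : ContDiff ℝ 2 f) :
    Continuous (Laplacian.laplacian f : Euc N → ℝ) := by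
  rw [funext (laplacian_eq_sum hf)]
  refine continuous_finsetSum _ fun i _ => ?_
  have : ContDiff ℝ 1 (fun y => fderiv ℝ f y (bvec i)) :=
    (hf.fderiv_right (m := 1) (by norm_num)).clm_apply contDiff_const
  have := this.continuous_fderiv one_ne_zero
  fun_prop

theorem tsupport_laplacian_subset (f : Euc N → ℝ) :
    tsupport (Laplacian.laplacian f : Euc N → ℝ) ⊆ tsupport f := by
  refine closure_minimal (fun x hx => ?_) (isClosed_tsupport f)
  by_contra hxf
  refine hx ?_
  have h0 : f =ᶠ[𝓝 x] fun _ => 0 := notMem_tsupport_iff_eventuallyEq.1 hxf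
  rw [(InnerProductSpace.laplacian_congr_nhds h0).eq_of_nhds]
  simp

theorem hasCompactSupport_laplacian {f : Euc N → ℝ}
    (hc : HasCompactSupport f) : HasCompactSupport (Laplacian.laplacian f : Euc N → ℝ) :=
  hc.mono' (subset_closure.trans (tsupport_laplacian_subset f))

/-- Integrating both sides by parts leaves the same term `-∫ p(f) ⟨∇f, ∇η⟩`; on the left there is
the further term `-∫ p'(f) |∇f|² η`, which has a sign. -/
theorem integral_convex_comp_smooth {f η : Euc N → ℝ} (hf : ContDiff ℝ 2 f) (hη : ContDiff ℝ 2 η)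
    (hc : HasCompactSupport η) (hη0 : ∀ x, 0 ≤ η x) {j p p' : ℝ → ℝ}
    (hj : ∀ v, HasDerivAt j (p v) v) (hp : ∀ v, HasDerivAt p (p' v) v)
    (hp'c : Continuous p') (hp' : ∀ v, 0 ≤ p' v) :
    ∫ x, p (f x) * (Laplacian.laplacian f : Euc N → ℝ) x * η x
      ≤ ∫ x, j (f x) * (Laplacian.laplacian η : Euc N → ℝ) x := by
  have hp1 : ContDiff ℝ 1 p := by
    rw [contDiff_one_iff_deriv, show deriv p = p' from funext fun v => (hp v).deriv]
    exact ⟨fun v => (hp v).differentiableAt, hp'c⟩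
  have hj1 : ContDiff ℝ 1 j := by
    rw [contDiff_one_iff_deriv, show deriv j = p from funext fun v => (hj v).deriv]
    exact ⟨fun v => (hj v).differentiableAt, hp1.continuous⟩
  have hf1 : ContDiff ℝ 1 f := hf.of_le (by norm_num)
  have hη1 : ContDiff ℝ 1 η := hη.of_le (by norm_num)
  have hfd := hf1.differentiable one_ne_zero
  rw [integral_mul_laplacian (f := fun x => j (f x)) (hj1.comp hf1) hη (Or.inr hc)]
  have e1 : ∀ x, p (f x) * (Laplacian.laplacian f : Euc N → ℝ) x * η x
      = (p (f x) * η x) * (Laplacian.laplacian f : Euc N → ℝ) x := fun x => by ring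
  simp_rw [e1]
  have hc' : HasCompactSupport (fun x => p (f x) * η x) := hc.mul_left
  rw [integral_mul_laplacian (f := fun x => p (f x) * η x) ((hp1.comp hf1).mul hη1) hf
    (Or.inl hc')]
  rw [neg_le_neg_iff]
  have hgp : ∀ x, gradient (fun x => p (f x) * η x) x
      = p (f x) • gradient η x + (η x * p' (f x)) • gradient f x := fun x => by
    have h1 : HasFDerivAt (fun y => p (f y)) (p' (f x) • fderiv ℝ f x) x :=
      (hp (f x)).comp_hasFDerivAt x (hfd x).hasFDerivAt
    have h2 := h1.mul (hη1.differentiable one_ne_zero x).hasFDerivAt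
    have h3 : fderiv ℝ (fun x => p (f x) * η x) x = _ := h2.fderiv
    simp [gradient, h3, mul_smul]
  have hgη := continuous_gradient hη1
  have hgf := continuous_gradient hf1
  have h3 := hf.continuous
  have h4 := hη.continuous
  have h5 := hp1.continuous
  refine integral_mono ?_ ?_ fun x => ?_
  · refine Continuous.integrable_of_hasCompactSupport ?_ ?_
    · have := continuous_gradient (hj1.comp hf1)
      simp only [Function.comp_def] at this
      fun_prop
    · refine (hasCompactSupport_gradient hc).mono fun x hx => ?_
      simp only [Function.mem_support] at hx ⊢
      contrapose! hx
      simp [hx]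
  · refine Continuous.integrable_of_hasCompactSupport ?_ ?_
    · have := continuous_gradient ((hp1.comp hf1).mul hη1)
      simp only [Function.comp_def] at this
      fun_prop
    · refine (hasCompactSupport_gradient hc').mono fun x hx => ?_
      simp only [Function.mem_support] at hx ⊢
      contrapose! hx
      simp [hx]
  · dsimp only
    rw [hgp, gradient_comp hfd hj, inner_add_left, inner_smul_left, inner_smul_left,
      inner_smul_left, real_inner_self_eq_norm_sq, real_inner_comm]
    have : 0 ≤ η x * p' (f x) * ‖gradient f x‖ ^ 2 :=
      mul_nonneg (mul_nonneg (hη0 x) (hp' _)) (by positivity)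
    simpa using this

/-- Poincaré's inequality for compactly supported functions. -/
theorem poincare_smooth (hN : 0 < N) {φ : Euc N → ℝ} (hφ : ContDiff ℝ 1 φ)
    (hc : HasCompactSupport φ) {R : ℝ} (hR : ∀ x ∈ tsupport φ, ‖x‖ ≤ R) :
    ∫ x, φ x ^ 2 ≤ 4 * R ^ 2 * ∫ x, ‖gradient φ x‖ ^ 2 := by
  let i : Fin N := ⟨0, hN⟩
  have hφc := hφ.continuous
  have hfc := hφ.continuous_fderiv one_ne_zero
  have hgc := continuous_gradient hφ
  have hX : ContDiff ℝ 1 (fun x : Euc N => x i) := by fun_prop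
  have hdX : ∀ x : Euc N, fderiv ℝ (fun x : Euc N => x i) x (bvec i) = 1 := fun x => by
    have : (fun x : Euc N => x i) = EuclideanSpace.proj (𝕜 := ℝ) i := rfl
    rw [this, ContinuousLinearMap.fderiv]
    simp [bvec]
  have h2 : ∀ x, fderiv ℝ (fun x => φ x ^ 2) x (bvec i) = 2 * φ x * fderiv ℝ φ x (bvec i) := by
    intro x
    have h : HasFDerivAt (fun x => φ x ^ 2) _ x :=
      (hφ.differentiable one_ne_zero x).hasFDerivAt.pow 2
    rw [h.fderiv]
    simp
  -- Integrating `φ² · ∂ᵢxᵢ` by parts gives `∫ φ² = -∫ 2 φ ∂ᵢφ xᵢ`. Young's inequality with weight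
  -- `1/2` on `φ²` lets half of the left side be absorbed, hence the constant `4R²`.
  have hip := integral_mul_fderiv_eq_neg (f := fun x => φ x ^ 2) (g := fun x : Euc N => x i)
    (by fun_prop) hX (Or.inl (by simp only [pow_two]; exact hc.mul_left)) (bvec i)
  simp only [hdX, mul_one, h2] at hip
  have hle : ∀ x, -(2 * φ x * fderiv ℝ φ x (bvec i) * x i)
      ≤ φ x ^ 2 / 2 + 2 * R ^ 2 * ‖gradient φ x‖ ^ 2 := fun x => by
    by_cases hx : x ∈ tsupport φ
    · have hxi : |x i| ≤ R := (PiLp.norm_apply_le x i).trans (hR x hx)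
      have hd : |fderiv ℝ φ x (bvec i)| ≤ ‖gradient φ x‖ := by
        rw [norm_gradient]
        simpa [bvec] using (fderiv ℝ φ x).le_opNorm (bvec i)
      have hm : (fderiv ℝ φ x (bvec i) * x i) ^ 2 ≤ R ^ 2 * ‖gradient φ x‖ ^ 2 := by
        rw [← sq_abs, abs_mul, ← mul_pow, mul_comm R]
        gcongr
      nlinarith [sq_nonneg (φ x + 2 * (fderiv ℝ φ x (bvec i) * x i))]
    · rw [image_eq_zero_of_notMem_tsupport hx]
      have : 0 ≤ 2 * R ^ 2 * ‖gradient φ x‖ ^ 2 := by positivity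
      simpa using this
  have hi1 : Integrable (fun x => φ x ^ 2) := Continuous.integrable_of_hasCompactSupport
    (by fun_prop) (by simp only [pow_two]; exact hc.mul_left)
  have hi2 : Integrable (fun x => ‖gradient φ x‖ ^ 2) :=
    Continuous.integrable_of_hasCompactSupport (by fun_prop)
      ((hasCompactSupport_gradient hc).comp_left (g := fun v => ‖v‖ ^ 2) (by simp))
  have hi3 : Integrable (fun x => 2 * φ x * fderiv ℝ φ x (bvec i) * x i) :=
    Continuous.integrable_of_hasCompactSupport (by fun_prop)
      (hc.mul_left (f := fun _ => (2 : ℝ))).mul_right.mul_right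
  have := integral_mono (μ := volume) hi3.neg ((hi1.div_const 2).add (hi2.const_mul (2 * R ^ 2))) hle
  have e : ∫ x, ((fun x => φ x ^ 2 / 2) + fun x => 2 * R ^ 2 * ‖gradient φ x‖ ^ 2 : Euc N → ℝ) x
      = (∫ x, φ x ^ 2) / 2 + 2 * R ^ 2 * ∫ x, ‖gradient φ x‖ ^ 2 := by
    rw [integral_add' (hi1.div_const 2) (hi2.const_mul (2 * R ^ 2)), integral_div,
      integral_const_mul]
  rw [e] at this
  simp only [Pi.neg_apply] at this
  rw [integral_neg, ← hip] at this
  linarith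

end EinsteinModel
end

/-! ### Mollification and Kato's inequality for weak Laplacians -/

noncomputable section

namespace EinsteinModel

open ContinuousLinearMap
open scoped Convolution

variable {N : ℕ}

/-- Convolution of `f` with a kernel `ρ`. -/
def moll (ρ f : Euc N → ℝ) : Euc N → ℝ := f ⋆[ContinuousLinearMap.mul ℝ ℝ, volume] ρ

theorem moll_apply (ρ f : Euc N → ℝ) (x : Euc N) : moll ρ f x = ∫ y, f y * ρ (x - y) := rfl

theorem moll_eq_convolution (ρ f : Euc N → ℝ) : moll ρ f = ρ ⋆[lsmul ℝ ℝ, volume] f := by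
  ext x
  rw [moll_apply, convolution_eq_swap]
  simp [mul_comm]

theorem integral_norm_moll_le {φ : ContDiffBump (0 : Euc N)} {f : Euc N → ℝ} (hf : Integrable f) :
    ∫ x, ‖moll (φ.normed volume) f x‖ ≤ ∫ x, ‖f x‖ := by
  have hφ : Integrable (φ.normed volume : Euc N → ℝ) := φ.integrable_normed
  have h1 : Integrable (moll (φ.normed volume) f) := hf.integrable_convolution _ hφ
  have h2 : Integrable (moll (φ.normed volume) fun x => ‖f x‖) :=
    hf.norm.integrable_convolution _ hφ
  have h3 : ∫ x, moll (φ.normed volume) (fun x => ‖f x‖) x = ∫ x, ‖f x‖ := by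
    unfold moll
    rw [integral_convolution _ hf.norm hφ]
    simp [φ.integral_normed]
  rw [← h3]
  refine integral_mono h1.norm h2 fun x => ?_
  dsimp only
  rw [moll_apply, moll_apply]
  refine (norm_integral_le_integral_norm _).trans_eq ?_
  simp_rw [norm_mul, Real.norm_of_nonneg (φ.nonneg_normed _)]

/-- Mollification is a contraction in `L¹`, so it suffices to treat a dense class. For continuous
`g` with compact support the convergence is pointwise, dominated by a constant on a fixed thickening
of the support. -/
theorem tendsto_integral_norm_moll_sub {φ : ℕ → ContDiffBump (0 : Euc N)}
    (hφ : Tendsto (fun n => (φ n).rOut) atTop (𝓝 0)) {f : Euc N → ℝ} (hf : Integrable f) :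
    Tendsto (fun n => ∫ x, ‖moll ((φ n).normed volume) f x - f x‖) atTop (𝓝 0) := by
  have hφi : ∀ n, Integrable ((φ n).normed volume : Euc N → ℝ) := fun n => (φ n).integrable_normed
  rw [Metric.tendsto_atTop]
  intro ε hε
  obtain ⟨g, hgc, hfg, hgcont, hgi⟩ := hf.exists_hasCompactSupport_integral_sub_le
    (show 0 < ε / 4 by positivity)
  have hint : ∀ {f : Euc N → ℝ}, Integrable f → ∀ n, Integrable (moll ((φ n).normed volume) f) :=
    fun hf n => hf.integrable_convolution _ (hφi n)
  have hg : Tendsto (fun n => ∫ x, ‖moll ((φ n).normed volume) g x - g x‖) atTop (𝓝 0) := by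
    obtain ⟨C, hC⟩ := hgcont.bounded_above_of_compact_support hgc
    have hC0 : 0 ≤ C := (norm_nonneg _).trans (hC 0)
    let K := Metric.cthickening 1 (tsupport g)
    have hK : IsCompact K := hgc.isCompact.cthickening
    have : Tendsto (fun n => ∫ x, ‖moll ((φ n).normed volume) g x - g x‖) atTop
        (𝓝 (∫ _ : Euc N, (0 : ℝ))) := by
      refine tendsto_integral_filter_of_dominated_convergence (K.indicator fun _ => 2 * C)
        (Eventually.of_forall fun n => ((hint hgi n).sub hgi).norm.aestronglyMeasurable) ?_
        ((integrable_indicator_iff hK.measurableSet).2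
          (integrableOn_const hK.measure_lt_top.ne)) ?_
      · filter_upwards [hφ.eventually (gt_mem_nhds one_pos)] with n hn
        refine Eventually.of_forall fun x => ?_
        by_cases hx : x ∈ K
        · rw [indicator_of_mem hx, norm_norm]
          have : ‖moll ((φ n).normed volume) g x‖ ≤ C := by
            rw [moll_apply]
            refine (norm_integral_le_of_norm_le (((hφi n).comp_sub_left x).const_mul C)
              (Eventually.of_forall fun y => ?_)).trans_eq ?_
            · rw [norm_mul, Real.norm_of_nonneg ((φ n).nonneg_normed _)]
              exact mul_le_mul_of_nonneg_right (hC y) ((φ n).nonneg_normed _)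
            · rw [integral_const_mul, integral_sub_left_eq_self (fun y => (φ n).normed volume y),
                (φ n).integral_normed, mul_one]
          calc _ ≤ ‖moll ((φ n).normed volume) g x‖ + ‖g x‖ := norm_sub_le _ _
            _ ≤ 2 * C := by linarith [hC x]
        · have hgx : g x = 0 := by
            by_contra h
            exact hx (Metric.self_subset_cthickening _ (subset_tsupport _ h))
          have hm : moll ((φ n).normed volume) g x = 0 := by
            rw [moll_apply]
            refine integral_eq_zero_of_ae (Eventually.of_forall fun y => ?_)
            by_contra h
            have h1 : g y ≠ 0 := left_ne_zero_of_mul h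
            have h2 : x - y ∈ Function.support ((φ n).normed volume) := right_ne_zero_of_mul h
            rw [(φ n).support_normed_eq, mem_ball_zero_iff] at h2
            refine hx (Metric.mem_cthickening_of_dist_le x y _ _ (subset_tsupport _ h1) ?_)
            rw [dist_eq_norm]
            exact (h2.trans hn).le
          simp [indicator_of_notMem hx, hgx, hm]
      · refine Eventually.of_forall fun x => ?_
        have := ContDiffBump.convolution_tendsto_right_of_continuous (μ := volume) hφ hgcont x
        simp_rw [← moll_eq_convolution] at this
        simpa using (this.sub_const (g x)).norm
    simpa using this
  rw [Metric.tendsto_atTop] at hg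
  obtain ⟨n₀, hn₀⟩ := hg (ε / 4) (by positivity)
  refine ⟨n₀, fun n hn => ?_⟩
  have h1 := hn₀ n hn
  rw [Real.dist_0_eq_abs, abs_of_nonneg (integral_nonneg fun _ => norm_nonneg _)] at h1 ⊢
  have hD : Integrable fun x => f x - g x := hf.sub hgi
  have hA : Integrable fun x => ‖moll ((φ n).normed volume) (fun x => f x - g x) x‖ :=
    (hint hD n).norm
  have hB : Integrable fun x => ‖moll ((φ n).normed volume) g x - g x‖ :=
    ((hint hgi n).sub hgi).norm
  have hsub : ∀ x, moll ((φ n).normed volume) f x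
      = moll ((φ n).normed volume) (fun x => f x - g x) x + moll ((φ n).normed volume) g x := by
    intro x
    simp only [moll_apply]
    have hb : ∀ {u : Euc N → ℝ}, Integrable u →
        Integrable fun y => u y * (φ n).normed volume (x - y) := fun hu =>
      ((φ n).hasCompactSupport_normed.convolutionExists_right (ContinuousLinearMap.mul ℝ ℝ)
        hu.locallyIntegrable (φ n).continuous_normed x)
    rw [← integral_add (hb hD) (hb hgi)]
    exact integral_congr_ae (Eventually.of_forall fun y => by simp; ring)
  calc ∫ x, ‖moll ((φ n).normed volume) f x - f x‖
      ≤ ∫ x, ((‖moll ((φ n).normed volume) (fun x => f x - g x) x‖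
          + ‖moll ((φ n).normed volume) g x - g x‖) + ‖f x - g x‖) := by
        refine integral_mono ((hint hf n).sub hf).norm
          ((hA.add hB).add hD.norm) fun x => ?_
        dsimp only
        rw [hsub]
        have e : moll ((φ n).normed volume) (fun x => f x - g x) x
            + moll ((φ n).normed volume) g x - f x
            = moll ((φ n).normed volume) (fun x => f x - g x) x
              + (moll ((φ n).normed volume) g x - g x) - (f x - g x) := by ring
        rw [e]
        exact (norm_sub_le _ _).trans (add_le_add_left (norm_add_le _ _) _)
    _ = (∫ x, ‖moll ((φ n).normed volume) (fun x => f x - g x) x‖)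
          + (∫ x, ‖moll ((φ n).normed volume) g x - g x‖) + ∫ x, ‖f x - g x‖ := by
        have hAB : Integrable fun x => ‖moll ((φ n).normed volume) (fun x => f x - g x) x‖
            + ‖moll ((φ n).normed volume) g x - g x‖ := hA.add hB
        rw [integral_add hAB hD.norm, integral_add hA hB]
    _ < ε := by
        have := integral_norm_moll_le (φ := φ n) hD
        linarith

theorem contDiff_moll {ρ f : Euc N → ℝ} (hρ : ContDiff ℝ ∞ ρ) (hc : HasCompactSupport ρ)
    (hf : LocallyIntegrable f) : ContDiff ℝ ∞ (moll ρ f) :=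
  hc.contDiff_convolution_right (n := ⊤) _ hf hρ

theorem fderiv_moll {ρ f : Euc N → ℝ} (hρ : ContDiff ℝ 1 ρ) (hc : HasCompactSupport ρ)
    (hf : LocallyIntegrable f) (x v : Euc N) :
    fderiv ℝ (moll ρ f) x v = moll (fun y => fderiv ℝ ρ y v) f x := by
  have h := (hc.hasFDerivAt_convolution_right (ContinuousLinearMap.mul ℝ ℝ) hf hρ x).fderiv
  unfold moll
  rw [h, convolution_precompR_apply _ hf (hc.fderiv ℝ) (hρ.continuous_fderiv one_ne_zero)]

theorem laplacian_moll {ρ f : Euc N → ℝ} (hρ : ContDiff ℝ ∞ ρ) (hc : HasCompactSupport ρ)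
    (hf : LocallyIntegrable f) (x : Euc N) :
    (Laplacian.laplacian (moll ρ f) : Euc N → ℝ) x = moll (Laplacian.laplacian ρ) f x := by
  have hρ2 : ContDiff ℝ 2 ρ := contDiff_infty.1 hρ 2
  have hρ1 : ContDiff ℝ 1 ρ := contDiff_infty.1 hρ 1
  have hi : ∀ i : Fin N, ContDiff ℝ 1 fun y => fderiv ℝ ρ y (bvec i) := fun i =>
    (hρ2.fderiv_right (m := 1) (by norm_num)).clm_apply contDiff_const
  rw [laplacian_eq_sum (contDiff_infty.1 (contDiff_moll hρ hc hf) 2),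
    funext (laplacian_eq_sum hρ2)]
  simp_rw [fderiv_moll hρ1 hc hf]
  have h2 : ∀ i : Fin N, fderiv ℝ (moll (fun y => fderiv ℝ ρ y (bvec i)) f) x (bvec i)
      = moll (fun y => fderiv ℝ (fun y => fderiv ℝ ρ y (bvec i)) y (bvec i)) f x := fun i =>
    fderiv_moll (hi i) (hc.fderiv_apply ℝ _) hf x _
  rw [Finset.sum_congr rfl fun i _ => h2 i]
  simp_rw [moll_apply, Finset.mul_sum]
  rw [integral_finsetSum]
  intro i _
  exact ((hc.fderiv_apply ℝ (bvec i)).fderiv_apply ℝ (bvec i)).convolutionExists_right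
    (ContinuousLinearMap.mul ℝ ℝ) hf
    (((hi i).continuous_fderiv one_ne_zero).clm_apply continuous_const) x

theorem laplacian_comp_sub_left {ρ : Euc N → ℝ} (hρ : ContDiff ℝ 2 ρ) (x y : Euc N) :
    (Laplacian.laplacian (fun y => ρ (x - y)) : Euc N → ℝ) y
      = (Laplacian.laplacian ρ : Euc N → ℝ) (x - y) := by
  have key : ∀ {f : Euc N → ℝ}, Differentiable ℝ f → ∀ y v,
      fderiv ℝ (fun y => f (x - y)) y v = -fderiv ℝ f (x - y) v := fun {f} hf y v => by
    have h : HasFDerivAt (fun y => f (x - y)) _ y :=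
      (hf (x - y)).hasFDerivAt.comp y ((hasFDerivAt_const x y).sub (hasFDerivAt_id y))
    rw [h.fderiv]
    simp
  have hi : ∀ i : Fin N, Differentiable ℝ fun y => fderiv ℝ ρ y (bvec i) := fun i =>
    ((hρ.fderiv_right (m := 1) (by norm_num)).clm_apply contDiff_const).differentiable one_ne_zero
  rw [laplacian_eq_sum (f := fun y => ρ (x - y)) (hρ.comp (contDiff_const.sub contDiff_id)),
    laplacian_eq_sum hρ]
  refine Finset.sum_congr rfl fun i _ => ?_
  simp_rw [key (hρ.differentiable two_ne_zero)]
  have := key (hi i) y (bvec i)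
  rw [fderiv_fun_neg, neg_apply, this, neg_neg]

/-- Mollification commutes with the weak Laplacian away from the boundary. -/
theorem laplacian_moll_indicator {Ω K : Set (Euc N)} {U l : Euc N → ℝ}
    (hU : HasWeakLaplacian Ω U l) (hK : IsCompact K) (hKΩ : K ⊆ Ω)
    {ρ : Euc N → ℝ} (hρ : ContDiff ℝ ∞ ρ) (hc : HasCompactSupport ρ) {x : Euc N}
    (hx : ∀ y, x - y ∈ tsupport ρ → y ∈ K) :
    (Laplacian.laplacian (moll ρ (K.indicator U)) : Euc N → ℝ) x = moll ρ (K.indicator l) x := by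
  have hρ2 : ContDiff ℝ 2 ρ := contDiff_infty.1 hρ 2
  have hUi : Integrable (K.indicator U) := (integrable_indicator_iff hK.measurableSet).2
    (hU.locInt.integrableOn_compact_subset hKΩ hK)
  -- The shifted kernel is itself an admissible test function, since its support lies in `K`; the
  -- definition of the weak Laplacian then gives the claim.
  have htest : IsTestFunction Ω fun y => ρ (x - y) := by
    have hts : tsupport (fun y => ρ (x - y)) ⊆ K := by
      refine closure_minimal (fun y hy => hx y (subset_tsupport _ hy)) hK.isClosed
    exact ⟨hρ.comp (contDiff_const.sub contDiff_id),
      hK.of_isClosed_subset (isClosed_tsupport _) hts, hts.trans hKΩ⟩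
  rw [laplacian_moll hρ hc hUi.locallyIntegrable]
  have h := hU.integral_eq _ htest
  simp_rw [laplacian_comp_sub_left hρ2] at h
  simp only [moll_apply]
  have hsw : ∀ (u k : Euc N → ℝ), (∀ z, z ∉ tsupport ρ → k z = 0) →
      ∫ y, K.indicator u y * k (x - y) = ∫ y in Ω, u y * k (x - y) := fun u k hk => by
    rw [← setIntegral_eq_integral_of_forall_compl_eq_zero (s := Ω)]
    · refine integral_congr_ae (Eventually.of_forall fun y => ?_)
      dsimp only
      by_cases hy : y ∈ K
      · rw [indicator_of_mem hy]
      · rw [hk (x - y) fun h => hy (hx y h)]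
        simp
    · intro y hy
      rw [indicator_of_notMem fun h => hy (hKΩ h), zero_mul]
  rw [hsw U _ fun z hz => ?_, hsw l _ fun z hz => ?_, h]
  · simp_rw [mul_comm]
  · exact image_eq_zero_of_notMem_tsupport hz
  · exact image_eq_zero_of_notMem_tsupport fun h => hz (tsupport_laplacian_subset ρ h)

/-- Kato's inequality for convex functions of a function with a weak Laplacian. -/
theorem HasWeakLaplacian.integral_convex_comp {Ω : Set (Euc N)} (hΩ : IsOpen Ω)
    {U l : Euc N → ℝ} (hU : HasWeakLaplacian Ω U l) {η : Euc N → ℝ} (hη : IsTestFunction Ω η)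
    (hη0 : ∀ x, 0 ≤ η x) {j p p' : ℝ → ℝ} (hj : ∀ v, HasDerivAt j (p v) v)
    (hp : ∀ v, HasDerivAt p (p' v) v) (hp'c : Continuous p') (hp' : ∀ v, 0 ≤ p' v) {B : ℝ}
    (hB : ∀ v, |p v| ≤ B) :
    ∫ x in Ω, p (U x) * l x * η x
      ≤ ∫ x in Ω, j (U x) * (Laplacian.laplacian η : Euc N → ℝ) x := by
  have hη2 : ContDiff ℝ 2 η := contDiff_infty.1 hη.contDiff 2
  have hpc : Continuous p := continuous_iff_continuousAt.2 fun v => (hp v).continuousAt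
  have hjc : Continuous j := continuous_iff_continuousAt.2 fun v => (hj v).continuousAt
  have hB0 : 0 ≤ B := (abs_nonneg _).trans (hB 0)
  -- Room between the support of `η` and the boundary: at points of that support, a mollifier of
  -- radius below `δ` sees only values in `K`, where `U` and `l` are integrable.
  obtain ⟨δ, hδ, hδΩ⟩ := hη.hasCompactSupport.isCompact.exists_cthickening_subset_open hΩ
    hη.tsupport_subset
  set K := Metric.cthickening δ (tsupport η) with hKdef
  have hK : IsCompact K := hη.hasCompactSupport.isCompact.cthickening
  have hKη : tsupport η ⊆ K := Metric.self_subset_cthickening _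
  set U₁ := K.indicator U
  set l₁ := K.indicator l
  have hU₁ : Integrable U₁ := (integrable_indicator_iff hK.measurableSet).2
    (hU.locInt.integrableOn_compact_subset hδΩ hK)
  have hl₁ : Integrable l₁ := (integrable_indicator_iff hK.measurableSet).2
    (hU.locInt_lap.integrableOn_compact_subset hδΩ hK)
  -- The ratio of outer to inner radius is fixed at `2`; almost everywhere convergence of the
  -- mollifications needs this ratio to stay bounded.
  let φ : ℕ → ContDiffBump (0 : Euc N) := fun n =>
    ⟨1 / ((n : ℝ) + 1) / 2, 1 / ((n : ℝ) + 1), by positivity,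
      half_lt_self (by positivity)⟩
  have hφ : Tendsto (fun n => (φ n).rOut) atTop (𝓝 0) :=
    tendsto_one_div_add_atTop_nhds_zero_nat
  set Un : ℕ → Euc N → ℝ := fun n => moll ((φ n).normed volume) U₁
  set ln : ℕ → Euc N → ℝ := fun n => moll ((φ n).normed volume) l₁
  have hUnC : ∀ n, ContDiff ℝ ∞ (Un n) := fun n =>
    contDiff_moll (φ n).contDiff_normed (φ n).hasCompactSupport_normed hU₁.locallyIntegrable
  have hlnC : ∀ n, Continuous (ln n) := fun n =>
    (contDiff_moll (φ n).contDiff_normed (φ n).hasCompactSupport_normed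
      hl₁.locallyIntegrable).continuous
  have hUni : ∀ n, Integrable (Un n) := fun n => hU₁.integrable_convolution _ (φ n).integrable_normed
  have hlni : ∀ n, Integrable (ln n) := fun n => hl₁.integrable_convolution _ (φ n).integrable_normed
  have hUn := tendsto_integral_norm_moll_sub hφ hU₁
  have hln := tendsto_integral_norm_moll_sub hφ hl₁
  have hUae : ∀ᵐ x, Tendsto (fun n => Un n x) atTop (𝓝 (U₁ x)) := by
    have := ContDiffBump.ae_convolution_tendsto_right_of_locallyIntegrable (μ := volume) (K := 2)
      hφ (Eventually.of_forall fun n => by simp only [φ]; linarith) hU₁.locallyIntegrable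
    simpa only [← moll_eq_convolution] using this
  obtain ⟨Cη, hCη⟩ := hη2.continuous.bounded_above_of_compact_support hη.hasCompactSupport
  have hLc := continuous_laplacian hη2
  have hLs := hasCompactSupport_laplacian hη.hasCompactSupport
  obtain ⟨CL, hCL⟩ := hLc.bounded_above_of_compact_support hLs
  have hCη0 : 0 ≤ Cη := (norm_nonneg _).trans (hCη 0)
  have hCL0 : 0 ≤ CL := (norm_nonneg _).trans (hCL 0)
  have hjL : LipschitzWith B.toNNReal j := by
    refine lipschitzWith_of_nnnorm_deriv_le (fun v => (hj v).differentiableAt) fun v => ?_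
    rw [(hj v).deriv, ← NNReal.coe_le_coe, coe_nnnorm, Real.coe_toNNReal _ hB0]
    exact hB v
  have hjL' : ∀ a b, |j a - j b| ≤ B * |a - b| := fun a b => by
    simpa [Real.dist_eq, Real.coe_toNNReal _ hB0] using hjL.dist_le_mul a b
  -- the inequality for the mollified functions
  have hineq : ∀ᶠ n in atTop, ∫ x, p (Un n x) * ln n x * η x
      ≤ ∫ x, j (Un n x) * (Laplacian.laplacian η : Euc N → ℝ) x := by
    filter_upwards [hφ.eventually (gt_mem_nhds hδ)] with n hn
    refine le_trans (le_of_eq ?_) (integral_convex_comp_smooth (contDiff_infty.1 (hUnC n) 2) hη2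
      hη.hasCompactSupport hη0 hj hp hp'c hp')
    refine integral_congr_ae (Eventually.of_forall fun x => ?_)
    by_cases hx : x ∈ tsupport η
    · dsimp only
      rw [laplacian_moll_indicator hU hK hδΩ (φ n).contDiff_normed (φ n).hasCompactSupport_normed]
      intro y hy
      rw [(φ n).tsupport_normed_eq, mem_closedBall_zero_iff] at hy
      refine Metric.mem_cthickening_of_dist_le y x _ _ hx ?_
      rw [dist_comm, dist_eq_norm]
      exact hy.trans hn.le
    · simp [image_eq_zero_of_notMem_tsupport hx]
  have hjint : ∀ {V : Euc N → ℝ}, Integrable V →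
      Integrable fun x => j (V x) * (Laplacian.laplacian η : Euc N → ℝ) x := fun {V} hV => by
    refine Integrable.mono' (g := fun x => |j 0| * ‖(Laplacian.laplacian η : Euc N → ℝ) x‖
      + B * CL * ‖V x‖) ?_ ?_ (Eventually.of_forall fun x => ?_)
    · exact ((hLc.integrable_of_hasCompactSupport hLs).norm.const_mul _).add (hV.norm.const_mul _)
    · exact (hjc.comp_aestronglyMeasurable hV.aestronglyMeasurable).mul hLc.aestronglyMeasurable
    · have h1 : |j (V x)| ≤ |j 0| + B * |V x| := by
        have := hjL' (V x) 0
        rw [sub_zero] at this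
        calc |j (V x)| = |j 0 + (j (V x) - j 0)| := by ring_nf
          _ ≤ _ := (abs_add_le _ _).trans (by linarith)
      rw [norm_mul, Real.norm_eq_abs, Real.norm_eq_abs (V x)]
      calc _ ≤ (|j 0| + B * |V x|) * ‖(Laplacian.laplacian η : Euc N → ℝ) x‖ := by gcongr
        _ = |j 0| * ‖(Laplacian.laplacian η : Euc N → ℝ) x‖
            + B * |V x| * ‖(Laplacian.laplacian η : Euc N → ℝ) x‖ := by ring
        _ ≤ |j 0| * ‖(Laplacian.laplacian η : Euc N → ℝ) x‖ + B * |V x| * CL := by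
            gcongr
            exact hCL x
        _ = _ := by ring
  have hpint : ∀ {V k : Euc N → ℝ}, AEStronglyMeasurable V volume → Integrable k →
      Integrable fun x => p (V x) * k x * η x := fun {V k} hV hk => by
    refine Integrable.mono' (g := fun x => B * Cη * ‖k x‖) (hk.norm.const_mul _)
      (((hpc.comp_aestronglyMeasurable hV).mul hk.aestronglyMeasurable).mul
        hη2.continuous.aestronglyMeasurable) (Eventually.of_forall fun x => ?_)
    rw [norm_mul, norm_mul, mul_right_comm]
    have := hCη x
    have := hB (V x)
    rw [← Real.norm_eq_abs] at this
    gcongr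
  have hR : Tendsto (fun n => ∫ x, j (Un n x) * (Laplacian.laplacian η : Euc N → ℝ) x) atTop
      (𝓝 (∫ x, j (U₁ x) * (Laplacian.laplacian η : Euc N → ℝ) x)) := by
    rw [tendsto_iff_dist_tendsto_zero]
    refine squeeze_zero (fun _ => dist_nonneg) (fun n => ?_) (by simpa using hUn.const_mul (B * CL))
    rw [dist_eq_norm, ← integral_sub (hjint (hUni n)) (hjint hU₁), ← integral_const_mul]
    simp_rw [← Real.norm_eq_abs]
    refine norm_integral_le_of_norm_le (((hUni n).sub hU₁).norm.const_mul _)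
      (Eventually.of_forall fun x => ?_)
    rw [← sub_mul, norm_mul]
    calc _ ≤ (B * |Un n x - U₁ x|) * CL := mul_le_mul (hjL' _ _) (hCL x) (norm_nonneg _)
          (by positivity)
      _ = B * CL * ‖Un n x - U₁ x‖ := by rw [Real.norm_eq_abs]; ring
  -- The limit of `p(Uₙ) lₙ` is taken in two moves: `lₙ → l₁` in `L¹` against the bounded factor
  -- `p(Uₙ)`, then dominated convergence of `p(Uₙ)` against the fixed function `l₁`.
  have hL1 : Tendsto (fun n => ∫ x, p (Un n x) * (ln n x - l₁ x) * η x) atTop (𝓝 0) := by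
    refine squeeze_zero_norm (fun n => ?_) (by simpa using hln.const_mul (B * Cη))
    rw [← integral_const_mul]
    refine norm_integral_le_of_norm_le (((hlni n).sub hl₁).norm.const_mul _)
      (Eventually.of_forall fun x => ?_)
    rw [norm_mul, norm_mul, mul_right_comm]
    have := hCη x
    have := hB (Un n x)
    rw [← Real.norm_eq_abs] at this
    gcongr
    rfl
  have hL2 : Tendsto (fun n => ∫ x, p (Un n x) * l₁ x * η x) atTop
      (𝓝 (∫ x, p (U₁ x) * l₁ x * η x)) := by
    refine tendsto_integral_of_dominated_convergence (fun x => B * Cη * ‖l₁ x‖)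
      (fun n => (hpint (hUni n).aestronglyMeasurable hl₁).aestronglyMeasurable)
      (hl₁.norm.const_mul _) (fun n => Eventually.of_forall fun x => ?_) ?_
    · rw [norm_mul, norm_mul, mul_right_comm]
      have := hCη x
      have := hB (Un n x)
      rw [← Real.norm_eq_abs] at this
      gcongr
    · filter_upwards [hUae] with x hx
      exact (((hpc.tendsto _).comp hx).mul_const _).mul_const _
  have hL : Tendsto (fun n => ∫ x, p (Un n x) * ln n x * η x) atTop
      (𝓝 (∫ x, p (U₁ x) * l₁ x * η x)) := by
    have := hL1.add hL2
    rw [zero_add] at this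
    refine this.congr fun n => ?_
    have hd : Integrable fun x => ln n x - l₁ x := (hlni n).sub hl₁
    rw [← integral_add (hpint (hUni n).aestronglyMeasurable hd)
      (hpint (hUni n).aestronglyMeasurable hl₁)]
    exact integral_congr_ae (Eventually.of_forall fun x => by simp; ring)
  have hfin := le_of_tendsto_of_tendsto hL hR hineq
  have e1 : ∫ x, p (U₁ x) * l₁ x * η x = ∫ x in Ω, p (U x) * l x * η x := by
    rw [← setIntegral_eq_integral_of_forall_compl_eq_zero (s := Ω)]
    · refine integral_congr_ae (Eventually.of_forall fun x => ?_)
      by_cases hx : x ∈ tsupport η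
      · simp [U₁, l₁, indicator_of_mem (hKη hx)]
      · simp [image_eq_zero_of_notMem_tsupport hx]
    · intro x hx
      simp [image_eq_zero_of_notMem_tsupport fun h => hx (hη.tsupport_subset h)]
  have e2 : ∫ x, j (U₁ x) * (Laplacian.laplacian η : Euc N → ℝ) x
      = ∫ x in Ω, j (U x) * (Laplacian.laplacian η : Euc N → ℝ) x := by
    have hz : ∀ x, x ∉ tsupport η → (Laplacian.laplacian η : Euc N → ℝ) x = 0 := fun x hx =>
      image_eq_zero_of_notMem_tsupport fun h => hx (tsupport_laplacian_subset η h)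
    rw [← setIntegral_eq_integral_of_forall_compl_eq_zero (s := Ω)]
    · refine integral_congr_ae (Eventually.of_forall fun x => ?_)
      by_cases hx : x ∈ tsupport η
      · simp [U₁, indicator_of_mem (hKη hx)]
      · simp [hz x hx]
    · intro x hx
      simp [hz x fun h => hx (hη.tsupport_subset h)]
  rwa [e1, e2] at hfin

end EinsteinModel
end

/-! ### Limits of products in `L²`; chain rule and Poincaré inequality in `W₀^{1,2}` -/

noncomputable section

namespace EinsteinModel

variable {N : ℕ}

theorem eLpNorm_inner_le {α E : Type*} [MeasurableSpace α] {μ : Measure α}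
    [NormedAddCommGroup E] [InnerProductSpace ℝ E] {X Y : α → E}
    (hX : AEStronglyMeasurable X μ) (hY : AEStronglyMeasurable Y μ) :
    eLpNorm (fun x => inner ℝ (X x) (Y x)) 1 μ ≤ eLpNorm X 2 μ * eLpNorm Y 2 μ := by
  have := eLpNorm_le_eLpNorm_mul_eLpNorm'_of_norm (p := 2) (q := 2) (r := 1) hX hY
    (fun a b => inner ℝ a b) 1 (Eventually.of_forall fun x => by
      simpa using norm_inner_le_norm (𝕜 := ℝ) (X x) (Y x))
  simpa using this

/-- Products of `L²`-convergent sequences, weighted by bounded and almost everywhere convergent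
factors, converge in `L¹`. -/
theorem tendsto_integral_abs_mul_inner_sub {α E : Type*} [MeasurableSpace α] {μ : Measure α}
    [NormedAddCommGroup E] [InnerProductSpace ℝ E] {X Y : ℕ → α → E} {X₀ Y₀ : α → E}
    {β : ℕ → α → ℝ} {β₀ : α → ℝ} {L : ℝ}
    (hX : ∀ n, MemLp (X n) 2 μ) (hX₀ : MemLp X₀ 2 μ) (hY : ∀ n, MemLp (Y n) 2 μ)
    (hY₀ : MemLp Y₀ 2 μ)
    (hXt : Tendsto (fun n => eLpNorm (fun x => X n x - X₀ x) 2 μ) atTop (𝓝 0))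
    (hYt : Tendsto (fun n => eLpNorm (fun x => Y n x - Y₀ x) 2 μ) atTop (𝓝 0))
    (hβm : ∀ n, AEStronglyMeasurable (β n) μ) (hβ : ∀ n, ∀ᵐ x ∂μ, |β n x| ≤ L)
    (hβt : ∀ᵐ x ∂μ, Tendsto (fun n => β n x) atTop (𝓝 (β₀ x))) :
    (∀ n, Integrable (fun x => β n x * inner ℝ (X n x) (Y n x)) μ) ∧
    Integrable (fun x => β₀ x * inner ℝ (X₀ x) (Y₀ x)) μ ∧
    Tendsto (fun n => ∫ x, |β n x * inner ℝ (X n x) (Y n x)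
      - β₀ x * inner ℝ (X₀ x) (Y₀ x)| ∂μ) atTop (𝓝 0) := by
  have hint : ∀ {A B : α → E}, MemLp A 2 μ → MemLp B 2 μ →
      Integrable (fun x => inner ℝ (A x) (B x)) μ := fun {A B} hA hB => by
    rw [← memLp_one_iff_integrable]
    refine ⟨hA.aestronglyMeasurable.inner hB.aestronglyMeasurable, ?_⟩
    exact (eLpNorm_inner_le hA.aestronglyMeasurable hB.aestronglyMeasurable).trans_lt
      (ENNReal.mul_lt_top hA.eLpNorm_lt_top hB.eLpNorm_lt_top)
  have hβ₀ : ∀ᵐ x ∂μ, |β₀ x| ≤ L := by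
    filter_upwards [hβt, ae_all_iff.2 hβ] with x hx hb
    exact le_of_tendsto hx.abs (Eventually.of_forall hb)
  have hβ₀m : AEStronglyMeasurable β₀ μ := aestronglyMeasurable_of_tendsto_ae atTop hβm hβt
  have hbm : ∀ {b k : α → ℝ}, AEStronglyMeasurable b μ → (∀ᵐ x ∂μ, |b x| ≤ L) → Integrable k μ →
      Integrable (fun x => b x * k x) μ := fun hb hbL hk => hk.bdd_mul hb hbL
  have h1 := fun n => hbm (hβm n) (hβ n) (hint (hX n) (hY n))
  have h2 := hbm hβ₀m hβ₀ (hint hX₀ hY₀)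
  refine ⟨h1, h2, ?_⟩
  have hXs : ∀ n, MemLp (fun x => X n x - X₀ x) 2 μ := fun n => (hX n).sub hX₀
  have hYs : ∀ n, MemLp (fun x => Y n x - Y₀ x) 2 μ := fun n => (hY n).sub hY₀
  -- the differences of the inner products tend to zero in `L¹`
  have hA : Tendsto (fun n => ∫ x, |inner ℝ (X n x - X₀ x) (Y n x - Y₀ x)| ∂μ) atTop (𝓝 0) ∧
      Tendsto (fun n => ∫ x, |inner ℝ (X n x - X₀ x) (Y₀ x)| ∂μ) atTop (𝓝 0) ∧
      Tendsto (fun n => ∫ x, |inner ℝ (X₀ x) (Y n x - Y₀ x)| ∂μ) atTop (𝓝 0) := by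
    have key : ∀ {A B : ℕ → α → E}, (∀ n, MemLp (A n) 2 μ) → (∀ n, MemLp (B n) 2 μ) →
        Tendsto (fun n => eLpNorm (A n) 2 μ * eLpNorm (B n) 2 μ) atTop (𝓝 0) →
        Tendsto (fun n => ∫ x, |inner ℝ (A n x) (B n x)| ∂μ) atTop (𝓝 0) := by
      intro A B hA hB ht
      have h3 : Tendsto (fun n => eLpNorm (fun x => inner ℝ (A n x) (B n x)) 1 μ) atTop (𝓝 0) :=
        tendsto_of_tendsto_of_tendsto_of_le_of_le tendsto_const_nhds ht (fun _ => zero_le)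
          fun n => eLpNorm_inner_le (hA n).aestronglyMeasurable (hB n).aestronglyMeasurable
      have h4 := (ENNReal.tendsto_toReal ENNReal.zero_ne_top).comp h3
      rw [ENNReal.toReal_zero] at h4
      refine h4.congr fun n => ?_
      simp_rw [Function.comp_apply, ← Real.norm_eq_abs]
      rw [integral_norm_eq_lintegral_enorm (hint (hA n) (hB n)).aestronglyMeasurable,
        eLpNorm_one_eq_lintegral_enorm]
    refine ⟨key hXs hYs ?_, key hXs (fun _ => hY₀) ?_, key (fun _ => hX₀) hYs ?_⟩
    · simpa using ENNReal.Tendsto.mul hXt (Or.inr ENNReal.zero_ne_top) hYt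
        (Or.inr ENNReal.zero_ne_top)
    · simpa using ENNReal.Tendsto.mul_const hXt (Or.inr hY₀.eLpNorm_ne_top)
    · simpa using ENNReal.Tendsto.const_mul hYt (Or.inr hX₀.eLpNorm_ne_top)
  -- The weights converge only almost everywhere, so their difference is paired with the fixed
  -- integrable function `⟨X₀, Y₀⟩`, where dominated convergence applies.
  have hB : Tendsto (fun n => ∫ x, |(β n x - β₀ x) * inner ℝ (X₀ x) (Y₀ x)| ∂μ) atTop (𝓝 0) := by
    have : Tendsto (fun n => ∫ x, |(β n x - β₀ x) * inner ℝ (X₀ x) (Y₀ x)| ∂μ) atTop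
        (𝓝 (∫ _, (0 : ℝ) ∂μ)) := by
      refine tendsto_integral_of_dominated_convergence
        (fun x => 2 * L * |inner ℝ (X₀ x) (Y₀ x)|) (fun n => ?_)
        ((hint hX₀ hY₀).abs.const_mul _) (fun n => ?_) ?_
      · exact (((hβm n).sub hβ₀m).mul (hint hX₀ hY₀).aestronglyMeasurable).norm
      · filter_upwards [hβ n, hβ₀] with x hx hx0
        rw [Real.norm_eq_abs, abs_abs, abs_mul]
        refine mul_le_mul_of_nonneg_right ?_ (abs_nonneg _)
        exact (abs_sub _ _).trans (by linarith)
      · filter_upwards [hβt] with x hx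
        have := ((hx.sub_const (β₀ x)).mul_const (inner ℝ (X₀ x) (Y₀ x))).abs
        simpa using this
    simpa using this
  have hsum := (((hA.1.add hA.2.1).add hA.2.2).const_mul L).add hB
  simp only [add_zero, mul_zero] at hsum
  refine squeeze_zero (fun n => integral_nonneg fun x => abs_nonneg _) (fun n => ?_) hsum
  have i1 := (hint (hXs n) (hYs n)).abs
  have i2 := (hint (hXs n) hY₀).abs
  have i3 := (hint hX₀ (hYs n)).abs
  have i12 : Integrable (fun x => |inner ℝ (X n x - X₀ x) (Y n x - Y₀ x)|
    + |inner ℝ (X n x - X₀ x) (Y₀ x)|) μ := i1.add i2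
  have i123 : Integrable (fun x => |inner ℝ (X n x - X₀ x) (Y n x - Y₀ x)|
    + |inner ℝ (X n x - X₀ x) (Y₀ x)| + |inner ℝ (X₀ x) (Y n x - Y₀ x)|) μ := i12.add i3
  have i4 : Integrable (fun x => |(β n x - β₀ x) * inner ℝ (X₀ x) (Y₀ x)|) μ := by
    have h3 := (hbm (hβm n) (hβ n) (hint hX₀ hY₀)).sub h2
    refine h3.abs.congr (Eventually.of_forall fun x => ?_)
    simp [sub_mul]
  rw [← integral_add i1 i2, ← integral_add i12 i3, ← integral_const_mul,
    ← integral_add (i123.const_mul L) i4]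
  refine integral_mono_ae ((h1 n).sub h2).abs ((i123.const_mul L).add i4) ?_
  filter_upwards [hβ n] with x hx
  have hL : 0 ≤ L := (abs_nonneg _).trans hx
  have e : β n x * inner ℝ (X n x) (Y n x) - β₀ x * inner ℝ (X₀ x) (Y₀ x)
      = β n x * (inner ℝ (X n x - X₀ x) (Y n x - Y₀ x) + inner ℝ (X n x - X₀ x) (Y₀ x)
        + inner ℝ (X₀ x) (Y n x - Y₀ x)) + (β n x - β₀ x) * inner ℝ (X₀ x) (Y₀ x) := by
    simp only [inner_sub_left, inner_sub_right]
    ring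
  rw [e]
  refine (abs_add_le _ _).trans (add_le_add_left ?_ _)
  rw [abs_mul]
  exact mul_le_mul hx (abs_add_three _ _ _) (abs_nonneg _) hL

/-- Smooth approximation of an element of `W₀^{1,2}(Ω)` together with its gradient. -/
structure ApproxW012 (Ω : Set (Euc N)) (V : Euc N → ℝ) (g : Euc N → Euc N)
    (φ : ℕ → Euc N → ℝ) : Prop where
  test : ∀ n, IsTestFunction Ω (φ n)
  memLp : MemLp V 2 (volume.restrict Ω)
  memLp_grad : MemLp g 2 (volume.restrict Ω)
  tendsto : Tendsto (fun n => eLpNorm (fun x => φ n x - V x) 2 (volume.restrict Ω)) atTop (𝓝 0)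
  tendsto_grad : Tendsto (fun n => eLpNorm (fun x => gradient (φ n) x - g x) 2
    (volume.restrict Ω)) atTop (𝓝 0)
  ae_tendsto : ∀ᵐ x ∂volume.restrict Ω, Tendsto (fun n => φ n x) atTop (𝓝 (V x))

theorem IsTestFunction.memLp {Ω : Set (Euc N)} {φ : Euc N → ℝ} (hφ : IsTestFunction Ω φ) :
    MemLp φ 2 (volume.restrict Ω) :=
  (hφ.contDiff.continuous.memLp_of_hasCompactSupport hφ.hasCompactSupport).restrict _

theorem IsTestFunction.memLp_gradient {Ω : Set (Euc N)} {φ : Euc N → ℝ}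
    (hφ : IsTestFunction Ω φ) : MemLp (gradient φ) 2 (volume.restrict Ω) :=
  ((continuous_gradient (contDiff_infty.1 hφ.contDiff 1)).memLp_of_hasCompactSupport
    (hasCompactSupport_gradient hφ.hasCompactSupport)).restrict _

/-- Convergence in `L²` implies convergence in measure, so a subsequence also converges almost
everywhere; this is what handles the nonlinear factors `q(φₙ)`. -/
theorem MemW012.exists_approx {Ω : Set (Euc N)} {V : Euc N → ℝ} (hV : MemW012 Ω V) :
    ∃ g φ, ApproxW012 Ω V g φ := by
  obtain ⟨g, -, hV2, hg2, happ⟩ := hV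
  have hpos : ∀ n : ℕ, (0 : ENNReal) < ((n : ENNReal) + 1)⁻¹ := fun n =>
    ENNReal.inv_pos.2 (by finiteness)
  choose φ hφ hφ1 hφ2 using fun n : ℕ => happ _ (hpos n)
  have hlim : Tendsto (fun n : ℕ => ((n : ENNReal) + 1)⁻¹) atTop (𝓝 0) := by
    have := (tendsto_add_atTop_iff_nat 1).2 ENNReal.tendsto_inv_nat_nhds_zero
    exact_mod_cast this
  have t1 : Tendsto (fun n => eLpNorm (fun x => φ n x - V x) 2 (volume.restrict Ω)) atTop (𝓝 0) := by
    refine tendsto_of_tendsto_of_tendsto_of_le_of_le tendsto_const_nhds hlim (fun _ => zero_le)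
      fun n => ?_
    have e : (fun x => φ n x - V x) = φ n - V := rfl
    rw [e, eLpNorm_sub_comm]
    exact (hφ1 n).le
  have t2 : Tendsto (fun n => eLpNorm (fun x => gradient (φ n) x - g x) 2 (volume.restrict Ω))
      atTop (𝓝 0) := by
    refine tendsto_of_tendsto_of_tendsto_of_le_of_le tendsto_const_nhds hlim (fun _ => zero_le)
      fun n => ?_
    have e : (fun x => gradient (φ n) x - g x) = gradient (φ n) - g := rfl
    rw [e, eLpNorm_sub_comm]
    exact (hφ2 n).le
  have hm := tendstoInMeasure_of_tendsto_eLpNorm (p := 2) two_ne_zero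
    (fun n => (hφ n).memLp.aestronglyMeasurable) hV2.aestronglyMeasurable t1
  obtain ⟨ns, hns, hae⟩ := hm.exists_seq_tendsto_ae
  exact ⟨g, fun n => φ (ns n), fun n => hφ _, hV2, hg2, t1.comp hns.tendsto_atTop,
    t2.comp hns.tendsto_atTop, hae⟩

theorem tendsto_integral_of_tendsto_integral_abs_sub {α : Type*} [MeasurableSpace α]
    {μ : Measure α} {f : ℕ → α → ℝ} {f₀ : α → ℝ} (hf : ∀ n, Integrable (f n) μ)
    (hf₀ : Integrable f₀ μ) (h : Tendsto (fun n => ∫ x, |f n x - f₀ x| ∂μ) atTop (𝓝 0)) :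
    Tendsto (fun n => ∫ x, f n x ∂μ) atTop (𝓝 (∫ x, f₀ x ∂μ)) := by
  rw [tendsto_iff_dist_tendsto_zero]
  refine squeeze_zero (fun _ => dist_nonneg) (fun n => ?_) h
  rw [dist_eq_norm, ← integral_sub (hf n) hf₀]
  exact norm_integral_le_integral_norm _

theorem abs_sub_le_of_hasDerivAt {Q q : ℝ → ℝ} {L : ℝ} (hQ : ∀ v, HasDerivAt Q (q v) v)
    (hL : ∀ v, |q v| ≤ L) (a b : ℝ) : |Q a - Q b| ≤ L * |a - b| := by
  have := Convex.norm_image_sub_le_of_norm_hasDerivWithin_le (f := Q) (f' := q) (s := univ)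
    (fun v _ => (hQ v).hasDerivWithinAt) (fun v _ => hL v) convex_univ (mem_univ b) (mem_univ a)
  simpa using this

theorem memLp_comp_of_lipschitz {α : Type*} [MeasurableSpace α] {μ : Measure α}
    [IsFiniteMeasure μ] {Q : ℝ → ℝ} {L : ℝ} (hQ : ∀ a b, |Q a - Q b| ≤ L * |a - b|)
    {V : α → ℝ} (hV : MemLp V 2 μ) : MemLp (fun x => Q (V x)) 2 μ := by
  have hQc : Continuous Q := by
    have hL : LipschitzWith L.toNNReal Q := LipschitzWith.of_dist_le_mul fun a b => by
      rw [Real.dist_eq, Real.dist_eq]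
      exact (hQ a b).trans (mul_le_mul_of_nonneg_right (Real.le_coe_toNNReal L) (abs_nonneg _))
    exact hL.continuous
  have h1 : MemLp (fun x => Q (V x) - Q 0) 2 μ := by
    refine MemLp.of_le_mul (c := L) hV ?_ (Eventually.of_forall fun x => ?_)
    · exact (hQc.comp_aestronglyMeasurable hV.aestronglyMeasurable).sub aestronglyMeasurable_const
    · simpa using hQ (V x) 0
  have h2 : MemLp (fun x => Q (V x) - Q 0 + Q 0) 2 μ := h1.add (memLp_const (Q 0))
  simpa using h2

section Composition

variable {Ω : Set (Euc N)} {V : Euc N → ℝ}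
  {g : Euc N → Euc N} {φ : ℕ → Euc N → ℝ}

theorem ApproxW012.tendsto_comp (hA : ApproxW012 Ω V g φ) {Q : ℝ → ℝ} {L : ℝ}
    (hQ : ∀ a b, |Q a - Q b| ≤ L * |a - b|) :
    Tendsto (fun n => eLpNorm (fun x => Q (φ n x) - Q (V x)) 2 (volume.restrict Ω)) atTop
      (𝓝 0) := by
  have h := ENNReal.Tendsto.const_mul (a := ENNReal.ofReal L) hA.tendsto
    (Or.inr ENNReal.ofReal_ne_top)
  rw [mul_zero] at h
  refine tendsto_of_tendsto_of_tendsto_of_le_of_le tendsto_const_nhds h (fun _ => zero_le)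
    fun n => ?_
  exact eLpNorm_le_mul_eLpNorm_of_ae_le_mul (Eventually.of_forall fun x => hQ _ _) 2

theorem ApproxW012.aestronglyMeasurable_comp (hA : ApproxW012 Ω V g φ) {q : ℝ → ℝ}
    (hq : Continuous q) (n : ℕ) :
    AEStronglyMeasurable (fun x => q (φ n x)) (volume.restrict Ω) :=
  (hq.comp (hA.test n).contDiff.continuous).aestronglyMeasurable

theorem ApproxW012.ae_tendsto_comp (hA : ApproxW012 Ω V g φ) {q : ℝ → ℝ} (hq : Continuous q) :
    ∀ᵐ x ∂volume.restrict Ω, Tendsto (fun n => q (φ n x)) atTop (𝓝 (q (V x))) := by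
  filter_upwards [hA.ae_tendsto] with x hx using (hq.tendsto _).comp hx

theorem IsTestFunction.poincare_comp (hN : 0 < N) {ψ : Euc N → ℝ} (hψ : IsTestFunction Ω ψ)
    {Q q : ℝ → ℝ} (hQ : ∀ v, HasDerivAt Q (q v) v) (hq : Continuous q) (hQ0 : Q 0 = 0)
    {R : ℝ} (hR : ∀ x ∈ Ω, ‖x‖ ≤ R) :
    ∫ x in Ω, Q (ψ x) ^ 2 ≤ 4 * R ^ 2 * ∫ x in Ω, q (ψ x) ^ 2 * ‖gradient ψ x‖ ^ 2 := by
  have hQ1 : ContDiff ℝ 1 Q := by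
    rw [contDiff_one_iff_deriv, show deriv Q = q from funext fun v => (hQ v).deriv]
    exact ⟨fun v => (hQ v).differentiableAt, hq⟩
  have hψ1 := contDiff_infty.1 hψ.contDiff 1
  have hc := hψ.hasCompactSupport.comp_left hQ0
  have hts : tsupport (Q ∘ ψ) ⊆ tsupport ψ := closure_mono fun x hx => by
    simp only [Function.mem_support, Function.comp_apply] at hx ⊢
    contrapose! hx
    rw [hx, hQ0]
  have hψ0 : ∀ x, x ∉ Ω → ψ x = 0 := fun x hx =>
    image_eq_zero_of_notMem_tsupport fun h => hx (hψ.tsupport_subset h)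
  have hg0 : ∀ x, x ∉ Ω → gradient ψ x = 0 := fun x hx => by
    have : fderiv ℝ ψ x = 0 := image_eq_zero_of_notMem_tsupport fun h =>
      hx (hψ.tsupport_subset (tsupport_fderiv_subset ℝ h))
    simp [gradient, this]
  have h := poincare_smooth hN (hQ1.comp hψ1) hc
    (fun x hx => hR x (hψ.tsupport_subset (hts hx)))
  simp only [Function.comp_def] at h
  simp_rw [gradient_comp (hψ1.differentiable one_ne_zero) hQ, norm_smul, mul_pow,
    Real.norm_eq_abs, sq_abs] at h
  have e1 := setIntegral_eq_integral_of_forall_compl_eq_zero (μ := volume) (s := Ω)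
    (f := fun x => Q (ψ x) ^ 2) fun x hx => by simp [hψ0 x hx, hQ0]
  have e2 := setIntegral_eq_integral_of_forall_compl_eq_zero (μ := volume) (s := Ω)
    (f := fun x => q (ψ x) ^ 2 * ‖gradient ψ x‖ ^ 2) fun x hx => by simp [hg0 x hx]
  rwa [e1, e2]

variable [IsFiniteMeasure (volume.restrict Ω)]

/-- The chain rule for `Q(V)`, tested against a Laplacian. -/
theorem ApproxW012.integral_comp_mul_laplacian (hA : ApproxW012 Ω V g φ) {Q q : ℝ → ℝ} {L : ℝ}
    (hQ : ∀ v, HasDerivAt Q (q v) v) (hq : Continuous q) (hL : ∀ v, |q v| ≤ L)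
    {η : Euc N → ℝ} (hη : IsTestFunction Ω η) :
    ∫ x in Ω, Q (V x) * (Laplacian.laplacian η : Euc N → ℝ) x
      = -∫ x in Ω, q (V x) * inner ℝ (g x) (gradient η x) := by
  have hQL := abs_sub_le_of_hasDerivAt hQ hL
  have hη2 : ContDiff ℝ 2 η := contDiff_infty.1 hη.contDiff 2
  have hLap : MemLp (Laplacian.laplacian η : Euc N → ℝ) 2 (volume.restrict Ω) :=
    ((continuous_laplacian hη2).memLp_of_hasCompactSupport
      (hasCompactSupport_laplacian hη.hasCompactSupport)).restrict _
  have hQ1 : ContDiff ℝ 1 Q := by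
    rw [contDiff_one_iff_deriv, show deriv Q = q from funext fun v => (hQ v).deriv]
    exact ⟨fun v => (hQ v).differentiableAt, hq⟩
  have hη0 : ∀ x, x ∉ Ω → (Laplacian.laplacian η : Euc N → ℝ) x = 0 := fun x hx =>
    image_eq_zero_of_notMem_tsupport fun h => hx (hη.tsupport_subset (tsupport_laplacian_subset η h))
  have hgη0 : ∀ x, x ∉ Ω → gradient η x = 0 := fun x hx => by
    have : fderiv ℝ η x = 0 := image_eq_zero_of_notMem_tsupport fun h =>
      hx (hη.tsupport_subset (tsupport_fderiv_subset ℝ h))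
    simp [gradient, this]
  -- The compact support of `η` justifies this integration by parts, so `Q` need not vanish at zero.
  -- The factor `1` brings the integral into the form of `tendsto_integral_abs_mul_inner_sub`.
  have hn : ∀ n, ∫ x in Ω, (1 : ℝ) * inner ℝ (Q (φ n x)) ((Laplacian.laplacian η : Euc N → ℝ) x)
      = -∫ x in Ω, q (φ n x) * inner ℝ (gradient (φ n) x) (gradient η x) := fun n => by
    have hφ1 := contDiff_infty.1 (hA.test n).contDiff 1
    have h := integral_mul_laplacian (f := fun x => Q (φ n x)) (hQ1.comp hφ1) hη2
      (Or.inr hη.hasCompactSupport)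
    simp_rw [gradient_comp (hφ1.differentiable one_ne_zero) hQ, inner_smul_left] at h
    have e1 := setIntegral_eq_integral_of_forall_compl_eq_zero (μ := volume) (s := Ω)
      (f := fun x => Q (φ n x) * (Laplacian.laplacian η : Euc N → ℝ) x)
      fun x hx => by simp [hη0 x hx]
    have e2 := setIntegral_eq_integral_of_forall_compl_eq_zero (μ := volume) (s := Ω)
      (f := fun x => q (φ n x) * inner ℝ (gradient (φ n) x) (gradient η x))
      fun x hx => by simp [hgη0 x hx]
    rw [e2]
    refine Eq.trans (Eq.trans ?_ e1) h
    simp [mul_comm]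
  obtain ⟨a1, a2, a3⟩ := tendsto_integral_abs_mul_inner_sub (β := fun _ _ => (1 : ℝ))
    (β₀ := fun _ => 1) (L := 1) (fun n => memLp_comp_of_lipschitz hQL (hA.test n).memLp)
    (memLp_comp_of_lipschitz hQL hA.memLp) (fun _ => hLap) hLap (hA.tendsto_comp hQL)
    (by simp) (fun _ => aestronglyMeasurable_const) (by simp) (by simp)
  obtain ⟨b1, b2, b3⟩ := tendsto_integral_abs_mul_inner_sub (β := fun n x => q (φ n x))
    (β₀ := fun x => q (V x)) (fun n => (hA.test n).memLp_gradient) hA.memLp_grad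
    (fun _ => hη.memLp_gradient) hη.memLp_gradient hA.tendsto_grad (by simp)
    (hA.aestronglyMeasurable_comp hq) (fun n => Eventually.of_forall fun x => hL _)
    (hA.ae_tendsto_comp hq)
  have ha := tendsto_integral_of_tendsto_integral_abs_sub a1 a2 a3
  have hb := (tendsto_integral_of_tendsto_integral_abs_sub b1 b2 b3).neg
  have := tendsto_nhds_unique ha (hb.congr fun n => (hn n).symm)
  simpa [mul_comm] using this

/-- Poincaré's inequality for `Q(V)`. -/
theorem ApproxW012.poincare_comp (hN : 0 < N) (hA : ApproxW012 Ω V g φ) {Q q : ℝ → ℝ} {L : ℝ}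
    (hQ : ∀ v, HasDerivAt Q (q v) v) (hq : Continuous q) (hL : ∀ v, |q v| ≤ L) (hQ0 : Q 0 = 0)
    {R : ℝ} (hR : ∀ x ∈ Ω, ‖x‖ ≤ R) :
    ∫ x in Ω, Q (V x) ^ 2 ≤ 4 * R ^ 2 * ∫ x in Ω, q (V x) ^ 2 * ‖g x‖ ^ 2 := by
  have hQL := abs_sub_le_of_hasDerivAt hQ hL
  have hq2 : Continuous fun v => q v ^ 2 := hq.pow 2
  have hn := fun n => (hA.test n).poincare_comp hN hQ hq hQ0 hR
  simp_rw [← real_inner_self_eq_norm_sq] at hn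
  obtain ⟨a1, a2, a3⟩ := tendsto_integral_abs_mul_inner_sub (E := ℝ)
    (X := fun n x => Q (φ n x)) (Y := fun n x => Q (φ n x)) (X₀ := fun x => Q (V x))
    (Y₀ := fun x => Q (V x)) (β := fun _ _ => (1 : ℝ)) (β₀ := fun _ => 1) (L := 1) (fun n => memLp_comp_of_lipschitz hQL (hA.test n).memLp)
    (memLp_comp_of_lipschitz hQL hA.memLp)
    (fun n => memLp_comp_of_lipschitz hQL (hA.test n).memLp)
    (memLp_comp_of_lipschitz hQL hA.memLp) (hA.tendsto_comp hQL) (hA.tendsto_comp hQL)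
    (fun _ => aestronglyMeasurable_const) (by simp) (by simp)
  obtain ⟨b1, b2, b3⟩ := tendsto_integral_abs_mul_inner_sub (E := Euc N)
    (X := fun n => gradient (φ n)) (Y := fun n => gradient (φ n)) (X₀ := g) (Y₀ := g)
    (β := fun n x => q (φ n x) ^ 2)
    (β₀ := fun x => q (V x) ^ 2) (L := L ^ 2) (fun n => (hA.test n).memLp_gradient)
    hA.memLp_grad (fun n => (hA.test n).memLp_gradient) hA.memLp_grad hA.tendsto_grad
    hA.tendsto_grad (hA.aestronglyMeasurable_comp hq2)
    (fun n => Eventually.of_forall fun x => by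
      rw [abs_pow]
      exact pow_le_pow_left₀ (abs_nonneg _) (hL _) 2)
    (hA.ae_tendsto_comp hq2)
  have ha := tendsto_integral_of_tendsto_integral_abs_sub a1 a2 a3
  have hb := (tendsto_integral_of_tendsto_integral_abs_sub b1 b2 b3).const_mul (4 * R ^ 2)
  simp only [one_mul, real_inner_self_eq_norm_sq (F := ℝ), Real.norm_eq_abs, sq_abs] at ha
  have hlim := le_of_tendsto_of_tendsto' ha hb hn
  simp_rw [real_inner_self_eq_norm_sq] at hlim
  exact hlim

end Composition

end EinsteinModel
end

/-! ### Steklov averages and the flux inequality -/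

noncomputable section

namespace EinsteinModel

variable {N : ℕ}

/-- Forward average of `T` over an interval of length `r`. -/
def steklov (T : ℝ → ℝ) (r v : ℝ) : ℝ := (∫ y in v..v + r, T y) / r

/-- The derivative of the average is a difference quotient of `T`. A Lipschitz `T` thus acquires a
continuously differentiable substitute, whose derivative obeys the same Lipschitz bound, without
differentiating `T`. -/
theorem hasDerivAt_steklov {T : ℝ → ℝ} (hT : Continuous T) (r v : ℝ) :
    HasDerivAt (steklov T r) ((T (v + r) - T v) / r) v := by
  have h1 : ∀ w, HasDerivAt (fun w => ∫ y in (0 : ℝ)..w, T y) (T w) w := fun w =>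
    intervalIntegral.integral_hasDerivAt_right (hT.intervalIntegrable _ _)
      (hT.stronglyMeasurableAtFilter _ _) hT.continuousAt
  have h2 : HasDerivAt (fun w => ∫ y in (0 : ℝ)..w + r, T y) (T (v + r)) v :=
    (h1 (v + r)).comp_add_const v r
  refine ((h2.sub (h1 v)).div_const r).congr_of_eventuallyEq (Eventually.of_forall fun w => ?_)
  simp only [steklov, Pi.sub_apply]
  rw [intervalIntegral.integral_interval_sub_left (hT.intervalIntegrable _ _)
    (hT.intervalIntegrable _ _)]

theorem abs_steklov_sub_le {T : ℝ → ℝ} (hT : Continuous T) {r v ε : ℝ} (hr : 0 < r)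
    (hε : ∀ y ∈ Icc v (v + r), |T y - T v| ≤ ε) : |steklov T r v - T v| ≤ ε := by
  have e : steklov T r v - T v = (∫ y in v..v + r, (T y - T v)) / r := by
    rw [intervalIntegral.integral_sub (hT.intervalIntegrable _ _) (by simp), steklov]
    field_simp
    simp
  have := intervalIntegral.norm_integral_le_of_norm_le_const (a := v) (b := v + r)
    (f := fun y => T y - T v) (C := ε) fun y hy => by
      rw [uIoc_of_le (by linarith)] at hy
      exact hε y ⟨hy.1.le, hy.2⟩
  rw [e, abs_div, abs_of_pos hr, div_le_iff₀ hr]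
  simpa [abs_of_pos hr] using this

theorem abs_steklov_sub_le_of_lipschitz {T : ℝ → ℝ} {L : ℝ}
    (hT : ∀ a b, |T a - T b| ≤ L * |a - b|) (hTc : Continuous T) {r : ℝ} (hr : 0 < r) (v : ℝ) :
    |steklov T r v - T v| ≤ L * r := by
  have hL : 0 ≤ L := by simpa using (abs_nonneg _).trans (hT 1 0)
  refine abs_steklov_sub_le hTc hr fun y hy => (hT y v).trans ?_
  rw [abs_of_nonneg (by linarith [hy.1])]
  gcongr
  linarith [hy.2]

theorem tendsto_steklov {T : ℝ → ℝ} (hT : Continuous T) {r : ℕ → ℝ} (hr : ∀ m, 0 < r m)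
    (hr0 : Tendsto r atTop (𝓝 0)) (v : ℝ) :
    Tendsto (fun m => steklov T (r m) v) atTop (𝓝 (T v)) := by
  rw [Metric.tendsto_atTop]
  intro ε hε
  obtain ⟨δ, hδ, hT'⟩ := Metric.continuous_iff.1 hT v (ε / 2) (by positivity)
  obtain ⟨m₀, hm₀⟩ := Metric.tendsto_atTop.1 hr0 δ hδ
  refine ⟨m₀, fun m hm => ?_⟩
  have h1 := hm₀ m hm
  rw [Real.dist_0_eq_abs, abs_of_pos (hr m)] at h1
  rw [Real.dist_eq]
  refine (abs_steklov_sub_le hT (hr m) fun y hy => ?_).trans_lt (half_lt_self hε)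
  refine (hT' y ?_).le
  rw [Real.dist_eq, abs_of_nonneg (by linarith [hy.1])]
  linarith [hy.2]

theorem continuous_of_abs_sub_le {T : ℝ → ℝ} {L : ℝ} (hT : ∀ a b, |T a - T b| ≤ L * |a - b|) :
    Continuous T := by
  have hL : LipschitzWith L.toNNReal T := LipschitzWith.of_dist_le_mul fun a b => by
    rw [Real.dist_eq, Real.dist_eq]
    exact (hT a b).trans (mul_le_mul_of_nonneg_right (Real.le_coe_toNNReal L) (abs_nonneg _))
  exact hL.continuous

theorem IsTestFunction.comp {Ω : Set (Euc N)} {φ : Euc N → ℝ} (hφ : IsTestFunction Ω φ)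
    {S : ℝ → ℝ} (hS : ContDiff ℝ ∞ S) (hS0 : S 0 = 0) : IsTestFunction Ω fun x => S (φ x) := by
  refine ⟨hS.comp hφ.contDiff, hφ.hasCompactSupport.comp_left hS0, ?_⟩
  refine (closure_mono fun x hx => ?_).trans hφ.tsupport_subset
  simp only [Function.mem_support] at hx ⊢
  contrapose! hx
  rw [hx, hS0]

/-- The basic energy inequality: `p(U) ΔU` tested with `S(V)`, where `V ∈ W₀^{1,2}(Ω)` and
`j(U) = T(V)` with `j' = p` nondecreasing and `T` Lipschitz. -/
theorem ApproxW012.integral_flux_le {Ω : Set (Euc N)} [IsFiniteMeasure (volume.restrict Ω)]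
    (hΩ : IsOpen Ω) {V : Euc N → ℝ} {g : Euc N → Euc N} {φ : ℕ → Euc N → ℝ}
    (hA : ApproxW012 Ω V g φ) {U l : Euc N → ℝ} (hU : HasWeakLaplacian Ω U l)
    {j p p' : ℝ → ℝ} (hj : ∀ v, HasDerivAt j (p v) v) (hp : ∀ v, HasDerivAt p (p' v) v)
    (hp'c : Continuous p') (hp' : ∀ v, 0 ≤ p' v) {B : ℝ} (hB : ∀ v, |p v| ≤ B)
    {T : ℝ → ℝ} {L : ℝ} (hT : ∀ a b, |T a - T b| ≤ L * |a - b|)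
    (hTU : ∀ᵐ x ∂volume.restrict Ω, T (V x) = j (U x))
    {S s : ℝ → ℝ} (hS : ContDiff ℝ ∞ S) (hSs : ∀ v, HasDerivAt S (s v) v) (hs : Continuous s)
    {D : ℝ} (hsD : ∀ v, |s v| ≤ D) (hS0 : S 0 = 0) (hSn : ∀ v, 0 ≤ S v) {M : ℝ} (hSM : ∀ v, S v ≤ M)
    (hpl : IntegrableOn (fun x => p (U x) * l x) Ω)
    {r : ℕ → ℝ} (hr : ∀ m, 0 < r m) (hr0 : Tendsto r atTop (𝓝 0)) {b : ℕ → ℝ} {b₀ : ℝ}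
    (hb : Tendsto b atTop (𝓝 b₀))
    (hbm : ∀ m, b m ≤ ∫ x in Ω, ((T (V x + r m) - T (V x)) / r m) * (s (V x) * ‖g x‖ ^ 2)) :
    ∫ x in Ω, p (U x) * l x * S (V x) ≤ -b₀ := by
  have hTc := continuous_of_abs_sub_le hT
  have hL : 0 ≤ L := by simpa using (abs_nonneg _).trans (hT 1 0)
  have hq : ∀ m v, |(T (v + r m) - T v) / r m| ≤ L := fun m v => by
    rw [abs_div, abs_of_pos (hr m), div_le_iff₀ (hr m)]
    simpa [abs_of_pos (hr m)] using hT (v + r m) v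
  -- `S(V)` need not be an admissible test function, but `S(φₙ)` is one and converges to it almost
  -- everywhere.
  have hη : ∀ n, IsTestFunction Ω fun x => S (φ n x) := fun n => (hA.test n).comp hS hS0
  obtain ⟨e1, e2, e3⟩ := tendsto_integral_abs_mul_inner_sub (E := Euc N)
    (X := fun _ => g) (Y := fun n => gradient (φ n)) (X₀ := g) (Y₀ := g)
    (β := fun n x => s (φ n x)) (β₀ := fun x => s (V x)) (L := D) (fun _ => hA.memLp_grad)
    hA.memLp_grad (fun n => (hA.test n).memLp_gradient) hA.memLp_grad (by simp)
    hA.tendsto_grad (hA.aestronglyMeasurable_comp hs)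
    (fun n => Eventually.of_forall fun x => hsD _) (hA.ae_tendsto_comp hs)
  set e : ℕ → ℝ := fun n => ∫ x in Ω, |s (φ n x) * inner ℝ (g x) (gradient (φ n) x)
    - s (V x) * inner ℝ (g x) (g x)|
  have hVm := hA.memLp.aestronglyMeasurable
  have hmain : ∀ n, ∫ x in Ω, p (U x) * l x * S (φ n x) ≤ L * e n - b₀ := fun n => by
    have hη2 := contDiff_infty.1 (hη n).contDiff 2
    have hLap : Integrable (Laplacian.laplacian fun x => S (φ n x) : Euc N → ℝ)
        (volume.restrict Ω) :=
      ((continuous_laplacian hη2).integrable_of_hasCompactSupport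
        (hasCompactSupport_laplacian (hη n).hasCompactSupport)).restrict
    have hLap2 : MemLp (Laplacian.laplacian fun x => S (φ n x) : Euc N → ℝ) 2
        (volume.restrict Ω) :=
      ((continuous_laplacian hη2).memLp_of_hasCompactSupport
        (hasCompactSupport_laplacian (hη n).hasCompactSupport)).restrict _
    have h1 := hU.integral_convex_comp hΩ (hη n) (fun x => hSn _) hj hp hp'c hp' hB
    have h2 : ∫ x in Ω, j (U x) * (Laplacian.laplacian fun x => S (φ n x) : Euc N → ℝ) x
        = ∫ x in Ω, T (V x) * (Laplacian.laplacian fun x => S (φ n x) : Euc N → ℝ) x :=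
      integral_congr_ae (by filter_upwards [hTU] with x hx; rw [hx])
    set CL := ∫ x in Ω, |(Laplacian.laplacian fun x => S (φ n x) : Euc N → ℝ) x|
    -- Two errors appear: replacing `T` by its Steklov average costs at most `L rₘ ∫ |Δη|`, and
    -- replacing `∇φₙ` by `g` costs at most `L eₙ`, uniformly in `m`.
    have hm : ∀ m, ∫ x in Ω, T (V x) * (Laplacian.laplacian fun x => S (φ n x) : Euc N → ℝ) x
        ≤ L * r m * CL + L * e n - b m := fun m => by
      have hqc : Continuous fun v => (T (v + r m) - T v) / r m := by fun_prop
      have h3 := hA.integral_comp_mul_laplacian (hasDerivAt_steklov hTc (r m)) hqc (hq m) (hη n)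
      have hgr : ∀ x, inner ℝ (g x) (gradient (fun x => S (φ n x)) x)
          = s (φ n x) * inner ℝ (g x) (gradient (φ n) x) := fun x => by
        rw [gradient_comp ((contDiff_infty.1 (hA.test n).contDiff 1).differentiable one_ne_zero)
          hSs, inner_smul_right]
      simp_rw [hgr] at h3
      have hstL := abs_sub_le_of_hasDerivAt (hasDerivAt_steklov hTc (r m)) (hq m)
      have i1 : Integrable (fun x => T (V x) * (Laplacian.laplacian fun x => S (φ n x) :
          Euc N → ℝ) x) (volume.restrict Ω) :=
        (memLp_comp_of_lipschitz hT hA.memLp).integrable_mul hLap2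
      have i2 : Integrable (fun x => steklov T (r m) (V x) * (Laplacian.laplacian fun x =>
          S (φ n x) : Euc N → ℝ) x) (volume.restrict Ω) :=
        (memLp_comp_of_lipschitz hstL hA.memLp).integrable_mul hLap2
      have h4 : (∫ x in Ω, T (V x) * (Laplacian.laplacian fun x => S (φ n x) : Euc N → ℝ) x)
          - ∫ x in Ω, steklov T (r m) (V x) * (Laplacian.laplacian fun x => S (φ n x) :
            Euc N → ℝ) x ≤ L * r m * CL := by
        rw [← integral_sub i1 i2, ← integral_const_mul]
        refine integral_mono (i1.sub i2) (hLap.abs.const_mul _) fun x => ?_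
        dsimp only
        rw [← sub_mul]
        refine (le_abs_self _).trans ?_
        rw [abs_mul, abs_sub_comm]
        exact mul_le_mul_of_nonneg_right
          (abs_steklov_sub_le_of_lipschitz hT hTc (hr m) (V x)) (abs_nonneg _)
      have hqm : AEStronglyMeasurable (fun x => (T (V x + r m) - T (V x)) / r m)
          (volume.restrict Ω) := hqc.comp_aestronglyMeasurable hVm
      have i3 : Integrable (fun x => (T (V x + r m) - T (V x)) / r m *
          (s (φ n x) * inner ℝ (g x) (gradient (φ n) x))) (volume.restrict Ω) :=
        (e1 n).bdd_mul hqm (Eventually.of_forall fun x => hq m (V x))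
      have i4 : Integrable (fun x => (T (V x + r m) - T (V x)) / r m *
          (s (V x) * inner ℝ (g x) (g x))) (volume.restrict Ω) :=
        e2.bdd_mul hqm (Eventually.of_forall fun x => hq m (V x))
      have h5 : (∫ x in Ω, (T (V x + r m) - T (V x)) / r m * (s (V x) * inner ℝ (g x) (g x)))
          - ∫ x in Ω, (T (V x + r m) - T (V x)) / r m *
            (s (φ n x) * inner ℝ (g x) (gradient (φ n) x)) ≤ L * e n := by
        rw [← integral_sub i4 i3, ← integral_const_mul]
        refine integral_mono (i4.sub i3) (((e1 n).sub e2).abs.const_mul _) fun x => ?_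
        dsimp only
        rw [← mul_sub]
        refine (le_abs_self _).trans ?_
        rw [abs_mul, abs_sub_comm (s (V x) * _)]
        exact mul_le_mul_of_nonneg_right (hq m (V x)) (abs_nonneg _)
      have h6 := hbm m
      simp_rw [← real_inner_self_eq_norm_sq] at h6
      linarith
    -- The limit in `m` comes first, for fixed `n`, because `∫ |ΔS(φₙ)|` has no bound uniform in
    -- `n`.
    have hlim : Tendsto (fun m => L * r m * CL + L * e n - b m) atTop
        (𝓝 (L * 0 * CL + L * e n - b₀)) :=
      (((hr0.const_mul L).mul_const CL).add_const _).sub hb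
    have h7 := ge_of_tendsto' hlim hm
    rw [h2] at h1
    linarith
  have hleft : Tendsto (fun n => ∫ x in Ω, p (U x) * l x * S (φ n x)) atTop
      (𝓝 (∫ x in Ω, p (U x) * l x * S (V x))) := by
    refine tendsto_integral_of_dominated_convergence (fun x => ‖p (U x) * l x‖ * M)
      (fun n => hpl.aestronglyMeasurable.mul (hA.aestronglyMeasurable_comp hS.continuous n))
      (hpl.norm.mul_const _) (fun n => Eventually.of_forall fun x => ?_) ?_
    · rw [norm_mul, Real.norm_of_nonneg (hSn _)]
      exact mul_le_mul_of_nonneg_left (hSM _) (norm_nonneg _)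
    · filter_upwards [hA.ae_tendsto_comp hS.continuous] with x hx using hx.const_mul _
  have hright : Tendsto (fun n => L * e n - b₀) atTop (𝓝 (L * 0 - b₀)) :=
    (e3.const_mul L).sub_const b₀
  have := le_of_tendsto_of_tendsto' hleft hright hmain
  linarith

end EinsteinModel
end

/-! ### The nonlinearities: increments of `G` and `H^{γ+1}`, and the inverse of `G` -/

noncomputable section

namespace EinsteinModel

/-- The standing assumptions on the nonlinearities. -/
structure IsAdmissible (h a : ℝ → ℝ) (p q γ c₃ c₄ : ℝ) : Prop where
  model : IsModel h a
  p_pos : 0 < p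
  q_pos : 0 < q
  γ_pos : 0 < γ
  c₃_pos : 0 < c₃
  c₄_pos : 0 < c₄
  lower : LowerStructure h a p q c₃
  upper : UpperStructure h γ (q / 2) c₄

/-- `G = H^p F`. -/
def G (h a : ℝ → ℝ) (p s : ℝ) : ℝ := H h s ^ p * F h a s

section Model

variable {h a : ℝ → ℝ}

theorem H_zero (h : ℝ → ℝ) : H h 0 = 0 := by simp [H]

theorem IsModel.intervalIntegrable (hM : IsModel h a) {s t : ℝ} (hs : 0 ≤ s) (ht : 0 ≤ t) :
    IntervalIntegrable h volume s t := by
  rw [intervalIntegrable_iff]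
  refine (hM.h_locInt.integrableOn_compact_subset (t := uIcc s t) (fun x hx => ?_)
    isCompact_uIcc).mono_set uIoc_subset_uIcc
  exact (le_min hs ht).trans hx.1

theorem IsModel.H_sub (hM : IsModel h a) {s t : ℝ} (hs : 0 ≤ s) (ht : 0 ≤ t) :
    H h t - H h s = ∫ r in s..t, h r :=
  intervalIntegral.integral_interval_sub_left (hM.intervalIntegrable le_rfl ht)
    (hM.intervalIntegrable le_rfl hs)

theorem IsModel.H_strictMonoOn (hM : IsModel h a) : StrictMonoOn (H h) (Ici 0) := by
  intro s hs t ht hst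
  rw [← sub_pos, hM.H_sub hs ht]
  exact intervalIntegral.intervalIntegral_pos_of_pos_on (hM.intervalIntegrable hs ht)
    (fun x hx => hM.h_pos x (lt_of_le_of_lt hs hx.1)) hst

theorem IsModel.H_monotoneOn (hM : IsModel h a) : MonotoneOn (H h) (Ici 0) :=
  hM.H_strictMonoOn.monotoneOn

theorem IsModel.H_nonneg (hM : IsModel h a) {s : ℝ} (hs : 0 ≤ s) : 0 ≤ H h s := by
  have := hM.H_monotoneOn (mem_Ici.2 le_rfl) (mem_Ici.2 hs) hs
  rwa [H_zero] at this

theorem IsModel.H_pos (hM : IsModel h a) {s : ℝ} (hs : 0 < s) : 0 < H h s := by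
  have := hM.H_strictMonoOn (mem_Ici.2 le_rfl) (mem_Ici.2 hs.le) hs
  rwa [H_zero] at this

theorem IsModel.H_continuousOn (hM : IsModel h a) : ContinuousOn (H h) (Ici 0) := by
  intro s hs
  have h1 : ContinuousOn (H h) (Icc 0 (s + 1)) := by
    have := intervalIntegral.continuousOn_primitive_interval (μ := volume) (f := h) (a := 0)
      (b := s + 1) ?_
    · rwa [uIcc_of_le (by linarith [mem_Ici.1 hs])] at this
    · refine hM.h_locInt.integrableOn_compact_subset (fun x hx => ?_) isCompact_uIcc
      rw [uIcc_of_le (by linarith [mem_Ici.1 hs])] at hx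
      exact hx.1
  refine (h1 s ⟨hs, by linarith⟩).mono_of_mem_nhdsWithin ?_
  filter_upwards [self_mem_nhdsWithin, mem_nhdsWithin_of_mem_nhds (Iio_mem_nhds (lt_add_one s))]
    with x hx hx' using ⟨hx, le_of_lt hx'⟩

theorem IsModel.continuous_H_max (hM : IsModel h a) : Continuous fun v => H h (max v 0) :=
  hM.H_continuousOn.comp_continuous (by fun_prop) fun v => le_max_right v 0

theorem IsModel.F_continuousOn (hM : IsModel h a) : ContinuousOn (F h a) (Ici 0) :=
  hM.F_lipschitz.continuousOn

theorem IsModel.F_pos (hM : IsModel h a) {s : ℝ} (hs : 0 < s) : 0 < F h a s :=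
  mul_pos (hM.h_pos s hs) (hM.a_pos s hs)

theorem IsModel.F_nonneg (hM : IsModel h a) {s : ℝ} (hs : 0 ≤ s) : 0 ≤ F h a s := by
  have := hM.F_mono (mem_Ici.2 le_rfl) (mem_Ici.2 hs) hs
  rwa [hM.F_zero] at this

theorem IsModel.G_zero (hM : IsModel h a) (p : ℝ) : G h a p 0 = 0 := by
  simp [G, hM.F_zero]

end Model

theorem monotoneOn_Ici_of_hasDerivWithinAt {f f' : ℝ → ℝ} {s₀ : ℝ} (hs₀ : 0 ≤ s₀)
    (hf : ∀ s, 0 ≤ s → HasDerivWithinAt f (f' s) (Ici 0) s) (hf' : ∀ s, s₀ ≤ s → 0 ≤ f' s) :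
    MonotoneOn f (Ici s₀) := by
  refine monotoneOn_of_hasDerivWithinAt_nonneg (f' := f') (convex_Ici s₀) (fun s hs => ?_)
    (fun s hs => ?_) fun s hs => ?_
  · exact (hf s (hs₀.trans hs)).continuousWithinAt.mono (Ici_subset_Ici.2 hs₀)
  · rw [interior_Ici] at hs ⊢
    exact (hf s (hs₀.trans hs.le)).mono fun x hx => hs₀.trans (le_of_lt hx)
  · rw [interior_Ici] at hs
    exact hf' s hs.le

section Admissible

variable {h a : ℝ → ℝ} {p q γ c₃ c₄ : ℝ}

theorem IsAdmissible.hasDerivWithinAt_G (hA : IsAdmissible h a p q γ c₃ c₄) {s : ℝ} (hs : 0 ≤ s) :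
    HasDerivWithinAt (G h a p) (derivWithin (G h a p) (Ici 0) s) (Ici 0) s :=
  (hA.lower s hs).1.hasDerivWithinAt

theorem IsAdmissible.G_continuousOn (hA : IsAdmissible h a p q γ c₃ c₄) :
    ContinuousOn (G h a p) (Ici 0) := fun _ hs => (hA.hasDerivWithinAt_G hs).continuousWithinAt

/-- On `[s, ∞)` the derivative of `G` is at least `c₃ H(s)^q`, since `H` increases. Subtracting the
linear function with this slope leaves a nondecreasing function. -/
theorem IsAdmissible.mul_sub_le_G_sub (hA : IsAdmissible h a p q γ c₃ c₄) {s t : ℝ} (hs : 0 ≤ s)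
    (hst : s ≤ t) : c₃ * H h s ^ q * (t - s) ≤ G h a p t - G h a p s := by
  have hmono := monotoneOn_Ici_of_hasDerivWithinAt (f := fun r => G h a p r - c₃ * H h s ^ q * r)
    hs (fun r hr => (hA.hasDerivWithinAt_G hr).sub
      ((hasDerivWithinAt_id r (Ici 0)).const_mul (c₃ * H h s ^ q))) fun r hr => by
      have h1 : c₃ * H h r ^ q ≤ derivWithin (G h a p) (Ici 0) r := (hA.lower r (hs.trans hr)).2
      have h2 : H h s ^ q ≤ H h r ^ q := Real.rpow_le_rpow (hA.model.H_nonneg hs)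
        (hA.model.H_monotoneOn (mem_Ici.2 hs) (mem_Ici.2 (hs.trans hr)) hr) hA.q_pos.le
      have h3 := mul_le_mul_of_nonneg_left h2 hA.c₃_pos.le
      linarith
  have := hmono (mem_Ici.2 le_rfl) (mem_Ici.2 hst) hst
  dsimp only at this
  linarith

theorem IsAdmissible.G_strictMonoOn (hA : IsAdmissible h a p q γ c₃ c₄) :
    StrictMonoOn (G h a p) (Ici 0) := by
  intro s hs t ht hst
  -- The linear lower bound degenerates when `s = 0`, where `H` vanishes; starting it from the
  -- midpoint gives a strictly positive slope.
  have hm : s < (s + t) / 2 := by linarith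
  have hs0 : (0 : ℝ) ≤ s := hs
  have hmp : 0 < (s + t) / 2 := by linarith
  have h1 := hA.mul_sub_le_G_sub hs hm.le
  have h2 := hA.mul_sub_le_G_sub hmp.le (show (s + t) / 2 ≤ t by linarith)
  have h3 : 0 ≤ c₃ * H h s ^ q * ((s + t) / 2 - s) :=
    mul_nonneg (mul_nonneg hA.c₃_pos.le (Real.rpow_nonneg (hA.model.H_nonneg hs) _))
      (by linarith)
  have h4 : 0 < c₃ * H h ((s + t) / 2) ^ q * (t - (s + t) / 2) :=
    mul_pos (mul_pos hA.c₃_pos (Real.rpow_pos_of_pos (hA.model.H_pos hmp) _)) (by linarith)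
  linarith

theorem IsAdmissible.G_monotoneOn (hA : IsAdmissible h a p q γ c₃ c₄) :
    MonotoneOn (G h a p) (Ici 0) := hA.G_strictMonoOn.monotoneOn

theorem IsAdmissible.G_nonneg (hA : IsAdmissible h a p q γ c₃ c₄) {s : ℝ} (hs : 0 ≤ s) :
    0 ≤ G h a p s := mul_nonneg (Real.rpow_nonneg (hA.model.H_nonneg hs) _) (hA.model.F_nonneg hs)

theorem IsAdmissible.G_pos (hA : IsAdmissible h a p q γ c₃ c₄) {s : ℝ} (hs : 0 < s) :
    0 < G h a p s := mul_pos (Real.rpow_pos_of_pos (hA.model.H_pos hs) _) (hA.model.F_pos hs)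

/-- The structure conditions combined: the increment of `H^{γ+1}` is controlled by the geometric
mean of the increments of the variable and of `G`. -/
theorem IsAdmissible.sq_sub_le (hA : IsAdmissible h a p q γ c₃ c₄) {s t : ℝ} (hs : 0 ≤ s)
    (hst : s ≤ t) :
    (H h t ^ (γ + 1) - H h s ^ (γ + 1)) ^ 2
      ≤ c₄ ^ 2 / c₃ * ((t - s) * (G h a p t - G h a p s)) := by
  rcases hst.eq_or_lt with rfl | hlt
  · simp
  have hX : 0 < t - s := by linarith
  have hZ : 0 < G h a p t - G h a p s := by
    have := hA.G_strictMonoOn (mem_Ici.2 hs) (mem_Ici.2 (hs.trans hst)) hlt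
    linarith
  set X := t - s
  set Z := G h a p t - G h a p s
  have hc := hA.c₃_pos
  have hc4 := hA.c₄_pos
  -- a linear bound for every positive weight
  have key : ∀ μ : ℝ, 0 < μ → H h t ^ (γ + 1) - H h s ^ (γ + 1)
      ≤ c₄ / 2 * (μ * X + Z / (c₃ * μ)) := by
    intro μ hμ
    have hmono := monotoneOn_Ici_of_hasDerivWithinAt
      (f := fun r => c₄ / 2 * (μ * r + G h a p r / (c₃ * μ)) - H h r ^ (γ + 1))
      le_rfl (fun r hr => (((hasDerivWithinAt_id r (Ici 0)).const_mul μ).add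
        ((hA.hasDerivWithinAt_G hr).div_const (c₃ * μ))).const_mul (c₄ / 2) |>.sub
        (hA.upper r hr).1.hasDerivWithinAt) fun r hr => by
        have h1 : c₃ * H h r ^ q ≤ derivWithin (G h a p) (Ici 0) r := (hA.lower r hr).2
        have h2 := (hA.upper r hr).2
        have h3 : H h r ^ q ≤ derivWithin (G h a p) (Ici 0) r / c₃ := by
          rw [le_div_iff₀ hc]; linarith
        have h4 : (H h r ^ (q / 2)) ^ 2 = H h r ^ q := by
          rw [← Real.rpow_natCast, ← Real.rpow_mul (hA.model.H_nonneg hr)]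
          norm_num
        have h5 : 2 * H h r ^ (q / 2) ≤ μ + H h r ^ q / μ := by
          rw [← h4, ← sub_nonneg]
          have : μ + (H h r ^ (q / 2)) ^ 2 / μ - 2 * H h r ^ (q / 2)
              = (H h r ^ (q / 2) - μ) ^ 2 / μ := by field_simp; ring
          rw [this]
          positivity
        have h6 : H h r ^ q / μ ≤ derivWithin (G h a p) (Ici 0) r / (c₃ * μ) := by
          rw [← div_div]
          exact div_le_div_of_nonneg_right h3 hμ.le
        have h7 : c₄ * H h r ^ (q / 2)
            ≤ c₄ / 2 * (μ + derivWithin (G h a p) (Ici 0) r / (c₃ * μ)) := by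
          have := mul_le_mul_of_nonneg_left (h5.trans (add_le_add_right h6 μ)) hc4.le
          linarith
        linarith
    have h8 := hmono (mem_Ici.2 hs) (mem_Ici.2 (hs.trans hst)) hst
    dsimp only at h8
    have e : c₄ / 2 * (μ * X + Z / (c₃ * μ)) = c₄ / 2 * (μ * t + G h a p t / (c₃ * μ))
        - c₄ / 2 * (μ * s + G h a p s / (c₃ * μ)) := by
      simp only [X, Z]
      ring
    rw [e]
    linarith
  have h0 : 0 ≤ H h t ^ (γ + 1) - H h s ^ (γ + 1) := by
    rw [sub_nonneg]
    exact Real.rpow_le_rpow (hA.model.H_nonneg hs)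
      (hA.model.H_monotoneOn (mem_Ici.2 hs) (mem_Ici.2 (hs.trans hst)) hst) (by linarith [hA.γ_pos])
  -- This weight equalises the two terms `μ X` and `Z / (c₃ μ)`. Optimising over `μ` plays the part
  -- of the Cauchy–Schwarz inequality and needs no integrability of the derivatives.
  have hμ : 0 < √(Z / (c₃ * X)) := Real.sqrt_pos.2 (by positivity)
  have hk := key _ hμ
  set μ := √(Z / (c₃ * X))
  have hμ2 : μ ^ 2 = Z / (c₃ * X) := Real.sq_sqrt (by positivity)
  have e1 : Z / (c₃ * μ) = μ * X := by
    rw [div_eq_iff (by positivity)]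
    have : Z = μ ^ 2 * (c₃ * X) := by rw [hμ2]; field_simp
    rw [this]
    ring
  rw [e1] at hk
  calc _ ≤ (c₄ / 2 * (μ * X + μ * X)) ^ 2 := pow_le_pow_left₀ h0 hk 2
    _ = c₄ ^ 2 * X ^ 2 * μ ^ 2 := by ring
    _ = _ := by rw [hμ2]; field_simp

/-- The inverse of `G`, extended by zero to negative arguments. -/
theorem IsAdmissible.exists_inverse (hA : IsAdmissible h a p q γ c₃ c₄) :
    ∃ K : ℝ → ℝ, Continuous K ∧ Monotone K ∧ (∀ v, 0 ≤ K v) ∧ (∀ v, G h a p (K v) = max v 0) ∧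
      ∀ s, 0 ≤ s → K (G h a p s) = s := by
  -- Continuing `G` by the identity on the negative axis makes it an increasing bijection of the
  -- line. Surjectivity at `+∞` comes from the linear lower bound beyond `1`.
  set E : ℝ → ℝ := fun s => G h a p (max s 0) + min s 0
  have hEc : Continuous E :=
    (hA.G_continuousOn.comp_continuous (by fun_prop) fun v => le_max_right v 0).add (by fun_prop)
  have hEm : StrictMono E := by
    intro s t hst
    rcases le_total s 0 with hs | hs
    · have h1 : max s 0 = 0 := max_eq_right hs
      rcases lt_or_ge 0 t with ht | ht
      · have := hA.G_pos ht
        simp only [E, h1, hA.model.G_zero, max_eq_left ht.le, min_eq_left hs, min_eq_right ht.le]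
        linarith
      · simp only [E, h1, max_eq_right ht, min_eq_left hs, min_eq_left ht]
        linarith
    · have ht := hs.trans hst.le
      simp only [E, max_eq_left hs, max_eq_left ht, min_eq_right hs, min_eq_right ht]
      have := hA.G_strictMonoOn (mem_Ici.2 hs) (mem_Ici.2 ht) hst
      linarith
  have htop : Tendsto E atTop atTop := by
    have hpos : 0 < c₃ * H h 1 ^ q :=
      mul_pos hA.c₃_pos (Real.rpow_pos_of_pos (hA.model.H_pos one_pos) _)
    refine tendsto_atTop_mono' atTop (f₁ := fun s => c₃ * H h 1 ^ q * (s - 1)) ?_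
      ((tendsto_atTop_add_const_right atTop (-1) tendsto_id).const_mul_atTop hpos)
    filter_upwards [eventually_ge_atTop 1] with s hs
    have h1 := hA.mul_sub_le_G_sub zero_le_one hs
    have h2 := hA.G_nonneg zero_le_one
    have h3 : (0 : ℝ) ≤ s := by linarith
    simp only [E, max_eq_left h3, min_eq_right h3]
    linarith
  have hbot : Tendsto E atBot atBot := by
    refine tendsto_id.congr' ?_
    filter_upwards [eventually_le_atBot 0] with s hs
    simp [E, max_eq_right hs, min_eq_left hs, hA.model.G_zero]
  have hEs : Function.Surjective E := hEc.surjective htop hbot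
  set e := hEm.orderIsoOfSurjective E hEs
  have hee : ∀ v, E (e.symm v) = v := fun v => e.apply_symm_apply v
  have hes : ∀ s, e.symm (E s) = s := fun s => e.symm_apply_apply s
  refine ⟨fun v => max (e.symm v) 0, e.symm.continuous.max continuous_const,
    fun v w hvw => max_le_max_right 0 (e.symm.monotone hvw), fun v => le_max_right _ _,
    fun v => ?_, fun s hs => ?_⟩
  · have hv := hee v
    change G h a p (max (e.symm v) 0) = max v 0
    rcases le_total (e.symm v) 0 with h0 | h0
    · simp only [E, max_eq_right h0, min_eq_left h0, hA.model.G_zero, zero_add] at hv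
      rw [hv] at h0
      rw [hv, max_eq_right h0, hA.model.G_zero]
    · simp only [E, max_eq_left h0, min_eq_right h0, add_zero] at hv
      rw [max_eq_left h0, hv, max_eq_left]
      rw [← hv]
      exact hA.G_nonneg h0
  · have : E s = G h a p s := by simp [E, max_eq_left hs, min_eq_right hs]
    change max (e.symm _) 0 = s
    rw [← this, hes, max_eq_left hs]

end Admissible

end EinsteinModel
end

/-! ### Convex cut-offs and the flux through superlevel sets -/

noncomputable section

namespace EinsteinModel

/-- `K` is the inverse of `G`, extended by zero to negative arguments. -/
structure IsInverse (h a : ℝ → ℝ) (p : ℝ) (K : ℝ → ℝ) : Prop where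
  continuous : Continuous K
  monotone : Monotone K
  nonneg : ∀ v, 0 ≤ K v
  G_apply : ∀ v, G h a p (K v) = max v 0
  apply_G : ∀ s, 0 ≤ s → K (G h a p s) = s

theorem hasDerivAt_primitive {f : ℝ → ℝ} (hf : Continuous f) (v : ℝ) :
    HasDerivAt (fun w => ∫ y in (0 : ℝ)..w, f y) (f v) v :=
  intervalIntegral.integral_hasDerivAt_right (hf.intervalIntegrable _ _)
    (hf.stronglyMeasurableAtFilter _ _) hf.continuousAt

/-- A convex cut-off `j` of the identity near zero, together with the Lipschitz function
`T = j ∘ K`. -/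
structure IsCutoff (h a : ℝ → ℝ) (p : ℝ) (K : ℝ → ℝ) (ε : ℝ) (j π π' T : ℝ → ℝ) (L σ : ℝ) :
    Prop where
  hasDerivAt_j : ∀ v, HasDerivAt j (π v) v
  hasDerivAt_π : ∀ v, HasDerivAt π (π' v) v
  continuous_π' : Continuous π'
  π'_nonneg : ∀ v, 0 ≤ π' v
  abs_π_le : ∀ v, |π v| ≤ 1
  σ_pos : 0 < σ
  π_eq_zero : ∀ v, v ≤ σ → π v = 0
  π_eq_one : ∀ v, K ε ≤ v → π v = 1
  lipschitz_T : ∀ v w, |T v - T w| ≤ L * |v - w|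
  monotone_T : Monotone T
  T_G : ∀ s, 0 ≤ s → T (G h a p s) = j s
  T_sub : ∀ v w, ε ≤ v → v ≤ w → T w - T v = K w - K v

variable {h a : ℝ → ℝ} {p q γ c₃ c₄ : ℝ} {K : ℝ → ℝ}

theorem IsInverse.pos (hA : IsAdmissible h a p q γ c₃ c₄) (hK : IsInverse h a p K) {v : ℝ}
    (hv : 0 < v) : 0 < K v := by
  refine (hK.nonneg v).lt_of_ne fun h0 => ?_
  have := hK.G_apply v
  rw [← h0, hA.model.G_zero, max_eq_left hv.le] at this
  exact hv.ne this

/-- The slope of `G` is bounded below only away from zero, so `K` may fail to be Lipschitz near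
zero. A convex `j` that vanishes up to `σ = K(ε)/2` discards that region, and `j ∘ K` has Lipschitz
constant `(c₃ H(σ)^q)⁻¹`; above `K(ε)` the slope of `j` is `1`, so increments of `K` are kept. -/
theorem IsInverse.exists_cutoff (hA : IsAdmissible h a p q γ c₃ c₄) (hK : IsInverse h a p K)
    {ε : ℝ} (hε : 0 < ε) : ∃ j π π' T L σ, IsCutoff h a p K ε j π π' T L σ := by
  have hKε := hK.pos hA hε
  set σ := K ε / 2 with hσ
  have hσ0 : 0 < σ := by positivity
  set π : ℝ → ℝ := fun s => Real.smoothTransition ((s - σ) / σ)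
  have hπs : ContDiff ℝ 2 π := Real.smoothTransition.contDiff.comp (by fun_prop)
  have hπm : Monotone π := fun s t hst => Real.smoothTransition.monotone (by gcongr)
  have hπ0 : ∀ s, s ≤ σ → π s = 0 := fun s hs => Real.smoothTransition.zero_of_nonpos
    (div_nonpos_of_nonpos_of_nonneg (by linarith) hσ0.le)
  have hπ1 : ∀ s, K ε ≤ s → π s = 1 := fun s hs => Real.smoothTransition.one_of_one_le
    ((one_le_div hσ0).2 (by rw [hσ]; linarith))
  have hπabs : ∀ s, |π s| ≤ 1 := fun s => by
    rw [abs_of_nonneg (Real.smoothTransition.nonneg _)]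
    exact Real.smoothTransition.le_one _
  set j : ℝ → ℝ := fun s => ∫ y in (0 : ℝ)..s, π y
  have hjd : ∀ v, HasDerivAt j (π v) v := hasDerivAt_primitive hπs.continuous
  have hjL : ∀ v w, |j v - j w| ≤ 1 * |v - w| := abs_sub_le_of_hasDerivAt hjd hπabs
  have hjm : Monotone j := monotone_of_hasDerivAt_nonneg hjd fun v =>
    Real.smoothTransition.nonneg _
  have hj0 : ∀ s, s ≤ σ → j s = 0 := fun s hs => by
    refine (intervalIntegral.integral_congr (g := fun _ => (0 : ℝ)) fun y hy => ?_).trans (by simp)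
    refine hπ0 y (hy.2.trans ?_)
    exact max_le hσ0.le hs
  have hj1 : ∀ v w, K ε ≤ v → v ≤ w → j w - j v = w - v := fun v w hv hvw => by
    have e : j w - j v = ∫ y in v..w, π y := intervalIntegral.integral_interval_sub_left
      (hπs.continuous.intervalIntegrable _ _) (hπs.continuous.intervalIntegrable _ _)
    rw [e]
    refine (intervalIntegral.integral_congr (g := fun _ => (1 : ℝ)) fun y hy => ?_).trans (by simp)
    rw [uIcc_of_le hvw] at hy
    exact hπ1 y (hv.trans hy.1)
  -- Since `j` does not distinguish values below `σ`, it suffices to estimate the increments of `max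
  -- K σ`.
  have hjmax : ∀ s, j s = j (max s σ) := fun s => by
    rcases le_total s σ with hs | hs
    · rw [max_eq_right hs, hj0 s hs, hj0 σ le_rfl]
    · rw [max_eq_left hs]
  have hpos : 0 < c₃ * H h σ ^ q :=
    mul_pos hA.c₃_pos (Real.rpow_pos_of_pos (hA.model.H_pos hσ0) _)
  have hKL : ∀ v w, v ≤ w → max (K w) σ - max (K v) σ ≤ (c₃ * H h σ ^ q)⁻¹ * (w - v) := by
    intro v w hvw
    rcases le_total (K w) σ with hw | hw
    · have : K v ≤ σ := (hK.monotone hvw).trans hw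
      rw [max_eq_right hw, max_eq_right this, sub_self]
      exact mul_nonneg (by positivity) (by linarith)
    · rw [max_eq_left hw]
      have h1 : max (K v) σ ≤ K w := max_le (hK.monotone hvw) hw
      have h0 : 0 ≤ max (K v) σ := hσ0.le.trans (le_max_right _ _)
      have h2 := hA.mul_sub_le_G_sub h0 h1
      have hw0 : 0 < w := by
        by_contra hcon
        have h3 := hK.G_apply w
        rw [max_eq_right (not_lt.1 hcon)] at h3
        exact (hA.G_pos (hσ0.trans_le hw)).ne' h3
      have h4 : v ≤ G h a p (max (K v) σ) := calc
        v ≤ max v 0 := le_max_left _ _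
        _ = G h a p (K v) := (hK.G_apply v).symm
        _ ≤ _ := hA.G_monotoneOn (mem_Ici.2 (hK.nonneg v)) (mem_Ici.2 h0) (le_max_left _ _)
      have h5 : H h σ ^ q ≤ H h (max (K v) σ) ^ q := Real.rpow_le_rpow (hA.model.H_nonneg hσ0.le)
        (hA.model.H_monotoneOn (mem_Ici.2 hσ0.le) (mem_Ici.2 h0) (le_max_right _ _)) hA.q_pos.le
      rw [hK.G_apply w, max_eq_left hw0.le] at h2
      have h6 : c₃ * H h σ ^ q * (K w - max (K v) σ)
          ≤ c₃ * H h (max (K v) σ) ^ q * (K w - max (K v) σ) := by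
        have := hA.c₃_pos
        have : 0 ≤ K w - max (K v) σ := by linarith
        gcongr
      rw [inv_mul_eq_div, le_div_iff₀ hpos]
      linarith
  refine ⟨j, π, deriv π, fun v => j (K v), (c₃ * H h σ ^ q)⁻¹, σ, hjd, fun v =>
    (hπs.differentiable two_ne_zero v).hasDerivAt, hπs.continuous_deriv (by norm_num),
    fun v => hπm.deriv_nonneg, hπabs, hσ0, hπ0, hπ1, fun v w => ?_, hjm.comp hK.monotone,
    fun s hs => by rw [hK.apply_G s hs], fun v w hv hvw => ?_⟩
  · wlog hvw : v ≤ w generalizing v w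
    · rw [abs_sub_comm, abs_sub_comm v]
      exact this w v (le_of_not_ge hvw)
    · rw [hjmax (K v), hjmax (K w)]
      refine (hjL _ _).trans ?_
      rw [one_mul, abs_sub_comm, abs_sub_comm v, abs_of_nonneg (sub_nonneg.2 hvw),
        abs_of_nonneg (sub_nonneg.2 (max_le_max_right σ (hK.monotone hvw)))]
      exact hKL v w hvw
  · exact hj1 _ _ (hK.monotone hv) (hK.monotone hvw)

section Elliptic

variable {N : ℕ} {Ω : Set (Euc N)} {U l : Euc N → ℝ}

/-- `U` is a nonnegative function with weak Laplacian `l`, square integrable flux and zero boundary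
values. -/
structure IsSlice (Ω : Set (Euc N)) (h a : ℝ → ℝ) (p : ℝ) (U l : Euc N → ℝ) : Prop where
  nonneg : ∀ᵐ x ∂volume.restrict Ω, 0 ≤ U x
  weakLaplacian : HasWeakLaplacian Ω U l
  integrable : IntegrableOn (fun x => F h a (U x) * l x) Ω
  boundary : MemW012 Ω fun x => G h a p (U x)

theorem IsSlice.aestronglyMeasurable (hS : IsSlice Ω h a p U l) :
    AEStronglyMeasurable U (volume.restrict Ω) :=
  hS.weakLaplacian.locInt.aestronglyMeasurable

theorem IsSlice.aestronglyMeasurable_lap (hS : IsSlice Ω h a p U l) :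
    AEStronglyMeasurable l (volume.restrict Ω) :=
  hS.weakLaplacian.locInt_lap.aestronglyMeasurable

/-- Only `F(U) l` is known to be integrable. As `F` is nondecreasing, a bounded `b` which vanishes
below `σ` satisfies `|b(U)| ≤ (B / F(σ)) F(U)`. -/
theorem IsSlice.integrableOn_mul (hM : IsModel h a) (hS : IsSlice Ω h a p U l) {b : ℝ → ℝ}
    (hb : Measurable b) {σ : ℝ} (hσ : 0 < σ) (hb0 : ∀ s, s ≤ σ → b s = 0) {B : ℝ}
    (hB : ∀ s, |b s| ≤ B) : IntegrableOn (fun x => b (U x) * l x) Ω := by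
  have hB0 : 0 ≤ B := (abs_nonneg _).trans (hB 0)
  refine Integrable.mono' (hS.integrable.norm.const_mul (B / F h a σ))
    ((hb.comp_aemeasurable hS.aestronglyMeasurable.aemeasurable).aestronglyMeasurable.mul
      hS.aestronglyMeasurable_lap) (Eventually.of_forall fun x => ?_)
  have hFσ := hM.F_pos hσ
  rcases le_or_gt (U x) σ with hx | hx
  · rw [hb0 _ hx]
    simp only [zero_mul, norm_zero]
    positivity
  · have h1 : F h a σ ≤ F h a (U x) :=
      hM.F_mono (mem_Ici.2 hσ.le) (mem_Ici.2 (hσ.le.trans hx.le)) hx.le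
    rw [norm_mul, norm_mul, Real.norm_of_nonneg (hFσ.le.trans h1), ← mul_assoc]
    refine mul_le_mul_of_nonneg_right ((hB _).trans ?_) (norm_nonneg _)
    rw [div_mul_eq_mul_div, le_div_iff₀ hFσ]
    gcongr

/-- The inward flux through every superlevel set is nonnegative. -/
theorem IsSlice.setIntegral_superlevel_nonpos [IsFiniteMeasure (volume.restrict Ω)]
    (hΩ : IsOpen Ω) (hA : IsAdmissible h a p q γ c₃ c₄) (hS : IsSlice Ω h a p U l) {σ : ℝ}
    (hσ : 0 < σ) : ∫ x in Ω, (Ioi σ).indicator (fun _ => (1 : ℝ)) (U x) * l x ≤ 0 := by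
  obtain ⟨K, hK1, hK2, hK3, hK4, hK5⟩ := hA.exists_inverse
  have hK : IsInverse h a p K := ⟨hK1, hK2, hK3, hK4, hK5⟩
  obtain ⟨g, φ, hφ⟩ := hS.boundary.exists_approx
  have hε := hA.G_pos hσ
  obtain ⟨j, π, π', T, L, σ', hC⟩ := hK.exists_cutoff hA hε
  have hKε : K (G h a p σ) = σ := hK.apply_G σ hσ.le
  have hπc : Continuous π := continuous_iff_continuousAt.2 fun v => (hC.hasDerivAt_π v).continuousAt
  have hπl : IntegrableOn (fun x => π (U x) * l x) Ω :=
    hS.integrableOn_mul hA.model hπc.measurable hC.σ_pos hC.π_eq_zero hC.abs_π_le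
  -- Smooth steps in the variable `V = G(U)`, increasing to the indicator of `V > G(σ)`, which is
  -- the set `U > σ`.
  set S : ℕ → ℝ → ℝ := fun i v => Real.smoothTransition (((i : ℝ) + 1) * (v - G h a p σ))
  have hSC : ∀ i, ContDiff ℝ ∞ (S i) := fun i =>
    Real.smoothTransition.contDiff.comp (by fun_prop)
  have hSm : ∀ i, Monotone (S i) := fun i v w hvw => Real.smoothTransition.monotone (by gcongr)
  have hSz : ∀ i v, v ≤ G h a p σ → S i v = 0 := fun i v hv =>
    Real.smoothTransition.zero_of_nonpos (mul_nonpos_of_nonneg_of_nonpos (by positivity)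
      (by linarith))
  have hS1 : ∀ i v, G h a p σ + 1 ≤ v → S i v = 1 := fun i v hv =>
    Real.smoothTransition.one_of_one_le (by
      have : (0 : ℝ) ≤ i := by positivity
      nlinarith)
  have hi : ∀ i, ∫ x in Ω, π (U x) * l x * S i (G h a p (U x)) ≤ 0 := fun i => by
    have hsc : Continuous (deriv (S i)) := (hSC i).continuous_deriv (by simp)
    have hcs : HasCompactSupport (deriv (S i)) := by
      refine HasCompactSupport.intro (K := Icc (G h a p σ) (G h a p σ + 1)) isCompact_Icc
        fun v hv => ?_
      rcases lt_or_ge v (G h a p σ) with h1 | h1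
      · have : S i =ᶠ[𝓝 v] fun _ => 0 := by
          filter_upwards [Iio_mem_nhds h1] with w hw using hSz i w (le_of_lt hw)
        rw [this.deriv_eq]
        simp
      · have h2 : G h a p σ + 1 < v := by
          by_contra hcon
          exact hv ⟨h1, not_lt.1 hcon⟩
        have : S i =ᶠ[𝓝 v] fun _ => 1 := by
          filter_upwards [Ioi_mem_nhds h2] with w hw using hS1 i w (le_of_lt hw)
        rw [this.deriv_eq]
        simp
    obtain ⟨D, hD⟩ := hsc.bounded_above_of_compact_support hcs
    -- No coercivity is needed here: `T` and `S i` are nondecreasing, so the dissipation integrals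
    -- are bounded below by `b = 0`.
    have := hφ.integral_flux_le hΩ hS.weakLaplacian hC.hasDerivAt_j hC.hasDerivAt_π
      hC.continuous_π' hC.π'_nonneg hC.abs_π_le hC.lipschitz_T
      (by filter_upwards [hS.nonneg] with x hx using hC.T_G _ hx) (hSC i)
      (fun v => ((hSC i).differentiable (by simp) v).hasDerivAt) hsc hD (hSz i 0 hε.le)
      (fun v => Real.smoothTransition.nonneg _) (fun v => Real.smoothTransition.le_one _) hπl
      (r := fun m => 1 / ((m : ℝ) + 1)) (fun m => by positivity)
      tendsto_one_div_add_atTop_nhds_zero_nat (b := fun _ => 0) tendsto_const_nhds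
      fun m => integral_nonneg fun x => by
        have h1 : T (G h a p (U x)) ≤ T (G h a p (U x) + 1 / ((m : ℝ) + 1)) :=
          hC.monotone_T (le_add_of_nonneg_right (by positivity))
        exact mul_nonneg (div_nonneg (sub_nonneg.2 h1) (by positivity))
          (mul_nonneg (hSm i).deriv_nonneg (by positivity))
    simpa using this
  have hlim : Tendsto (fun i => ∫ x in Ω, π (U x) * l x * S i (G h a p (U x))) atTop
      (𝓝 (∫ x in Ω, (Ioi σ).indicator (fun _ => (1 : ℝ)) (U x) * l x)) := by
    refine tendsto_integral_of_dominated_convergence (fun x => ‖π (U x) * l x‖)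
      (fun i => hπl.aestronglyMeasurable.mul
        ((hSC i).continuous.comp_aestronglyMeasurable hφ.memLp.aestronglyMeasurable))
      hπl.norm (fun i => Eventually.of_forall fun x => ?_) ?_
    · rw [norm_mul, Real.norm_of_nonneg (Real.smoothTransition.nonneg _)]
      exact mul_le_of_le_one_right (norm_nonneg _) (Real.smoothTransition.le_one _)
    · filter_upwards [hS.nonneg] with x hx
      rcases le_or_gt (U x) σ with hxσ | hxσ
      · have h1 : G h a p (U x) ≤ G h a p σ :=
          hA.G_monotoneOn (mem_Ici.2 hx) (mem_Ici.2 hσ.le) hxσ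
        simp_rw [hSz _ _ h1]
        rw [indicator_of_notMem (by simpa using hxσ)]
        simp
      · have h1 : G h a p σ < G h a p (U x) :=
          hA.G_strictMonoOn (mem_Ici.2 hσ.le) (mem_Ici.2 hx) hxσ
        rw [indicator_of_mem (by simpa using hxσ), hC.π_eq_one _ (by rw [hKε]; exact hxσ.le)]
        refine tendsto_const_nhds.congr' ?_
        have h2 : Tendsto (fun i : ℕ => ((i : ℝ) + 1) * (G h a p (U x) - G h a p σ)) atTop atTop :=
          (tendsto_atTop_add_const_right _ _ tendsto_natCast_atTop_atTop).atTop_mul_const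
            (by linarith)
        filter_upwards [h2.eventually_ge_atTop 1] with i hi
        simp [S, Real.smoothTransition.one_of_one_le hi]
  exact le_of_tendsto' hlim hi

end Elliptic

end EinsteinModel
end

/-! ### The energy estimate for a smooth truncation of `G(U)` -/

noncomputable section

namespace EinsteinModel

variable {h a : ℝ → ℝ} {p q γ c₃ c₄ : ℝ} {K : ℝ → ℝ}
  {N : ℕ} {Ω : Set (Euc N)} {U l : Euc N → ℝ}

theorem IsInverse.continuous_rpow (hA : IsAdmissible h a p q γ c₃ c₄) (hK : IsInverse h a p K) :
    Continuous fun v => H h (K v) ^ (γ + 1) :=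
  (hA.model.H_continuousOn.comp_continuous hK.continuous fun v => hK.nonneg v).rpow_const
    fun _ => Or.inr (by linarith [hA.γ_pos])

theorem IsAdmissible.rpow_mono (hA : IsAdmissible h a p q γ c₃ c₄) {s t : ℝ} (hs : 0 ≤ s)
    (hst : s ≤ t) : H h s ^ (γ + 1) ≤ H h t ^ (γ + 1) :=
  Real.rpow_le_rpow (hA.model.H_nonneg hs)
    (hA.model.H_monotoneOn (mem_Ici.2 hs) (mem_Ici.2 (hs.trans hst)) hst) (by linarith [hA.γ_pos])

theorem IsInverse.monotone_rpow (hA : IsAdmissible h a p q γ c₃ c₄) (hK : IsInverse h a p K) :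
    Monotone fun v => H h (K v) ^ (γ + 1) :=
  fun _ _ hvw => hA.rpow_mono (hK.nonneg _) (hK.monotone hvw)

/-- The energy estimate for the flux, tested with a smooth truncation `S` of `G(U)`. -/
theorem IsSlice.flux_le [IsFiniteMeasure (volume.restrict Ω)] (hN : 0 < N) (hΩ : IsOpen Ω)
    {R : ℝ} (hR0 : 0 < R) (hR : ∀ x ∈ Ω, ‖x‖ ≤ R) (hA : IsAdmissible h a p q γ c₃ c₄)
    (hS : IsSlice Ω h a p U l) {s : ℝ → ℝ} (hs : ContDiff ℝ ∞ s) (hs0 : ∀ v, 0 ≤ s v)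
    (hs1 : ∀ v, s v ≤ 1) {ε M ρ r : ℝ} (hε : 0 < ε) (hsε : ∀ v, v ≤ ε → s v = 0)
    (hsM : ∀ v, M ≤ v → s v = 0) (hρ : 0 < ρ) (hρr : ρ ≤ r)
    (hsρ : ∀ v, G h a p ρ ≤ v → v ≤ G h a p r → s v = 1) :
    ∫ x in Ω, (∫ y in (0 : ℝ)..G h a p (U x), s y) * l x
      ≤ -(c₃ / (4 * R ^ 2 * c₄ ^ 2) * ∫ x in Ω,
        (max 0 (H h (min (U x) r) ^ (γ + 1) - H h ρ ^ (γ + 1))) ^ 2) := by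
  obtain ⟨K, hK1, hK2, hK3, hK4, hK5⟩ := hA.exists_inverse
  have hK : IsInverse h a p K := ⟨hK1, hK2, hK3, hK4, hK5⟩
  obtain ⟨g, φ, hφ⟩ := hS.boundary.exists_approx
  obtain ⟨j, π, π', T, L, σ, hC⟩ := hK.exists_cutoff hA hε
  have hπc : Continuous π := continuous_iff_continuousAt.2 fun v => (hC.hasDerivAt_π v).continuousAt
  have hπl : IntegrableOn (fun x => π (U x) * l x) Ω :=
    hS.integrableOn_mul hA.model hπc.measurable hC.σ_pos hC.π_eq_zero hC.abs_π_le
  have hc3 := hA.c₃_pos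
  have hc4 := hA.c₄_pos
  have hr : 0 < r := hρ.trans_le hρr
  set S : ℝ → ℝ := fun v => ∫ y in (0 : ℝ)..v, s y
  have hSd : ∀ v, HasDerivAt S (s v) v := hasDerivAt_primitive hs.continuous
  have hsint := fun v w : ℝ => hs.continuous.intervalIntegrable (μ := volume) v w
  have hSm : Monotone S := monotone_of_hasDerivAt_nonneg hSd hs0
  have hSε : ∀ v, v ≤ ε → S v = 0 := fun v hv => by
    refine (intervalIntegral.integral_congr (g := fun _ => (0 : ℝ)) fun y hy => ?_).trans (by simp)
    exact hsε y (hy.2.trans (max_le hε.le hv))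
  have hSn : ∀ v, 0 ≤ S v := fun v => by
    rw [← hSε (min v ε) (min_le_right _ _)]
    exact hSm (min_le_left _ _)
  have hSM : ∀ v, S v ≤ S M := fun v => by
    rcases le_total v M with hv | hv
    · exact hSm hv
    · have e : S v - S M = ∫ y in M..v, s y :=
        intervalIntegral.integral_interval_sub_left (hsint _ _) (hsint _ _)
      rw [intervalIntegral.integral_congr (g := fun _ => (0 : ℝ)) fun y hy => by
        rw [uIcc_of_le hv] at hy
        exact hsM y hy.1] at e
      simp at e
      linarith
  have hSC : ContDiff ℝ ∞ S := by
    rw [contDiff_infty_iff_deriv, show deriv S = s from funext fun v => (hSd v).deriv]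
    exact ⟨fun v => (hSd v).differentiableAt, hs⟩
  have hscs : HasCompactSupport s := HasCompactSupport.intro (K := Icc ε M) isCompact_Icc
    fun v hv => by
      rcases le_total v ε with h1 | h1
      · exact hsε v h1
      · exact hsM v (by by_contra hcon; exact hv ⟨h1, (not_le.1 hcon).le⟩)
  -- The quantity `H(U)^{γ+1}` to which Poincaré's inequality is to apply, written as a function of
  -- `V = G(U)`.
  set θ : ℝ → ℝ := fun v => H h (K v) ^ (γ + 1)
  have hθc : Continuous θ := hK.continuous_rpow hA
  have hθm : Monotone θ := hK.monotone_rpow hA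
  have hθ0 : ∀ v, 0 ≤ θ v := fun v => Real.rpow_nonneg (hA.model.H_nonneg (hK.nonneg v)) _
  set rm : ℕ → ℝ := fun m => 1 / ((m : ℝ) + 1)
  have hrm : ∀ m, 0 < rm m := fun m => by positivity
  have hrm1 : ∀ m, rm m ≤ 1 := fun m => by
    simp only [rm]
    rw [div_le_one (by positivity)]
    simp
  have hrm0 : Tendsto rm atTop (𝓝 0) := tendsto_one_div_add_atTop_nhds_zero_nat
  -- A difference quotient of `θ`, localised by `s`. Its primitive at `V` is a truncated
  -- regularisation of `H(U)^{γ+1}`, with continuous and bounded derivative.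
  set ψ : ℕ → ℝ → ℝ := fun m v => (θ (v + rm m) - θ v) / rm m * s v
  have hψc : ∀ m, Continuous (ψ m) := fun m => by
    have := hs.continuous
    fun_prop
  have hψ0 : ∀ m v, 0 ≤ ψ m v := fun m v => mul_nonneg
    (div_nonneg (sub_nonneg.2 (hθm (by linarith [hrm m]))) (hrm m).le) (hs0 v)
  -- The inverse of the product of the Poincaré constant `4R²` and the factor `c₄²/c₃` of
  -- `IsAdmissible.sq_sub_le`.
  set κ := c₃ / (4 * R ^ 2 * c₄ ^ 2)
  have hκ : 0 < κ := by positivity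
  -- A lower bound for the squared primitive of `ψ m` at `V`: between `G(ρ)` and `G(r)` the cut-off
  -- equals `1`, so the primitive grows there exactly as the Steklov average of `θ`.
  set lo : ℕ → Euc N → ℝ := fun m x =>
    (max 0 (steklov θ (rm m) (min (G h a p (U x)) (G h a p r)) - steklov θ (rm m) (G h a p ρ))) ^ 2
  have hVm := hφ.memLp.aestronglyMeasurable
  have hstc : ∀ m, Continuous (steklov θ (rm m)) := fun m =>
    continuous_iff_continuousAt.2 fun v => (hasDerivAt_steklov hθc (rm m) v).continuousAt
  have hlom : ∀ m, AEStronglyMeasurable (lo m) (volume.restrict Ω) := fun m => by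
    have : Continuous fun v => (max 0 (steklov θ (rm m) (min v (G h a p r))
        - steklov θ (rm m) (G h a p ρ))) ^ 2 := by
      have := hstc m
      fun_prop
    exact this.comp_aestronglyMeasurable hVm
  have hstb : ∀ m v, v ≤ G h a p r → |steklov θ (rm m) v| ≤ 2 * θ (G h a p r + 1) := fun m v hv => by
    have h1 := abs_steklov_sub_le (v := v) (ε := θ (G h a p r + 1)) hθc (hrm m) fun y hy => by
      have h2 : θ y ≤ θ (G h a p r + 1) := hθm (by linarith [hy.2, hrm1 m])
      have h3 : θ v ≤ θ y := hθm hy.1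
      rw [abs_of_nonneg (by linarith)]
      linarith [hθ0 v]
    have h4 : θ v ≤ θ (G h a p r + 1) := hθm (by linarith)
    have h5 := abs_sub_abs_le_abs_sub (steklov θ (rm m) v) (θ v)
    rw [abs_of_nonneg (hθ0 v)] at h5
    linarith
  have hGρr : G h a p ρ ≤ G h a p r :=
    hA.G_monotoneOn (mem_Ici.2 hρ.le) (mem_Ici.2 hr.le) hρr
  have hlob : ∀ m x, ‖lo m x‖ ≤ (4 * θ (G h a p r + 1)) ^ 2 := fun m x => by
    rw [Real.norm_of_nonneg (sq_nonneg _)]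
    refine pow_le_pow_left₀ (le_max_left _ _) (max_le (mul_nonneg (by norm_num) (hθ0 _)) ?_) 2
    have h1 := abs_le.1 (hstb m _ (min_le_right (G h a p (U x)) (G h a p r)))
    have h2 := abs_le.1 (hstb m _ hGρr)
    linarith [h1.2, h2.1]
  have hlolim : Tendsto (fun m => κ * ∫ x in Ω, lo m x) atTop (𝓝 (κ * ∫ x in Ω,
      (max 0 (H h (min (U x) r) ^ (γ + 1) - H h ρ ^ (γ + 1))) ^ 2)) := by
    refine Tendsto.const_mul κ (tendsto_integral_of_dominated_convergence
      (fun _ => (4 * θ (G h a p r + 1)) ^ 2) hlom (integrable_const _)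
      (fun m => Eventually.of_forall (hlob m)) ?_)
    filter_upwards [hS.nonneg] with x hx
    have e1 : H h (min (U x) r) ^ (γ + 1) = θ (min (G h a p (U x)) (G h a p r)) := by
      simp only [θ]
      rw [hK.monotone.map_min, hK.apply_G _ hx, hK.apply_G _ hr.le]
    have e2 : H h ρ ^ (γ + 1) = θ (G h a p ρ) := by
      simp only [θ]
      rw [hK.apply_G _ hρ.le]
    rw [e1, e2]
    exact (tendsto_const_nhds.max ((tendsto_steklov hθc hrm hrm0 _).sub
      (tendsto_steklov hθc hrm hrm0 _))).pow 2
  have hbm : ∀ m, κ * ∫ x in Ω, lo m x ≤ ∫ x in Ω,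
      ((T (G h a p (U x) + rm m) - T (G h a p (U x))) / rm m)
        * (s (G h a p (U x)) * ‖g x‖ ^ 2) := fun m => by
    obtain ⟨D, hD⟩ := (hψc m).bounded_above_of_compact_support hscs.mul_left
    have hΨd := hasDerivAt_primitive (hψc m)
    have hP := hφ.poincare_comp hN hΨd (hψc m) hD (by simp) hR
    have hψint := fun v w : ℝ => (hψc m).intervalIntegrable (μ := volume) v w
    have hΨm : Monotone fun w => ∫ y in (0 : ℝ)..w, ψ m y :=
      monotone_of_hasDerivAt_nonneg hΨd (hψ0 m)
    have hΨL := abs_sub_le_of_hasDerivAt hΨd hD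
    have i1 : Integrable (fun x => (∫ y in (0 : ℝ)..G h a p (U x), ψ m y) ^ 2)
        (volume.restrict Ω) := (memLp_comp_of_lipschitz hΨL hφ.memLp).integrable_sq
    have i0 : Integrable (lo m) (volume.restrict Ω) :=
      Integrable.mono' (integrable_const _) (hlom m) (Eventually.of_forall (hlob m))
    have hlow : ∫ x in Ω, lo m x ≤ ∫ x in Ω, (∫ y in (0 : ℝ)..G h a p (U x), ψ m y) ^ 2 := by
      refine integral_mono_ae i0 i1 ?_
      filter_upwards [hS.nonneg] with x hx
      set v := G h a p (U x)
      have hΨ0 : 0 ≤ ∫ y in (0 : ℝ)..v, ψ m y :=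
        intervalIntegral.integral_nonneg (hA.G_nonneg hx) fun y _ => hψ0 m y
      refine pow_le_pow_left₀ (le_max_left _ _) (max_le hΨ0 ?_) 2
      rcases le_total v (G h a p ρ) with hv | hv
      · have : steklov θ (rm m) (min v (G h a p r)) ≤ steklov θ (rm m) (G h a p ρ) :=
          monotone_of_hasDerivAt_nonneg (hasDerivAt_steklov hθc (rm m)) (fun w =>
            div_nonneg (sub_nonneg.2 (hθm (by linarith [hrm m]))) (hrm m).le)
            ((min_le_left _ _).trans hv)
        linarith
      · have hle : G h a p ρ ≤ min v (G h a p r) := le_min hv hGρr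
        have hθd : Continuous fun y => (θ (y + rm m) - θ y) / rm m := by fun_prop
        have e1 : ∫ y in G h a p ρ..min v (G h a p r), ψ m y
            = steklov θ (rm m) (min v (G h a p r)) - steklov θ (rm m) (G h a p ρ) := by
          rw [← intervalIntegral.integral_eq_sub_of_hasDerivAt
            (fun y _ => hasDerivAt_steklov hθc (rm m) y) (hθd.intervalIntegrable _ _)]
          refine intervalIntegral.integral_congr fun y hy => ?_
          rw [uIcc_of_le hle] at hy
          simp only [ψ]
          rw [hsρ y hy.1 (hy.2.trans (min_le_right _ _)), mul_one]
        have e2 := intervalIntegral.integral_interval_sub_left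
          (hψint 0 (min v (G h a p r))) (hψint 0 (G h a p ρ))
        have h3 : 0 ≤ ∫ y in (0 : ℝ)..G h a p ρ, ψ m y :=
          intervalIntegral.integral_nonneg (hA.G_nonneg hρ.le) fun y _ => hψ0 m y
        have h4 := hΨm (min_le_left v (G h a p r))
        dsimp only at h4
        linarith
    have hg2 : Integrable (fun x => ‖g x‖ ^ 2) (volume.restrict Ω) :=
      hφ.memLp_grad.integrable_norm_pow (by norm_num)
    have i2 : Integrable (fun x => ψ m (G h a p (U x)) ^ 2 * ‖g x‖ ^ 2) (volume.restrict Ω) :=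
      hg2.bdd_mul (c := D ^ 2) (((hψc m).pow 2).comp_aestronglyMeasurable hVm)
        (Eventually.of_forall fun x => by
          rw [Real.norm_of_nonneg (sq_nonneg _), ← sq_abs]
          exact pow_le_pow_left₀ (abs_nonneg _) (hD _) 2)
    have hTc := continuous_of_abs_sub_le hC.lipschitz_T
    have i3 : Integrable (fun x => ((T (G h a p (U x) + rm m) - T (G h a p (U x))) / rm m)
        * (s (G h a p (U x)) * ‖g x‖ ^ 2)) (volume.restrict Ω) := by
      refine Integrable.bdd_mul (c := L) ?_ ?_ (Eventually.of_forall fun x => ?_)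
      · exact hg2.bdd_mul (c := 1) (hs.continuous.comp_aestronglyMeasurable hVm)
          (Eventually.of_forall fun x => by
            rw [Real.norm_of_nonneg (hs0 _)]
            exact hs1 _)
      · have : Continuous fun v => (T (v + rm m) - T v) / rm m := by fun_prop
        exact this.comp_aestronglyMeasurable hVm
      · rw [norm_div, Real.norm_of_nonneg (hrm m).le, div_le_iff₀ (hrm m)]
        simpa [abs_of_pos (hrm m)] using hC.lipschitz_T (G h a p (U x) + rm m) (G h a p (U x))
    -- Pointwise, `ψ²` is at most `c₄²/c₃` times the difference quotient of `T` times `s`. This uses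
    -- `IsAdmissible.sq_sub_le` between `K(v)` and `K(v + rₘ)`, the equality of the increments of
    -- `T` and `K` above `ε`, and `s² ≤ s`.
    have hup : ∫ x in Ω, ψ m (G h a p (U x)) ^ 2 * ‖g x‖ ^ 2 ≤ c₄ ^ 2 / c₃ * ∫ x in Ω,
        ((T (G h a p (U x) + rm m) - T (G h a p (U x))) / rm m)
          * (s (G h a p (U x)) * ‖g x‖ ^ 2) := by
      rw [← integral_const_mul]
      refine integral_mono i2 (i3.const_mul _) fun x => ?_
      set v := G h a p (U x)
      dsimp only
      rw [← mul_assoc, ← mul_assoc]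
      refine mul_le_mul_of_nonneg_right ?_ (sq_nonneg _)
      rcases le_or_gt v ε with hv | hv
      · simp [ψ, hsε v hv]
      · have hv0 : 0 ≤ v := hε.le.trans hv.le
        have h1 := hA.sq_sub_le (hK.nonneg v) (hK.monotone (show v ≤ v + rm m by linarith [hrm m]))
        rw [hK.G_apply, hK.G_apply, max_eq_left hv0, max_eq_left (by linarith [hrm m]),
          add_sub_cancel_left, ← hC.T_sub v _ hv.le (by linarith [hrm m])] at h1
        have hsq : s v ^ 2 ≤ s v := by nlinarith [hs0 v, hs1 v]
        have hX : 0 ≤ c₄ ^ 2 / c₃ * ((T (v + rm m) - T v) / rm m) :=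
          mul_nonneg (by positivity) (div_nonneg (sub_nonneg.2 (hC.monotone_T
            (by linarith [hrm m]))) (hrm m).le)
        calc ψ m v ^ 2 = (θ (v + rm m) - θ v) ^ 2 / rm m ^ 2 * s v ^ 2 := by
              simp only [ψ]; ring
          _ ≤ (c₄ ^ 2 / c₃ * ((T (v + rm m) - T v) * rm m)) / rm m ^ 2 * s v ^ 2 := by
              gcongr
          _ = c₄ ^ 2 / c₃ * ((T (v + rm m) - T v) / rm m) * s v ^ 2 := by
              have := (hrm m).ne'
              field_simp
          _ ≤ _ := mul_le_mul_of_nonneg_left hsq hX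
    calc κ * ∫ x in Ω, lo m x ≤ κ * (4 * R ^ 2 * (c₄ ^ 2 / c₃ * ∫ x in Ω,
          ((T (G h a p (U x) + rm m) - T (G h a p (U x))) / rm m)
            * (s (G h a p (U x)) * ‖g x‖ ^ 2))) := by
          refine mul_le_mul_of_nonneg_left ?_ hκ.le
          exact hlow.trans (hP.trans (mul_le_mul_of_nonneg_left hup (by positivity)))
      _ = _ := by
          simp only [κ]
          field_simp
  have hmain := hφ.integral_flux_le hΩ hS.weakLaplacian hC.hasDerivAt_j hC.hasDerivAt_π
    hC.continuous_π' hC.π'_nonneg hC.abs_π_le hC.lipschitz_T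
    (by filter_upwards [hS.nonneg] with x hx using hC.T_G _ hx) hSC hSd hs.continuous
    (D := 1) (fun v => by rw [abs_of_nonneg (hs0 v)]; exact hs1 v) (by simp [S]) hSn hSM hπl
    hrm hrm0 hlolim hbm
  refine le_of_eq_of_le (integral_congr_ae ?_) hmain
  filter_upwards [hS.nonneg] with x hx
  change S (G h a p (U x)) * l x = _
  -- The cut-off `π` is invisible in the flux: where it may differ from `1`, the factor `S(G(U))`
  -- vanishes.
  rcases le_or_gt (G h a p (U x)) ε with hv | hv
  · rw [hSε _ hv]
    simp
  · have : K ε ≤ U x := by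
      rw [← hK.apply_G _ hx]
      exact hK.monotone hv.le
    rw [hC.π_eq_one _ this]
    ring

end EinsteinModel
end

/-! ### Monotone multipliers and the truncated flux -/

noncomputable section

namespace EinsteinModel

/-- A superlevel set of a continuous monotone function on `[0, ∞)` is empty or a half line. -/
theorem superlevel_eq_Ioi {P : ℝ → ℝ} (hPc : ContinuousOn P (Ici 0)) (hPm : MonotoneOn P (Ici 0))
    (hP0 : P 0 = 0) {t : ℝ} (ht : 0 < t) :
    (∀ s, 0 ≤ s → P s ≤ t) ∨ ∃ σ, 0 < σ ∧ ∀ s, 0 ≤ s → (t < P s ↔ σ < s) := by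
  by_cases hb : ∀ s, 0 ≤ s → P s ≤ t
  · exact Or.inl hb
  push Not at hb
  obtain ⟨b, hb0, hb⟩ := hb
  refine Or.inr ?_
  obtain ⟨σ, hσ, hPσ⟩ : t ∈ P '' Icc 0 b := by
    refine intermediate_value_Icc hb0 (hPc.mono fun x hx => hx.1) ⟨?_, hb.le⟩
    rw [hP0]
    exact ht.le
  -- the largest solution of `P σ = t`
  set A := {s | s ∈ Icc 0 b ∧ P s = t} with hAdef
  have hAne : A.Nonempty := ⟨σ, hσ, hPσ⟩
  have hAc : IsClosed A :=
    (hPc.mono fun x hx => hx.1).preimage_isClosed_of_isClosed isClosed_Icc isClosed_singleton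
  have hAb : BddAbove A := ⟨b, fun x hx => hx.1.2⟩
  have hmem : sSup A ∈ A := hAc.csSup_mem hAne hAb
  have h0 : 0 ≤ sSup A := hmem.1.1
  refine ⟨sSup A, h0.lt_of_ne fun h => ?_, fun s hs => ⟨fun h => ?_, fun h => ?_⟩⟩
  · have := hmem.2
    rw [← h, hP0] at this
    exact ht.ne this
  · by_contra hcon
    have := hPm (mem_Ici.2 hs) (mem_Ici.2 h0) (not_lt.1 hcon)
    rw [hmem.2] at this
    linarith
  · have h1 := hPm (mem_Ici.2 h0) (mem_Ici.2 hs) h.le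
    rw [hmem.2] at h1
    refine h1.lt_of_ne fun he => ?_
    have hsb : s ≤ b := by
      by_contra hcon
      have := hPm (mem_Ici.2 hb0) (mem_Ici.2 hs) (not_le.1 hcon).le
      linarith
    exact absurd (le_csSup hAb ⟨⟨hs, hsb⟩, he.symm⟩) (not_le.2 h)

variable {h a : ℝ → ℝ} {p q γ c₃ c₄ : ℝ} {N : ℕ} {Ω : Set (Euc N)} {U l : Euc N → ℝ}

theorem lintegral_ofReal_le_of_integral_nonpos {α : Type*} [MeasurableSpace α] {μ : Measure α}
    {f : α → ℝ} (hf : Integrable f μ) (h0 : ∫ x, f x ∂μ ≤ 0) :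
    ∫⁻ x, ENNReal.ofReal (f x) ∂μ ≤ ∫⁻ x, ENNReal.ofReal (-f x) ∂μ := by
  rw [integral_eq_lintegral_pos_part_sub_lintegral_neg_part hf, sub_nonpos] at h0
  exact (ENNReal.toReal_le_toReal hf.lintegral_lt_top.ne hf.neg.lintegral_lt_top.ne).1 h0

/-- By the layer cake formula the integral is a superposition over `t > 0` of the fluxes through
`{P(U) > t}`. Up to a null set, each such set is empty or of the form `{U > σ}` with `σ > 0`, where
the flux is nonpositive. No derivative of `P` is involved. -/
theorem IsSlice.integral_mul_nonpos [IsFiniteMeasure (volume.restrict Ω)]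
    (hΩ : IsOpen Ω) (hA : IsAdmissible h a p q γ c₃ c₄) (hS : IsSlice Ω h a p U l) {P : ℝ → ℝ}
    (hPc : ContinuousOn P (Ici 0)) (hPm : MonotoneOn P (Ici 0)) (hP0 : P 0 = 0)
    (hPl : IntegrableOn (fun x => P (U x) * l x) Ω) : ∫ x in Ω, P (U x) * l x ≤ 0 := by
  set μ := volume.restrict Ω with hμ
  have hUm : AEMeasurable U μ := hS.aestronglyMeasurable.aemeasurable
  have hlm : AEMeasurable l μ := hS.aestronglyMeasurable_lap.aemeasurable
  have hPUm : AEMeasurable (fun x => P (U x)) μ := by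
    have h1 : AEMeasurable (fun x => P (max (U x) 0)) μ :=
      (hPc.comp_continuous (by fun_prop) fun v => le_max_right v 0 :
        Continuous fun v => P (max v 0)).measurable.comp_aemeasurable hUm
    refine h1.congr ?_
    filter_upwards [hS.nonneg] with x hx
    rw [max_eq_left hx]
  have hPU0 : ∀ᵐ x ∂μ, 0 ≤ P (U x) := by
    filter_upwards [hS.nonneg] with x hx
    have := hPm (mem_Ici.2 le_rfl) (mem_Ici.2 hx) hx
    rwa [hP0] at this
  -- the two parts of the integral, by the layer cake formula
  have layer : ∀ k : Euc N → ℝ, AEMeasurable k μ →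
      ∫⁻ x, ENNReal.ofReal (P (U x) * k x) ∂μ
        = ∫⁻ t in Ioi (0 : ℝ), ∫⁻ x in {x | t < P (U x)}, ENNReal.ofReal (k x) ∂μ := by
    intro k hk
    have hac : μ.withDensity (fun x => ENNReal.ofReal (k x)) ≪ μ :=
      withDensity_absolutelyContinuous _ _
    have e1 : ∫⁻ x, ENNReal.ofReal (P (U x) * k x) ∂μ
        = ∫⁻ x, ENNReal.ofReal (P (U x)) ∂(μ.withDensity fun x => ENNReal.ofReal (k x)) := by
      rw [lintegral_withDensity_eq_lintegral_mul₀ hk.ennreal_ofReal hPUm.ennreal_ofReal]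
      refine lintegral_congr_ae ?_
      filter_upwards [hPU0] with x hx
      rw [Pi.mul_apply, ENNReal.ofReal_mul hx, mul_comm]
    rw [e1, lintegral_eq_lintegral_meas_lt _ (hac.ae_le hPU0) (hPUm.mono_ac hac)]
    refine lintegral_congr fun t => ?_
    rw [withDensity_apply₀]
    exact nullMeasurableSet_lt aemeasurable_const hPUm
  have hle : ∀ t ∈ Ioi (0 : ℝ), ∫⁻ x in {x | t < P (U x)}, ENNReal.ofReal (l x) ∂μ
      ≤ ∫⁻ x in {x | t < P (U x)}, ENNReal.ofReal (-l x) ∂μ := fun t ht => by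
    rcases superlevel_eq_Ioi hPc hPm hP0 ht with hall | ⟨σ, hσ, hiff⟩
    · have : μ {x | t < P (U x)} = 0 := by
        rw [measure_eq_zero_iff_ae_notMem]
        filter_upwards [hS.nonneg] with x hx
        simpa using hall _ hx
      rw [setLIntegral_measure_zero _ _ this]
      exact zero_le
    · have hnull : NullMeasurableSet {x | t < P (U x)} μ :=
        nullMeasurableSet_lt aemeasurable_const hPUm
      have hconv : ∀ k : Euc N → ℝ, ∫⁻ x in {x | t < P (U x)}, ENNReal.ofReal (k x) ∂μ
          = ∫⁻ x, ENNReal.ofReal ((Ioi σ).indicator (fun _ => (1 : ℝ)) (U x) * k x) ∂μ :=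
        fun k => by
        rw [← lintegral_indicator₀ hnull]
        refine lintegral_congr_ae ?_
        filter_upwards [hS.nonneg] with x hx
        by_cases hx' : t < P (U x)
        · rw [indicator_of_mem (by simpa using hx'),
            indicator_of_mem (by simpa using (hiff _ hx).1 hx'), one_mul]
        · rw [indicator_of_notMem (by simpa using hx'),
            indicator_of_notMem (s := Ioi σ) (a := U x) (fun h' => hx' ((hiff _ hx).2 h')), zero_mul, ENNReal.ofReal_zero]
      rw [hconv, hconv]
      have hint : Integrable (fun x => (Ioi σ).indicator (fun _ => (1 : ℝ)) (U x) * l x) μ := by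
        refine hS.integrableOn_mul hA.model (measurable_const.indicator measurableSet_Ioi) hσ
          (fun s hs => indicator_of_notMem (by simpa using hs) _) (B := 1) fun s => ?_
        by_cases hs : s ∈ Ioi σ
        · simp [indicator_of_mem hs]
        · simp [indicator_of_notMem hs]
      have := lintegral_ofReal_le_of_integral_nonpos hint
        (hS.setIntegral_superlevel_nonpos hΩ hA hσ)
      simpa only [mul_neg] using this
  rw [integral_eq_lintegral_pos_part_sub_lintegral_neg_part hPl, sub_nonpos]
  refine ENNReal.toReal_mono hPl.neg.lintegral_lt_top.ne ?_
  have e : ∀ x, -(P (U x) * l x) = P (U x) * -l x := fun x => by ring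
  simp_rw [e]
  rw [layer l hlm, layer (fun x => -l x) hlm.neg]
  exact setLIntegral_mono' measurableSet_Ioi hle

/-- The truncated flux `∫ min(H(U), k)^p F(U) l` is integrable. -/
theorem IsSlice.integrable_truncated (hA : IsAdmissible h a p q γ c₃ c₄)
    (hS : IsSlice Ω h a p U l) {k : ℝ} (hk : 0 ≤ k) :
    IntegrableOn (fun x => min (H h (U x)) k ^ p * F h a (U x) * l x) Ω := by
  have hHm : AEStronglyMeasurable (fun x => min (H h (U x)) k ^ p) (volume.restrict Ω) := by
    have hc : Continuous fun v => min (H h (max v 0)) k ^ p :=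
      (hA.model.continuous_H_max.min continuous_const).rpow_const fun _ => Or.inr hA.p_pos.le
    refine (hc.comp_aestronglyMeasurable hS.aestronglyMeasurable).congr ?_
    filter_upwards [hS.nonneg] with x hx
    simp [max_eq_left hx]
  have := Integrable.bdd_mul (c := k ^ p) hS.integrable hHm (by
    filter_upwards [hS.nonneg] with x hx
    have h0 : 0 ≤ min (H h (U x)) k := le_min (hA.model.H_nonneg hx) hk
    rw [Real.norm_of_nonneg (Real.rpow_nonneg h0 _)]
    exact Real.rpow_le_rpow h0 (min_le_right _ _) hA.p_pos.le)
  exact this.congr (Eventually.of_forall fun x => by simp [mul_assoc])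

theorem IsAdmissible.truncated_continuousOn (hA : IsAdmissible h a p q γ c₃ c₄) (k : ℝ) :
    ContinuousOn (fun s => min (H h s) k ^ p * F h a s) (Ici 0) :=
  ((hA.model.H_continuousOn.inf continuousOn_const).rpow_const
    fun _ _ => Or.inr hA.p_pos.le).mul hA.model.F_continuousOn

theorem IsAdmissible.truncated_mono (hA : IsAdmissible h a p q γ c₃ c₄) {k : ℝ} (hk : 0 ≤ k) :
    MonotoneOn (fun s => min (H h s) k ^ p) (Ici 0) := fun _ hs _ ht hst =>
  Real.rpow_le_rpow (le_min (hA.model.H_nonneg hs) hk)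
    (min_le_min_right k (hA.model.H_monotoneOn hs ht hst)) hA.p_pos.le

theorem IsSlice.truncated_nonpos [IsFiniteMeasure (volume.restrict Ω)]
    (hΩ : IsOpen Ω) (hA : IsAdmissible h a p q γ c₃ c₄) (hS : IsSlice Ω h a p U l) {k : ℝ}
    (hk : 0 ≤ k) : ∫ x in Ω, min (H h (U x)) k ^ p * F h a (U x) * l x ≤ 0 := by
  refine hS.integral_mul_nonpos hΩ hA (hA.truncated_continuousOn k) (fun s hs t ht hst => ?_)
    (by simp [hA.model.F_zero]) (hS.integrable_truncated hA hk)
  exact mul_le_mul (hA.truncated_mono hk hs ht hst) (hA.model.F_mono hs ht hst)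
    (hA.model.F_nonneg hs) (Real.rpow_nonneg (le_min (hA.model.H_nonneg ht) hk) _)

/-- Raising the truncation level changes the multiplier by a nondecreasing function vanishing at
zero. The resulting monotonicity in `k` is what allows monotone convergence of the dissipation rates
in time. -/
theorem IsSlice.truncated_antitone [IsFiniteMeasure (volume.restrict Ω)]
    (hΩ : IsOpen Ω) (hA : IsAdmissible h a p q γ c₃ c₄) (hS : IsSlice Ω h a p U l) {k k' : ℝ}
    (hk : 0 ≤ k) (hkk' : k ≤ k') :
    ∫ x in Ω, (min (H h (U x)) k' ^ p - min (H h (U x)) k ^ p) * (F h a (U x) * l x) ≤ 0 := by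
  have hi := (hS.integrable_truncated hA (hk.trans hkk')).sub (hS.integrable_truncated hA hk)
  have hnn : ∀ s, 0 ≤ s → 0 ≤ min (H h s) k' ^ p - min (H h s) k ^ p := fun s hs =>
    sub_nonneg.2 (Real.rpow_le_rpow (le_min (hA.model.H_nonneg hs) hk)
      (min_le_min_left _ hkk') hA.p_pos.le)
  have hmono : MonotoneOn (fun s => min (H h s) k' ^ p - min (H h s) k ^ p) (Ici 0) := by
    intro s hs t ht hst
    have hst' := hA.model.H_monotoneOn hs ht hst
    have hs0 := hA.model.H_nonneg hs
    dsimp only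
    rcases le_total (H h t) k with h1 | h1
    · rw [min_eq_left h1, min_eq_left (h1.trans hkk'), min_eq_left (hst'.trans h1),
        min_eq_left ((hst'.trans h1).trans hkk'), sub_self, sub_self]
    · have h2 := hA.truncated_mono (hk.trans hkk') hs ht hst
      dsimp only at h2
      rcases le_total (H h s) k with h3 | h3
      · rw [min_eq_left h3, min_eq_left (h3.trans hkk'), sub_self]
        exact hnn t ht
      · rw [min_eq_right h1, min_eq_right h3]
        linarith
  have := hS.integral_mul_nonpos hΩ hA
    (P := fun s => (min (H h s) k' ^ p - min (H h s) k ^ p) * F h a s)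
    (by
      refine ((hA.truncated_continuousOn k').sub (hA.truncated_continuousOn k)).congr
        fun s _ => ?_
      simp [sub_mul])
    (fun s hs t ht hst => mul_le_mul (hmono hs ht hst) (hA.model.F_mono hs ht hst)
      (hA.model.F_nonneg hs) (hnn t ht))
    (by simp [hA.model.F_zero])
    (hi.congr (Eventually.of_forall fun x => by simp [sub_mul]))
  simpa only [mul_assoc] using this

/-- The energy inequality for the truncated flux. -/
theorem IsSlice.truncated_le [IsFiniteMeasure (volume.restrict Ω)] (hN : 0 < N) (hΩ : IsOpen Ω)
    {R : ℝ} (hR0 : 0 < R) (hR : ∀ x ∈ Ω, ‖x‖ ≤ R) (hA : IsAdmissible h a p q γ c₃ c₄)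
    (hS : IsSlice Ω h a p U l) {k r : ℝ} (hr : 0 < r) (hrk : H h r < k) :
    ∫ x in Ω, min (H h (U x)) k ^ p * F h a (U x) * l x
      ≤ -(c₃ / (4 * R ^ 2 * c₄ ^ 2) * ∫ x in Ω, (H h (min (U x) r) ^ (γ + 1)) ^ 2) := by
  have hk : 0 ≤ k := (hA.model.H_nonneg hr.le).trans hrk.le
  -- The gap between `r` and `r'` is where the cut-off `s` switches off; up to `r'` the truncation
  -- at `k` is inactive and the multiplier equals `G`.
  obtain ⟨r', hrr', hr'k⟩ : ∃ r', r < r' ∧ H h r' < k := by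
    have h1 : ContinuousAt (H h) r := (hA.model.H_continuousOn r hr.le).continuousAt (Ici_mem_nhds hr)
    have h2 := (h1.eventually (gt_mem_nhds hrk)).filter_mono (nhdsWithin_le_nhds (s := Ioi r))
    obtain ⟨r', h3, h4⟩ := (h2.and self_mem_nhdsWithin).exists
    exact ⟨r', h4, h3⟩
  have hr'0 : 0 < r' := hr.trans hrr'
  have hGrr' := hA.G_strictMonoOn (mem_Ici.2 hr.le) (mem_Ici.2 hr'0.le) hrr'
  -- the estimate with the lower cut-off level `ρ`
  have hρ : ∀ ρ, 0 < ρ → ρ ≤ r → ∫ x in Ω, min (H h (U x)) k ^ p * F h a (U x) * l x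
      ≤ -(c₃ / (4 * R ^ 2 * c₄ ^ 2) * ∫ x in Ω,
        (max 0 (H h (min (U x) r) ^ (γ + 1) - H h ρ ^ (γ + 1))) ^ 2) := by
    intro ρ hρ hρr
    have hρ2 : 0 < ρ / 2 := by positivity
    have hGρ := hA.G_strictMonoOn (mem_Ici.2 hρ2.le) (mem_Ici.2 hρ.le) (half_lt_self hρ)
    have hε := hA.G_pos hρ2
    set ε := G h a p (ρ / 2)
    set M := G h a p r'
    have hd1 : 0 < G h a p ρ - ε := by linarith
    have hd2 : 0 < M - G h a p r := by linarith
    set s : ℝ → ℝ := fun v => Real.smoothTransition ((v - ε) / (G h a p ρ - ε))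
      * Real.smoothTransition ((M - v) / (M - G h a p r))
    have hs : ContDiff ℝ ∞ s :=
      (Real.smoothTransition.contDiff.comp (by fun_prop)).mul
        (Real.smoothTransition.contDiff.comp (by fun_prop))
    have hs0 : ∀ v, 0 ≤ s v := fun v =>
      mul_nonneg (Real.smoothTransition.nonneg _) (Real.smoothTransition.nonneg _)
    have hs1 : ∀ v, s v ≤ 1 := fun v => mul_le_one₀ (Real.smoothTransition.le_one _)
      (Real.smoothTransition.nonneg _) (Real.smoothTransition.le_one _)
    have hsε : ∀ v, v ≤ ε → s v = 0 := fun v hv => by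
      simp only [s]
      rw [Real.smoothTransition.zero_of_nonpos
        (div_nonpos_of_nonpos_of_nonneg (by linarith) hd1.le), zero_mul]
    have hsM : ∀ v, M ≤ v → s v = 0 := fun v hv => by
      simp only [s]
      rw [Real.smoothTransition.zero_of_nonpos (x := (M - v) / _)
        (div_nonpos_of_nonpos_of_nonneg (by linarith) hd2.le), mul_zero]
    have hsρ : ∀ v, G h a p ρ ≤ v → v ≤ G h a p r → s v = 1 := fun v h1 h2 => by
      simp only [s]
      rw [Real.smoothTransition.one_of_one_le ((one_le_div hd1).2 (by linarith)),
        Real.smoothTransition.one_of_one_le ((one_le_div hd2).2 (by linarith)), one_mul]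
    refine le_trans ?_ (hS.flux_le hN hΩ hR0 hR hA hs hs0 hs1 hε hsε hsM hρ hρr hsρ)
    set S : ℝ → ℝ := fun v => ∫ y in (0 : ℝ)..v, s y
    have hSd : ∀ v, HasDerivAt S (s v) v := hasDerivAt_primitive hs.continuous
    have hSc : Continuous S := continuous_iff_continuousAt.2 fun v => (hSd v).continuousAt
    have hSm : Monotone S := monotone_of_hasDerivAt_nonneg hSd hs0
    have hSL := abs_sub_le_of_hasDerivAt hSd fun v => (abs_of_nonneg (hs0 v)).trans_le (hs1 v)
    have hSM : ∀ v, M ≤ v → S v = S M := fun v hv => by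
      have e : S v - S M = ∫ y in M..v, s y := intervalIntegral.integral_interval_sub_left
        (hs.continuous.intervalIntegrable _ _) (hs.continuous.intervalIntegrable _ _)
      rw [intervalIntegral.integral_congr (g := fun _ => (0 : ℝ)) fun y hy => by
        rw [uIcc_of_le hv] at hy
        exact hsM y hy.1] at e
      simp at e
      linarith
    have hSε : ∀ v, v ≤ ε → S v = 0 := fun v hv => by
      refine (intervalIntegral.integral_congr (g := fun _ => (0 : ℝ)) fun y hy => ?_).trans
        (by simp)
      exact hsε y (hy.2.trans (max_le hε.le hv))
    have hSb : ∀ v, |S v| ≤ S M := fun v => by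
      have h0 : 0 ≤ S v := by
        rw [← hSε (min v ε) (min_le_right _ _)]
        exact hSm (min_le_left _ _)
      rw [abs_of_nonneg h0, ← hSM (max v M) (le_max_right _ _)]
      exact hSm (le_max_left _ _)
    have hGc : Continuous fun v => S (G h a p (max v 0)) :=
      hSc.comp (hA.G_continuousOn.comp_continuous (by fun_prop) fun v => le_max_right v 0)
    have hSl : IntegrableOn (fun x => S (G h a p (U x)) * l x) Ω := by
      have h1 := hS.integrableOn_mul hA.model hGc.measurable hρ2
        (fun v hv => hSε _ (hA.G_monotoneOn (mem_Ici.2 (le_max_right v 0)) (mem_Ici.2 hρ2.le)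
          (max_le hv hρ2.le))) fun v => hSb _
      refine h1.congr ?_
      filter_upwards [hS.nonneg] with x hx
      rw [max_eq_left hx]
    -- Up to `r'` the difference is `G - S(G)`, nondecreasing because `S` has slope at most `1`;
    -- beyond `r'` the term `S(G)` is constant. Hence the truncated flux is bounded above by that of
    -- `S(G)`.
    have hmono : MonotoneOn (fun s => min (H h s) k ^ p * F h a s - S (G h a p s)) (Ici 0) := by
      have hu : Icc 0 r' ∪ Ici r' = Ici 0 := Icc_union_Ici_eq_Ici hr'0.le
      rw [← hu]
      refine MonotoneOn.union_right (c := r') (fun s hs t ht hst => ?_) (fun s hs t ht hst => ?_)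
        ⟨⟨hr'0.le, le_rfl⟩, fun x hx => hx.2⟩ ⟨mem_Ici.2 le_rfl, fun x hx => hx⟩
      · have hHk : ∀ w ∈ Icc 0 r', min (H h w) k ^ p * F h a w = G h a p w := fun w hw => by
          rw [min_eq_left ((hA.model.H_monotoneOn (mem_Ici.2 hw.1) (mem_Ici.2 hr'0.le)
            hw.2).trans hr'k.le), G]
        rw [hHk s hs, hHk t ht]
        have h1 := hA.G_monotoneOn (mem_Ici.2 hs.1) (mem_Ici.2 ht.1) hst
        have h2 := (le_abs_self _).trans (hSL (G h a p t) (G h a p s))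
        rw [abs_of_nonneg (sub_nonneg.2 h1)] at h2
        linarith
      · have hs' : s ∈ Ici (0 : ℝ) := mem_Ici.2 (hr'0.le.trans hs)
        have ht' : t ∈ Ici (0 : ℝ) := mem_Ici.2 (hr'0.le.trans ht)
        rw [hSM _ (hA.G_monotoneOn (mem_Ici.2 hr'0.le) hs' hs),
          hSM _ (hA.G_monotoneOn (mem_Ici.2 hr'0.le) ht' ht)]
        refine sub_le_sub_right ?_ _
        exact mul_le_mul (hA.truncated_mono hk hs' ht' hst) (hA.model.F_mono hs' ht' hst)
          (hA.model.F_nonneg hs') (Real.rpow_nonneg (le_min (hA.model.H_nonneg ht') hk) _)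
    have hdiff := (hS.integrable_truncated hA hk).sub hSl
    have hfin := hS.integral_mul_nonpos hΩ hA
      (P := fun s => min (H h s) k ^ p * F h a s - S (G h a p s))
      ((hA.truncated_continuousOn k).sub (hSc.comp_continuousOn hA.G_continuousOn)) hmono
      (by simp [hA.model.F_zero, hA.model.G_zero, S])
      (hdiff.congr (Eventually.of_forall fun x => by simp [sub_mul]))
    simp_rw [sub_mul] at hfin
    rw [integral_sub (hS.integrable_truncated hA hk) hSl] at hfin
    linarith
  -- remove the lower cut-off
  set ρn : ℕ → ℝ := fun n => r * (1 / ((n : ℝ) + 1))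
  have hρn0 : Tendsto ρn atTop (𝓝 0) := by
    have := tendsto_one_div_add_atTop_nhds_zero_nat (𝕜 := ℝ) |>.const_mul r
    rw [mul_zero] at this
    exact this
  have hρnp : ∀ n, 0 < ρn n := fun n => by positivity
  have hρnr : ∀ n, ρn n ≤ r := fun n => by
    refine mul_le_of_le_one_right hr.le ?_
    rw [div_le_one (by positivity)]
    simp
  have hHr : Continuous fun v => H h (min (max v 0) r) ^ (γ + 1) :=
    (hA.model.H_continuousOn.comp_continuous (by fun_prop) fun v =>
      le_min (le_max_right v 0) hr.le).rpow_const fun _ => Or.inr (by linarith [hA.γ_pos])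
  have hHm : AEStronglyMeasurable (fun x => H h (min (U x) r) ^ (γ + 1)) (volume.restrict Ω) := by
    refine (hHr.comp_aestronglyMeasurable hS.aestronglyMeasurable).congr ?_
    filter_upwards [hS.nonneg] with x hx
    rw [max_eq_left hx]
  have hlim : Tendsto (fun n => ∫ x in Ω,
      (max 0 (H h (min (U x) r) ^ (γ + 1) - H h (ρn n) ^ (γ + 1))) ^ 2) atTop
      (𝓝 (∫ x in Ω, (H h (min (U x) r) ^ (γ + 1)) ^ 2)) := by
    have hHρ : Tendsto (fun n => H h (ρn n) ^ (γ + 1)) atTop (𝓝 0) := by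
      have h1 : Tendsto (H h) (𝓝[Ici 0] 0) (𝓝 0) := by
        simpa [ContinuousWithinAt, H_zero] using hA.model.H_continuousOn 0 (mem_Ici.2 le_rfl)
      have h2 := h1.comp (tendsto_nhdsWithin_iff.2
        ⟨hρn0, Eventually.of_forall fun n => mem_Ici.2 (hρnp n).le⟩)
      have h3 := h2.rpow_const (p := γ + 1) (Or.inr (by linarith [hA.γ_pos]))
      rwa [Real.zero_rpow (by linarith [hA.γ_pos])] at h3
    refine tendsto_integral_of_dominated_convergence (fun _ => (H h r ^ (γ + 1)) ^ 2)
      (fun n => ?_) (integrable_const _) (fun n => ?_) ?_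
    · exact ((aestronglyMeasurable_const (b := (0 : ℝ))).sup (hHm.sub aestronglyMeasurable_const)).pow 2
    · filter_upwards [hS.nonneg] with x hx
      rw [Real.norm_of_nonneg (sq_nonneg _)]
      have h1 := hA.rpow_mono (le_min hx hr.le) (min_le_right (U x) r)
      have h2 : 0 ≤ H h (ρn n) ^ (γ + 1) := Real.rpow_nonneg (hA.model.H_nonneg (hρnp n).le) _
      have h3 : 0 ≤ H h r ^ (γ + 1) := Real.rpow_nonneg (hA.model.H_nonneg hr.le) _
      exact pow_le_pow_left₀ (le_max_left _ _) (max_le h3 (by linarith)) 2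
    · filter_upwards [hS.nonneg] with x hx
      have h1 : 0 ≤ H h (min (U x) r) ^ (γ + 1) :=
        Real.rpow_nonneg (hA.model.H_nonneg (le_min hx hr.le)) _
      have h2 := ((tendsto_const_nhds (x := (0 : ℝ))).max
        ((tendsto_const_nhds (x := H h (min (U x) r) ^ (γ + 1))).sub hHρ)).pow 2
      rwa [sub_zero, max_eq_right h1] at h2
  exact ge_of_tendsto' (hlim.const_mul _).neg fun n => hρ _ (hρnp n) (hρnr n)

end EinsteinModel
end

/-! ### Integration in time: chain rule, truncated powers, dissipation -/

noncomputable section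

namespace EinsteinModel

theorem AbsolutelyContinuousOnInterval.of_dist_le {f g : ℝ → ℝ} {a b B : ℝ}
    (hf : AbsolutelyContinuousOnInterval f a b)
    (hfg : ∀ x ∈ uIcc a b, ∀ y ∈ uIcc a b, dist (g x) (g y) ≤ B * dist (f x) (f y)) :
    AbsolutelyContinuousOnInterval g a b := by
  rw [absolutelyContinuousOnInterval_iff] at hf ⊢
  intro ε hε
  have hB : 0 < |B| + 1 := by positivity
  obtain ⟨δ, hδ, hf⟩ := hf (ε / (|B| + 1)) (by positivity)
  refine ⟨δ, hδ, fun E hE hEδ => ?_⟩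
  have h1 := hf E hE hEδ
  rw [lt_div_iff₀ hB] at h1
  refine lt_of_le_of_lt ?_ h1
  rw [Finset.sum_mul]
  refine Finset.sum_le_sum fun i hi => ?_
  have h2 := hE.1 i hi
  refine (hfg _ h2.1 _ h2.2).trans ?_
  rw [mul_comm]
  exact mul_le_mul_of_nonneg_left ((le_abs_self B).trans (by linarith)) dist_nonneg

/-- Since `f` is merely integrable, its primitive is only absolutely continuous. Composition with
the Lipschitz `Φ` preserves this, so the fundamental theorem applies with the almost everywhere
chain rule. -/
theorem integral_comp_primitive_mul {f φ Φ : ℝ → ℝ} {s t A B : ℝ}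
    (hf : IntervalIntegrable f volume s t) (hΦ : ∀ y, HasDerivAt Φ (φ y) y)
    (hφ : ∀ y, |φ y| ≤ B) :
    ∫ τ in s..t, φ (A + ∫ r in s..τ, f r) * f τ = Φ (A + ∫ r in s..t, f r) - Φ A := by
  have hV := hf.absolutelyContinuousOnInterval_intervalIntegral (c := s) left_mem_uIcc
  have hL := abs_sub_le_of_hasDerivAt hΦ hφ
  have hAC : AbsolutelyContinuousOnInterval (fun τ => Φ (A + ∫ r in s..τ, f r)) s t := by
    refine AbsolutelyContinuousOnInterval.of_dist_le (B := B) hV fun x _ y _ => ?_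
    rw [Real.dist_eq, Real.dist_eq]
    refine (hL _ _).trans_eq ?_
    rw [add_sub_add_left_eq_sub]
  have h := hAC.integral_deriv_eq_sub
  rw [intervalIntegral.integral_same, add_zero] at h
  rw [← h]
  refine intervalIntegral.integral_congr_ae ?_
  filter_upwards [hf.ae_hasDerivAt_integral] with τ hτ hτ'
  have h1 := hτ (uIoc_subset_uIcc hτ') s left_mem_uIcc
  exact ((hΦ _).comp τ (h1.const_add A)).deriv.symm

/-- A monotone sequence of nonnegative functions with bounded integrals has an integrable limit. -/
theorem exists_integrable_tendsto {α : Type*} [MeasurableSpace α] {μ : Measure α}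
    {D : ℕ → α → ℝ} {C : ℝ} (hD : ∀ k, Integrable (D k) μ) (hD0 : ∀ k, ∀ᵐ x ∂μ, 0 ≤ D k x)
    (hDm : ∀ k, ∀ᵐ x ∂μ, D k x ≤ D (k + 1) x) (hC : ∀ k, ∫ x, D k x ∂μ ≤ C) :
    ∃ E : α → ℝ, Integrable E μ ∧ (∀ᵐ x ∂μ, ∀ k, D k x ≤ E x) ∧
      (∀ᵐ x ∂μ, Monotone fun k => D k x) ∧
      ∀ᵐ x ∂μ, Tendsto (fun k => D k x) atTop (𝓝 (E x)) := by
  have hmono : ∀ᵐ x ∂μ, Monotone fun k => D k x :=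
    (ae_all_iff.2 hDm).mono fun x hx => monotone_nat_of_le_succ hx
  have hmeas : ∀ k, AEMeasurable (fun x => ENNReal.ofReal (D k x)) μ := fun k =>
    (hD k).aemeasurable.ennreal_ofReal
  have hmono' : ∀ᵐ x ∂μ, Monotone fun k => ENNReal.ofReal (D k x) :=
    hmono.mono fun x hx i j hij => ENNReal.ofReal_le_ofReal (hx hij)
  have hsup : ∫⁻ x, ⨆ k, ENNReal.ofReal (D k x) ∂μ ≤ ENNReal.ofReal C := by
    rw [lintegral_iSup' hmeas hmono']
    refine iSup_le fun k => ?_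
    rw [← ofReal_integral_eq_lintegral_ofReal (hD k) (hD0 k)]
    exact ENNReal.ofReal_le_ofReal (hC k)
  have hne : ∫⁻ x, ⨆ k, ENNReal.ofReal (D k x) ∂μ ≠ ⊤ :=
    (hsup.trans_lt ENNReal.ofReal_lt_top).ne
  have hmeasS : AEMeasurable (fun x => ⨆ k, ENNReal.ofReal (D k x)) μ := AEMeasurable.iSup hmeas
  have hlim : ∀ᵐ x ∂μ, Tendsto (fun k => D k x) atTop
      (𝓝 (⨆ k, ENNReal.ofReal (D k x)).toReal) := by
    filter_upwards [ae_lt_top' hmeasS hne, hmono', ae_all_iff.2 hD0] with x hx hxm hx0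
    have h1 := (ENNReal.tendsto_toReal hx.ne).comp (tendsto_atTop_iSup hxm)
    refine h1.congr fun k => ?_
    simp [ENNReal.toReal_ofReal (hx0 k)]
  refine ⟨_, integrable_toReal_of_lintegral_ne_top hmeasS hne, ?_, hmono, hlim⟩
  filter_upwards [hlim, hmono] with x hx hxm k using hxm.ge_of_tendsto hx k

section TimePrimitive

/-- The primitive in time of `w`, starting from `A` at the time `t₀`. -/
def timePrimitive {α : Type*} (A : α → ℝ) (w : α × ℝ → ℝ) (t₀ : ℝ) (x : α) (t : ℝ) : ℝ :=
  A x + ∫ s in t₀..t, w (x, s)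

theorem timePrimitive_self {α : Type*} (A : α → ℝ) (w : α × ℝ → ℝ) (t₀ : ℝ) (x : α) :
    timePrimitive A w t₀ x t₀ = A x := by simp [timePrimitive]

variable {α : Type*} [MeasurableSpace α] {μ : Measure α} {A : α → ℝ} {w : α × ℝ → ℝ} {t₀ T : ℝ}

/-- The moving endpoint is absorbed into indicators of fixed measurable sets, so that measurability
of parameter integrals applies jointly in space and time. -/
theorem measurable_timePrimitive (hA : Measurable A) (hw : Measurable w) :
    Measurable fun z : α × ℝ => timePrimitive A w t₀ z.1 z.2 := by
  have key : ∀ {S : Set ((α × ℝ) × ℝ)}, MeasurableSet S →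
      Measurable fun z : α × ℝ => ∫ s, S.indicator (fun y => w (y.1.1, y.2)) (z, s) := by
    intro S hS
    have h1 : Measurable (S.indicator fun y : (α × ℝ) × ℝ => w (y.1.1, y.2)) :=
      (hw.comp (measurable_fst.fst.prodMk measurable_snd)).indicator hS
    exact (h1.stronglyMeasurable.integral_prod_right' (ν := volume)).measurable
  have h1 := key (S := {y | t₀ < y.2 ∧ y.2 ≤ y.1.2})
    ((measurableSet_lt measurable_const measurable_snd).inter
      (measurableSet_le measurable_snd measurable_fst.snd))
  have h2 := key (S := {y | y.1.2 < y.2 ∧ y.2 ≤ t₀})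
    ((measurableSet_lt measurable_fst.snd measurable_snd).inter
      (measurableSet_le measurable_snd measurable_const))
  suffices h3 : (fun z : α × ℝ => timePrimitive A w t₀ z.1 z.2) = fun z => A z.1 +
      ((∫ s, {y : (α × ℝ) × ℝ | t₀ < y.2 ∧ y.2 ≤ y.1.2}.indicator
        (fun y => w (y.1.1, y.2)) (z, s)) - ∫ s, {y : (α × ℝ) × ℝ | y.1.2 < y.2 ∧ y.2 ≤ t₀}.indicator
        (fun y => w (y.1.1, y.2)) (z, s)) by
    rw [h3]
    exact (hA.comp measurable_fst).add (h1.sub h2)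
  funext z
  rw [timePrimitive, intervalIntegral, ← integral_indicator measurableSet_Ioc,
    ← integral_indicator measurableSet_Ioc]
  rfl

theorem ae_intervalIntegrable_slice [SFinite μ]
    (hw : Integrable w (μ.prod (volume.restrict (Ioc t₀ T)))) :
    ∀ᵐ x ∂μ, ∀ s ∈ Icc t₀ T, ∀ t ∈ Icc t₀ T,
      IntervalIntegrable (fun τ => w (x, τ)) volume s t := by
  filter_upwards [hw.prod_right_ae] with x hx s hs t ht
  rw [intervalIntegrable_iff]
  exact IntegrableOn.mono_set hx fun y hy => ⟨(le_min hs.1 ht.1).trans_lt hy.1,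
    hy.2.trans (max_le hs.2 ht.2)⟩

theorem integrable_comp_timePrimitive_mul (hA : Measurable A) (hw : Measurable w)
    (hwi : Integrable w (μ.prod (volume.restrict (Ioc t₀ T)))) {φ : ℝ → ℝ} {B : ℝ}
    (hφ : Continuous φ) (hB : ∀ y, |φ y| ≤ B) :
    Integrable (fun z : α × ℝ => φ (timePrimitive A w t₀ z.1 z.2) * w z)
      (μ.prod (volume.restrict (Ioc t₀ T))) :=
  hwi.bdd_mul (hφ.measurable.comp (measurable_timePrimitive hA hw)).aestronglyMeasurable
    (Eventually.of_forall fun _ => hB _)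

/-- The chain rule is applied for almost every fixed `x`, followed by Fubini. Boundedness of `φ`
supplies the integrability, which is the reason for truncating the power. -/
theorem integral_timePrimitive_sub [SFinite μ] (hA : Measurable A) (hw : Measurable w)
    (hwi : Integrable w (μ.prod (volume.restrict (Ioc t₀ T)))) {φ Φ : ℝ → ℝ} {B : ℝ}
    (hφ : Continuous φ) (hΦ : ∀ y, HasDerivAt Φ (φ y) y) (hB : ∀ y, |φ y| ≤ B)
    {s t : ℝ} (hs : t₀ ≤ s) (hst : s ≤ t) (ht : t ≤ T) :
    ∫ x, (Φ (timePrimitive A w t₀ x t) - Φ (timePrimitive A w t₀ x s)) ∂μ =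
      ∫ τ in s..t, ∫ x, φ (timePrimitive A w t₀ x τ) * w (x, τ) ∂μ := by
  have hsub : Ioc s t ⊆ Ioc t₀ T := Ioc_subset_Ioc hs ht
  have hi : Integrable (fun z : α × ℝ => φ (timePrimitive A w t₀ z.1 z.2) * w z)
      (μ.prod (volume.restrict (Ioc s t))) := by
    refine (integrable_comp_timePrimitive_mul hA hw hwi hφ hB).mono_measure ?_
    exact Measure.prod_mono le_rfl (Measure.restrict_mono hsub le_rfl)
  rw [intervalIntegral.integral_of_le hst]
  rw [← integral_integral_swap (f := fun x τ => φ (timePrimitive A w t₀ x τ) * w (x, τ)) hi]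
  refine integral_congr_ae ?_
  filter_upwards [ae_intervalIntegrable_slice hwi] with x hx
  have hsm : s ∈ Icc t₀ T := ⟨hs, hst.trans ht⟩
  have htm : t ∈ Icc t₀ T := ⟨hs.trans hst, ht⟩
  have h0m : t₀ ∈ Icc t₀ T := ⟨le_rfl, htm.1.trans ht⟩
  have hadd : ∀ τ ∈ Icc s t, timePrimitive A w t₀ x τ =
      timePrimitive A w t₀ x s + ∫ r in s..τ, w (x, r) := fun τ hτ => by
    have hτm : τ ∈ Icc t₀ T := ⟨hs.trans hτ.1, hτ.2.trans ht⟩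
    rw [timePrimitive, timePrimitive, add_assoc,
      intervalIntegral.integral_add_adjacent_intervals (hx _ h0m _ hsm) (hx _ hsm _ hτm)]
  have h1 := integral_comp_primitive_mul (A := timePrimitive A w t₀ x s) (hx s hsm t htm) hΦ hB
  rw [← hadd t ⟨hst, le_rfl⟩] at h1
  rw [← h1, intervalIntegral.integral_of_le hst]
  refine setIntegral_congr_fun measurableSet_Ioc fun τ hτ => ?_
  rw [hadd τ (Ioc_subset_Icc_self hτ)]

end TimePrimitive

section TruncatedPower

variable {p : ℝ}

/-- The derivative of `r ↦ r₊^{p+1}`, truncated at the level `k`. -/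
def truncPow (p k r : ℝ) : ℝ := (p + 1) * min (max r 0) k ^ p

theorem continuous_truncPow (hp : 0 ≤ p) (k : ℝ) : Continuous (truncPow p k) :=
  continuous_const.mul (((continuous_id.max continuous_const).min continuous_const).rpow_const
    fun _ => Or.inr hp)

theorem truncPow_nonneg (hp : 0 ≤ p) {k : ℝ} (hk : 0 ≤ k) (r : ℝ) : 0 ≤ truncPow p k r :=
  mul_nonneg (by linarith) (Real.rpow_nonneg (le_min (le_max_right _ _) hk) _)

theorem truncPow_mono (hp : 0 ≤ p) {k k' : ℝ} (hk : 0 ≤ k) (hkk' : k ≤ k') (r : ℝ) :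
    truncPow p k r ≤ truncPow p k' r :=
  mul_le_mul_of_nonneg_left (Real.rpow_le_rpow (le_min (le_max_right _ _) hk)
    (min_le_min_left _ hkk') hp) (by linarith)

theorem truncPow_of_nonneg {k r : ℝ} (hr : 0 ≤ r) : truncPow p k r = (p + 1) * min r k ^ p := by
  rw [truncPow, max_eq_left hr]

theorem abs_truncPow_le (hp : 0 ≤ p) {k : ℝ} (hk : 0 ≤ k) (r : ℝ) :
    |truncPow p k r| ≤ (p + 1) * k ^ p := by
  rw [abs_of_nonneg (truncPow_nonneg hp hk r)]
  exact mul_le_mul_of_nonneg_left (Real.rpow_le_rpow (le_min (le_max_right _ _) hk)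
    (min_le_right _ _) hp) (by linarith)

/-- The primitive of `truncPow`. -/
def truncPrim (p k y : ℝ) : ℝ := ∫ r in (0 : ℝ)..y, truncPow p k r

theorem hasDerivAt_truncPrim (hp : 0 ≤ p) (k y : ℝ) :
    HasDerivAt (truncPrim p k) (truncPow p k y) y :=
  hasDerivAt_primitive (continuous_truncPow hp k) y

theorem continuous_truncPrim (hp : 0 ≤ p) (k : ℝ) : Continuous (truncPrim p k) :=
  continuous_iff_continuousAt.2 fun y => (hasDerivAt_truncPrim hp k y).continuousAt

theorem truncPrim_nonneg (hp : 0 ≤ p) {k : ℝ} (hk : 0 ≤ k) {y : ℝ} (hy : 0 ≤ y) :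
    0 ≤ truncPrim p k y :=
  intervalIntegral.integral_nonneg hy fun r _ => truncPow_nonneg hp hk r

theorem truncPrim_mono (hp : 0 ≤ p) {k k' : ℝ} (hk : 0 ≤ k) (hkk' : k ≤ k') {y : ℝ}
    (hy : 0 ≤ y) : truncPrim p k y ≤ truncPrim p k' y :=
  intervalIntegral.integral_mono_on hy ((continuous_truncPow hp k).intervalIntegrable _ _)
    ((continuous_truncPow hp k').intervalIntegrable _ _) fun r _ => truncPow_mono hp hk hkk' r

theorem truncPrim_eq (hp : 0 ≤ p) {k y : ℝ} (hy : 0 ≤ y) (hyk : y ≤ k) :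
    truncPrim p k y = y ^ (p + 1) := by
  have h1 : truncPrim p k y = ∫ r in (0 : ℝ)..y, (p + 1) * r ^ p := by
    refine intervalIntegral.integral_congr fun r hr => ?_
    rw [uIcc_of_le hy] at hr
    rw [truncPow_of_nonneg hr.1, min_eq_left (hr.2.trans hyk)]
  rw [h1, intervalIntegral.integral_const_mul, integral_rpow (Or.inl (by linarith)),
    Real.zero_rpow (by linarith)]
  field_simp
  ring

theorem truncPrim_le (hp : 0 ≤ p) {k : ℝ} (hk : 0 ≤ k) {y : ℝ} (hy : 0 ≤ y) :
    truncPrim p k y ≤ y ^ (p + 1) := by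
  rw [← truncPrim_eq (k := max k y) hp hy (le_max_right _ _)]
  exact truncPrim_mono hp hk (le_max_left _ _) hy

theorem tendsto_truncPrim (hp : 0 ≤ p) {y : ℝ} (hy : 0 ≤ y) :
    Tendsto (fun k : ℕ => truncPrim p k y) atTop (𝓝 (y ^ (p + 1))) := by
  refine tendsto_const_nhds.congr' ?_
  filter_upwards [tendsto_natCast_atTop_atTop.eventually_ge_atTop y] with k hk
  rw [truncPrim_eq hp hy hk]

end TruncatedPower

section Dissipation

variable {α : Type*} [MeasurableSpace α] {μ : Measure α} {A : α → ℝ} {w : α × ℝ → ℝ} {t₀ T p : ℝ}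

/-- The truncated primitive is Lipschitz, so its change since `t₀` is controlled by the time
integral of `w`; its initial value is at most `A^{p+1}`. -/
theorem integrable_truncPrim_timePrimitive [SFinite μ] (hp : 0 ≤ p) (hA : Measurable A)
    (hw : Measurable w) (hwi : Integrable w (μ.prod (volume.restrict (Ioc t₀ T))))
    (hA0 : ∀ᵐ x ∂μ, 0 ≤ A x) (hAp : Integrable (fun x => A x ^ (p + 1)) μ) {k : ℝ} (hk : 0 ≤ k)
    {t : ℝ} (ht : t ∈ Icc t₀ T) :
    Integrable (fun x => truncPrim p k (timePrimitive A w t₀ x t)) μ := by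
  have hm : ∀ t, Measurable fun x => timePrimitive A w t₀ x t := fun t =>
    (measurable_timePrimitive hA hw).comp measurable_prodMk_right
  have hc := (continuous_truncPrim hp k).measurable
  have h0 : Integrable (fun x => truncPrim p k (A x)) μ := by
    refine hAp.mono' (hc.comp hA).aestronglyMeasurable ?_
    filter_upwards [hA0] with x hx
    rw [Real.norm_of_nonneg (truncPrim_nonneg hp hk hx)]
    exact truncPrim_le hp hk hx
  have hwt : Integrable (fun x => ∫ s in t₀..t, w (x, s)) μ := by
    simp_rw [intervalIntegral.integral_of_le ht.1]
    refine Integrable.integral_prod_left (f := w) (hwi.mono_measure ?_)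
    exact Measure.prod_mono le_rfl (Measure.restrict_mono (Ioc_subset_Ioc_right ht.2) le_rfl)
  have h1 : Integrable (fun x => truncPrim p k (timePrimitive A w t₀ x t) - truncPrim p k (A x))
      μ := by
    refine (hwt.abs.const_mul ((p + 1) * k ^ p)).mono'
      ((hc.comp (hm t)).sub (hc.comp hA)).aestronglyMeasurable (Eventually.of_forall fun x => ?_)
    refine (abs_sub_le_of_hasDerivAt (hasDerivAt_truncPrim hp k) (abs_truncPow_le hp hk) _
      _).trans_eq ?_
    rw [timePrimitive, add_sub_cancel_left]
  refine (h1.add h0).congr (Eventually.of_forall fun x => ?_)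
  simp

/-- Each truncation level satisfies an exact balance. Its rate is nonnegative, nondecreasing in `k`,
and has total integral at most `∫ A^{p+1}`. Monotone convergence applies to the rates and to the
energies at each time, and the limit rate `D` dominates every truncated one. -/
theorem exists_dissipation [SFinite μ] (hp : 0 ≤ p) (hA : Measurable A)
    (hw : Measurable w) (hwi : Integrable w (μ.prod (volume.restrict (Ioc t₀ T))))
    (hT : t₀ ≤ T) (hW0 : ∀ t, t₀ ≤ t → ∀ᵐ x ∂μ, 0 ≤ timePrimitive A w t₀ x t)
    (hAp : Integrable (fun x => A x ^ (p + 1)) μ)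
    (h0 : ∀ k : ℕ, ∀ᵐ τ ∂volume.restrict (Ioc t₀ T),
      ∫ x, truncPow p k (timePrimitive A w t₀ x τ) * w (x, τ) ∂μ ≤ 0)
    (h1 : ∀ k : ℕ, ∀ᵐ τ ∂volume.restrict (Ioc t₀ T),
      ∫ x, truncPow p (k + 1 : ℕ) (timePrimitive A w t₀ x τ) * w (x, τ) ∂μ ≤
        ∫ x, truncPow p k (timePrimitive A w t₀ x τ) * w (x, τ) ∂μ) :
    (∀ t ∈ Icc t₀ T, Integrable (fun x => timePrimitive A w t₀ x t ^ (p + 1)) μ) ∧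
    ∃ D : ℝ → ℝ, IntegrableOn D (Ioc t₀ T) ∧
      (∀ᵐ τ ∂volume.restrict (Ioc t₀ T), ∀ k : ℕ,
        -∫ x, truncPow p k (timePrimitive A w t₀ x τ) * w (x, τ) ∂μ ≤ D τ) ∧
      ∀ s t, t₀ ≤ s → s ≤ t → t ≤ T →
        (∫ x, timePrimitive A w t₀ x s ^ (p + 1) ∂μ) - ∫ x, timePrimitive A w t₀ x t ^ (p + 1) ∂μ
          = ∫ τ in s..t, D τ := by
  set W := timePrimitive A w t₀
  set Dk : ℕ → ℝ → ℝ := fun k τ => -∫ x, truncPow p k (W x τ) * w (x, τ) ∂μ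
  have hk0 : ∀ k : ℕ, (0 : ℝ) ≤ k := fun k => Nat.cast_nonneg k
  have hDi : ∀ k, IntegrableOn (Dk k) (Ioc t₀ T) := fun k =>
    (Integrable.integral_prod_right (integrable_comp_timePrimitive_mul hA hw hwi
      (continuous_truncPow hp k) (abs_truncPow_le hp (hk0 k)))).neg
  have hA0 : ∀ᵐ x ∂μ, 0 ≤ A x := by
    have h2 := hW0 t₀ le_rfl
    simp only [W, timePrimitive_self] at h2
    exact h2
  have hΦi : ∀ k : ℕ, ∀ t ∈ Icc t₀ T, Integrable (fun x => truncPrim p k (W x t)) μ :=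
    fun k t ht => integrable_truncPrim_timePrimitive hp hA hw hwi hA0 hAp (hk0 k) ht
  have hident : ∀ k : ℕ, ∀ s t, t₀ ≤ s → s ≤ t → t ≤ T →
      (∫ x, truncPrim p k (W x s) ∂μ) - ∫ x, truncPrim p k (W x t) ∂μ = ∫ τ in s..t, Dk k τ := by
    intro k s t hs hst ht
    have h := integral_timePrimitive_sub hA hw hwi (continuous_truncPow hp k)
      (hasDerivAt_truncPrim hp k) (abs_truncPow_le hp (hk0 k)) hs hst ht
    rw [integral_sub (hΦi k t ⟨hs.trans hst, ht⟩) (hΦi k s ⟨hs, hst.trans ht⟩)] at h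
    simp only [Dk, intervalIntegral.integral_neg]
    rw [← h]
    ring
  have hD0 : ∀ k, ∀ᵐ τ ∂volume.restrict (Ioc t₀ T), 0 ≤ Dk k τ := fun k =>
    (h0 k).mono fun τ hτ => neg_nonneg.2 hτ
  have hYk : ∀ k : ℕ, ∀ t ∈ Icc t₀ T,
      ∫ x, truncPrim p k (W x t) ∂μ ≤ ∫ x, A x ^ (p + 1) ∂μ := by
    intro k t ht
    have h2 : 0 ≤ ∫ τ in t₀..t, Dk k τ := by
      rw [intervalIntegral.integral_of_le ht.1]
      exact integral_nonneg_of_ae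
        (ae_mono (Measure.restrict_mono (Ioc_subset_Ioc_right ht.2) le_rfl) (hD0 k))
    rw [← hident k t₀ t le_rfl ht.1 ht.2, sub_nonneg] at h2
    refine h2.trans (integral_mono_ae (hΦi k t₀ ⟨le_rfl, hT⟩) hAp ?_)
    filter_upwards [hA0] with x hx
    simp only [W, timePrimitive_self]
    exact truncPrim_le hp (hk0 k) hx
  obtain ⟨D, hD, hDle, hDm, hDt⟩ := exists_integrable_tendsto (C := ∫ x, A x ^ (p + 1) ∂μ) hDi hD0
    (fun k => (h1 k).mono fun τ hτ => neg_le_neg hτ) fun k => by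
      rw [← intervalIntegral.integral_of_le hT, ← hident k t₀ T le_rfl hT le_rfl]
      have h2 := hYk k t₀ ⟨le_rfl, hT⟩
      have h3 : 0 ≤ ∫ x, truncPrim p k (W x T) ∂μ := integral_nonneg_of_ae
        ((hW0 T hT).mono fun x hx => truncPrim_nonneg hp (hk0 k) hx)
      linarith
  have hlim : ∀ t, t₀ ≤ t → ∀ᵐ x ∂μ,
      Tendsto (fun k : ℕ => truncPrim p k (W x t)) atTop (𝓝 (W x t ^ (p + 1))) := fun t ht =>
    (hW0 t ht).mono fun x hx => tendsto_truncPrim hp hx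
  have hmono : ∀ t, t₀ ≤ t → ∀ᵐ x ∂μ, Monotone fun k : ℕ => truncPrim p k (W x t) := fun t ht =>
    (hW0 t ht).mono fun x hx i j hij => truncPrim_mono hp (hk0 i) (Nat.cast_le.2 hij) hx
  have hint : ∀ t ∈ Icc t₀ T, Integrable (fun x => W x t ^ (p + 1)) μ := by
    intro t ht
    obtain ⟨E, hE, -, -, hEt⟩ := exists_integrable_tendsto (C := ∫ x, A x ^ (p + 1) ∂μ)
      (fun k => hΦi k t ht) (fun k => (hW0 t ht.1).mono fun x hx => truncPrim_nonneg hp (hk0 k) hx)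
      (fun k => (hmono t ht.1).mono fun x hx => hx (Nat.le_succ k)) fun k => hYk k t ht
    refine hE.congr ?_
    filter_upwards [hEt, hlim t ht.1] with x hx hx' using tendsto_nhds_unique hx hx'
  refine ⟨hint, D, hD, hDle, fun s t hs hst ht => ?_⟩
  have hY : ∀ t ∈ Icc t₀ T, Tendsto (fun k : ℕ => ∫ x, truncPrim p k (W x t) ∂μ) atTop
      (𝓝 (∫ x, W x t ^ (p + 1) ∂μ)) := fun t ht =>
    integral_tendsto_of_tendsto_of_monotone (fun k => hΦi k t ht) (hint t ht) (hmono t ht.1)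
      (hlim t ht.1)
  have hle : volume.restrict (Ioc s t) ≤ volume.restrict (Ioc t₀ T) :=
    Measure.restrict_mono (Ioc_subset_Ioc hs ht) le_rfl
  refine tendsto_nhds_unique ((hY s ⟨hs, hst.trans ht⟩).sub (hY t ⟨hs.trans hst, ht⟩)) ?_
  simp_rw [fun k => hident k s t hs hst ht, intervalIntegral.integral_of_le hst]
  exact integral_tendsto_of_tendsto_of_monotone (fun k => Integrable.mono_measure (hDi k) hle)
    (Integrable.mono_measure hD hle) (ae_mono hle hDm) (ae_mono hle hDt)

end Dissipation

end EinsteinModel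

end

/-! ### The dissipation bound on a single time slice -/

noncomputable section

namespace EinsteinModel

/-- Hölder's inequality against the constant `1`; the upper bound on `g` ensures all integrability.
-/
theorem rpow_integral_le {α : Type*} [MeasurableSpace α] {μ : Measure α} [IsFiniteMeasure μ]
    (hμ : 0 < μ.real univ) {g : α → ℝ} {θ B : ℝ} (hθ : 1 < θ) (hg : AEStronglyMeasurable g μ)
    (hg0 : ∀ᵐ x ∂μ, 0 ≤ g x) (hgB : ∀ᵐ x ∂μ, g x ≤ B) :
    μ.real univ ^ (1 - θ) * (∫ x, g x ∂μ) ^ θ ≤ ∫ x, g x ^ θ ∂μ := by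
  have hθ0 : 0 < θ := by linarith
  have hpq := Real.HolderConjugate.conjExponent hθ
  have hmem : ∀ r, MemLp g r μ := fun r => MemLp.of_bound hg B (by
    filter_upwards [hg0, hgB] with x hx hx'
    rwa [Real.norm_of_nonneg hx])
  have h := integral_mul_le_Lp_mul_Lq_of_nonneg hpq hg0 (g := fun _ => (1 : ℝ))
    (Eventually.of_forall fun _ => zero_le_one) (hmem _) (memLp_const 1)
  simp only [mul_one, Real.one_rpow, integral_const, smul_eq_mul] at h
  have hI : 0 ≤ ∫ x, g x ∂μ := integral_nonneg_of_ae hg0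
  have hJ : 0 ≤ ∫ x, g x ^ θ ∂μ :=
    integral_nonneg_of_ae (hg0.mono fun x hx => Real.rpow_nonneg hx _)
  have h2 := Real.rpow_le_rpow hI h hθ0.le
  rw [Real.mul_rpow (Real.rpow_nonneg hJ _) (Real.rpow_nonneg hμ.le _), ← Real.rpow_mul hJ,
    ← Real.rpow_mul hμ.le, one_div_mul_cancel hθ0.ne', Real.rpow_one] at h2
  have h3 : 1 / Real.conjExponent θ * θ = θ - 1 := by
    rw [Real.conjExponent]
    field_simp
  rw [h3] at h2
  refine (mul_le_mul_of_nonneg_left h2 (Real.rpow_nonneg hμ.le _)).trans_eq ?_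
  rw [mul_left_comm, ← Real.rpow_add hμ]
  simp

section Slice

variable {N : ℕ} {Ω : Set (Euc N)} {h a : ℝ → ℝ} {U l V w : Euc N → ℝ} {p q γ c₃ c₄ : ℝ}

theorem IsSlice.integral_truncPow_mul_le (hA : IsAdmissible h a p q γ c₃ c₄)
    (hS : IsSlice Ω h a p U l) (hV : ∀ᵐ x ∂volume.restrict Ω, H h (U x) = V x)
    (hVm : AEStronglyMeasurable V (volume.restrict Ω)) (hwi : IntegrableOn w Ω)
    (hw : ∀ᵐ x ∂volume.restrict Ω, w x - F h a (U x) * l x ≤ 0) {k : ℝ} (hk : 0 ≤ k) :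
    ∫ x in Ω, truncPow p k (V x) * w x ≤
      (p + 1) * ∫ x in Ω, min (H h (U x)) k ^ p * F h a (U x) * l x := by
  have hp := hA.p_pos.le
  rw [← integral_const_mul]
  refine integral_mono_ae (hwi.bdd_mul
    ((continuous_truncPow hp k).comp_aestronglyMeasurable hVm)
    (Eventually.of_forall fun x => abs_truncPow_le hp hk _))
    ((hS.integrable_truncated hA hk).const_mul _) ?_
  filter_upwards [hV, hw, hS.nonneg] with x h1 h2 h3
  rw [← h1, truncPow_of_nonneg (hA.model.H_nonneg h3), mul_assoc, mul_assoc]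
  gcongr
  · exact Real.rpow_nonneg (le_min (hA.model.H_nonneg h3) hk) _
  · linarith

theorem IsSlice.integral_truncPow_mul_nonpos [IsFiniteMeasure (volume.restrict Ω)]
    (hΩ : IsOpen Ω) (hA : IsAdmissible h a p q γ c₃ c₄)
    (hS : IsSlice Ω h a p U l) (hV : ∀ᵐ x ∂volume.restrict Ω, H h (U x) = V x)
    (hVm : AEStronglyMeasurable V (volume.restrict Ω)) (hwi : IntegrableOn w Ω)
    (hw : ∀ᵐ x ∂volume.restrict Ω, w x - F h a (U x) * l x ≤ 0) {k : ℝ} (hk : 0 ≤ k) :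
    ∫ x in Ω, truncPow p k (V x) * w x ≤ 0 :=
  (hS.integral_truncPow_mul_le hA hV hVm hwi hw hk).trans
    (mul_nonpos_of_nonneg_of_nonpos (by linarith [hA.p_pos]) (hS.truncated_nonpos hΩ hA hk))

/-- The difference of the two weights is nonnegative, so it may multiply `w ≤ F(U) l`; the flux it
produces is nonpositive by `IsSlice.truncated_antitone`. -/
theorem IsSlice.integral_truncPow_mul_antitone [IsFiniteMeasure (volume.restrict Ω)]
    (hΩ : IsOpen Ω) (hA : IsAdmissible h a p q γ c₃ c₄)
    (hS : IsSlice Ω h a p U l) (hV : ∀ᵐ x ∂volume.restrict Ω, H h (U x) = V x)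
    (hVm : AEStronglyMeasurable V (volume.restrict Ω)) (hwi : IntegrableOn w Ω)
    (hw : ∀ᵐ x ∂volume.restrict Ω, w x - F h a (U x) * l x ≤ 0) {k k' : ℝ} (hk : 0 ≤ k)
    (hkk' : k ≤ k') :
    ∫ x in Ω, truncPow p k' (V x) * w x ≤ ∫ x in Ω, truncPow p k (V x) * w x := by
  have hp := hA.p_pos.le
  have hi : ∀ k, 0 ≤ k → IntegrableOn (fun x => truncPow p k (V x) * w x) Ω := fun k hk =>
    hwi.bdd_mul ((continuous_truncPow hp k).comp_aestronglyMeasurable hVm)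
      (Eventually.of_forall fun x => abs_truncPow_le hp hk _)
  have hk' := hk.trans hkk'
  rw [← sub_nonpos, ← integral_sub (hi k' hk') (hi k hk)]
  have ht := hS.truncated_antitone hΩ hA hk hkk'
  have hti : IntegrableOn (fun x => (min (H h (U x)) k' ^ p - min (H h (U x)) k ^ p) *
      (F h a (U x) * l x)) Ω :=
    ((hS.integrable_truncated hA hk').sub (hS.integrable_truncated hA hk)).congr
      (Eventually.of_forall fun x => by simp only [Pi.sub_apply]; ring)
  refine le_trans (integral_mono_ae ((hi k' hk').sub (hi k hk)) (hti.const_mul (p + 1)) ?_)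
    ((integral_const_mul _ _).trans_le
      (mul_nonpos_of_nonneg_of_nonpos (by linarith) ht))
  filter_upwards [hV, hw, hS.nonneg] with x h1 h2 h3
  have h4 := hA.model.H_nonneg h3
  rw [← h1, truncPow_of_nonneg h4, truncPow_of_nonneg h4, ← sub_mul, ← mul_sub, mul_assoc]
  have h5 : min (H h (U x)) k ^ p ≤ min (H h (U x)) k' ^ p :=
    Real.rpow_le_rpow (le_min h4 hk) (min_le_min_left _ hkk') hp
  gcongr
  · linarith

/-- The differential inequality, for a bound `D` of all the truncated dissipation rates. -/
theorem IsSlice.rpow_integral_le [IsFiniteMeasure (volume.restrict Ω)] (hN : 0 < N)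
    (hΩ : IsOpen Ω) (hΩ0 : 0 < volume.real Ω)
    {R : ℝ} (hR0 : 0 < R) (hR : ∀ x ∈ Ω, ‖x‖ ≤ R) (hA : IsAdmissible h a p q γ c₃ c₄)
    (hθ : 1 < 2 / ((p + 1) / (γ + 1)))
    (hS : IsSlice Ω h a p U l) (hV : ∀ᵐ x ∂volume.restrict Ω, H h (U x) = V x)
    (hVm : AEStronglyMeasurable V (volume.restrict Ω)) (hwi : IntegrableOn w Ω)
    (hw : ∀ᵐ x ∂volume.restrict Ω, w x - F h a (U x) * l x ≤ 0)
    (hint : IntegrableOn (fun x => H h (U x) ^ (p + 1)) Ω) {D : ℝ}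
    (hD : ∀ k : ℕ, -∫ x in Ω, truncPow p k (V x) * w x ≤ D) :
    (p + 1) * (c₃ / (4 * R ^ 2 * c₄ ^ 2)) * volume.real Ω ^ (1 - 2 / ((p + 1) / (γ + 1))) *
      (∫ x in Ω, H h (U x) ^ (p + 1)) ^ (2 / ((p + 1) / (γ + 1))) ≤ D := by
  have hp := hA.p_pos
  have hγ := hA.γ_pos
  set θ := 2 / ((p + 1) / (γ + 1)) with hθdef
  -- This matching of exponents turns the Hölder lower bound for `H^{p+1}` into one for the square
  -- of `H^{γ+1}`, which the energy estimate controls.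
  have hθp : (p + 1) * θ = (γ + 1) * 2 := by
    rw [hθdef]
    field_simp
  have hM := hA.model
  have hgc : ∀ r : ℝ, 0 ≤ r → Continuous fun v => H h (min (max v 0) r) ^ (p + 1) := fun r hr =>
    (hM.H_continuousOn.comp_continuous (by fun_prop) fun v =>
      le_min (le_max_right v 0) hr).rpow_const fun _ => Or.inr (by linarith)
  have hgm : ∀ r : ℝ, 0 ≤ r →
      AEStronglyMeasurable (fun x => H h (min (U x) r) ^ (p + 1)) (volume.restrict Ω) := by
    intro r hr
    refine ((hgc r hr).comp_aestronglyMeasurable hS.aestronglyMeasurable).congr ?_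
    filter_upwards [hS.nonneg] with x hx
    rw [max_eq_left hx]
  have hmin : ∀ r s, 0 ≤ r → 0 ≤ s → 0 ≤ H h (min s r) := fun r s hr hs =>
    hM.H_nonneg (le_min hs hr)
  have hgle : ∀ r s r', 0 ≤ r → 0 ≤ s → r ≤ r' →
      H h (min s r) ^ (p + 1) ≤ H h (min s r') ^ (p + 1) := fun r s r' hr hs hrr' =>
    Real.rpow_le_rpow (hmin r s hr hs) (hM.H_monotoneOn (mem_Ici.2 (le_min hs hr))
      (mem_Ici.2 (le_min hs (hr.trans hrr'))) (min_le_min_left _ hrr')) (by linarith)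
  have hstep : ∀ r : ℝ, 0 < r → (p + 1) * (c₃ / (4 * R ^ 2 * c₄ ^ 2)) *
      volume.real Ω ^ (1 - θ) * (∫ x in Ω, H h (min (U x) r) ^ (p + 1)) ^ θ ≤ D := by
    intro r hr
    -- The truncation level only has to exceed `H(r)`. As `D` dominates the rates for all `k`, the
    -- bound is free of `k` and `r` can tend to infinity.
    obtain ⟨k, hk⟩ := exists_nat_gt (H h r)
    have h1 := hS.truncated_le hN hΩ hR0 hR hA hr hk
    have h2 := hS.integral_truncPow_mul_le hA hV hVm hwi hw (Nat.cast_nonneg k)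
    have h3 := EinsteinModel.rpow_integral_le (μ := volume.restrict Ω) (by simpa using hΩ0) hθ
      (hgm r hr.le) (hS.nonneg.mono fun x hx => Real.rpow_nonneg (hmin r _ hr.le hx) _)
      (B := H h r ^ (p + 1)) (hS.nonneg.mono fun x hx => Real.rpow_le_rpow (hmin r _ hr.le hx)
        (hM.H_monotoneOn (mem_Ici.2 (le_min hx hr.le)) (mem_Ici.2 hr.le) (min_le_right _ _))
        (by linarith))
    have h4 : ∫ x in Ω, (H h (min (U x) r) ^ (p + 1)) ^ θ =
        ∫ x in Ω, (H h (min (U x) r) ^ (γ + 1)) ^ 2 := by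
      refine integral_congr_ae ?_
      filter_upwards [hS.nonneg] with x hx
      have h5 := hmin r _ hr.le hx
      rw [← Real.rpow_mul h5, hθp, Real.rpow_mul h5, Real.rpow_two]
    rw [h4, measureReal_restrict_apply_univ] at h3
    refine le_trans ?_ (hD k)
    have hκ : 0 ≤ c₃ / (4 * R ^ 2 * c₄ ^ 2) := by
      have := hA.c₃_pos
      positivity
    have h6 := mul_le_mul_of_nonneg_left h1 (by linarith : (0 : ℝ) ≤ p + 1)
    have h7 := mul_le_mul_of_nonneg_left h3 (mul_nonneg (by linarith : (0 : ℝ) ≤ p + 1) hκ)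
    calc _ = (p + 1) * (c₃ / (4 * R ^ 2 * c₄ ^ 2)) *
          (volume.real Ω ^ (1 - θ) * (∫ x in Ω, H h (min (U x) r) ^ (p + 1)) ^ θ) := by ring
      _ ≤ _ := by linarith
  have hgi : ∀ n : ℕ, Integrable (fun x => H h (min (U x) n) ^ (p + 1)) (volume.restrict Ω) := by
    intro n
    refine hint.mono' (hgm n (Nat.cast_nonneg n)) ?_
    filter_upwards [hS.nonneg] with x hx
    have h1 := hmin n _ (Nat.cast_nonneg n) hx
    rw [Real.norm_of_nonneg (Real.rpow_nonneg h1 _)]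
    exact Real.rpow_le_rpow h1 (hM.H_monotoneOn (mem_Ici.2 (le_min hx (Nat.cast_nonneg n)))
      (mem_Ici.2 hx) (min_le_left _ _)) (by linarith)
  have hlim : Tendsto (fun n : ℕ => ∫ x in Ω, H h (min (U x) n) ^ (p + 1)) atTop
      (𝓝 (∫ x in Ω, H h (U x) ^ (p + 1))) := by
    refine integral_tendsto_of_tendsto_of_monotone hgi hint ?_ ?_
    · filter_upwards [hS.nonneg] with x hx i j hij
      exact hgle i _ j (Nat.cast_nonneg i) hx (Nat.cast_le.2 hij)
    · filter_upwards with x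
      refine tendsto_const_nhds.congr' ?_
      filter_upwards [tendsto_natCast_atTop_atTop.eventually_ge_atTop (U x)] with n hn
      rw [min_eq_left hn]
  refine le_of_tendsto ((hlim.rpow_const (Or.inr (by linarith))).const_mul _) ?_
  filter_upwards [eventually_gt_atTop 0] with n hn
  exact hstep n (Nat.cast_pos.2 hn)

end Slice

end EinsteinModel

end

/-! ### From time slices to the energy balance of the solution -/

noncomputable section

namespace EinsteinModel

variable {N : ℕ} {Ω : Set (Euc N)} {h a : ℝ → ℝ} {p q γ c₃ c₄ t₀ : ℝ}

theorem IsStrongSolution.exists_dissipation [IsFiniteMeasure (volume.restrict Ω)] (hN : 0 < N)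
    (hΩ : IsOpen Ω) (hΩ0 : 0 < volume.real Ω)
    {R : ℝ} (hR0 : 0 < R) (hR : ∀ x ∈ Ω, ‖x‖ ≤ R) (hA : IsAdmissible h a p q γ c₃ c₄)
    (hθ : 1 < 2 / ((p + 1) / (γ + 1))) {u₀ : Euc N → ℝ} {u : Euc N → ℝ → ℝ}
    (hu : IsStrongSolution Ω h a t₀ u₀ u) (hub : ZeroBoundary Ω h a p t₀ u)
    (hu₀ : MemLp (fun x => H h (u₀ x)) (ENNReal.ofReal (p + 1)) (volume.restrict Ω)) {T : ℝ}
    (hT : t₀ ≤ T) :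
    (∀ t ∈ Icc t₀ T, IntegrableOn (fun x => H h (u x t) ^ (p + 1)) Ω) ∧
    ∃ D : ℝ → ℝ, IntegrableOn D (Ioc t₀ T) ∧
      (∀ᵐ τ ∂volume.restrict (Ioc t₀ T),
        (p + 1) * (c₃ / (4 * R ^ 2 * c₄ ^ 2)) * volume.real Ω ^ (1 - 2 / ((p + 1) / (γ + 1))) *
          Y Ω h p u τ ^ (2 / ((p + 1) / (γ + 1))) ≤ D τ) ∧
      ∀ s t, t₀ ≤ s → s ≤ t → t ≤ T → Y Ω h p u s - Y Ω h p u t = ∫ τ in s..t, D τ := by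
  obtain ⟨-, hunn, hut₀, w, l, hw2, hwH, hlap, hFl, hineq⟩ := hu
  have hp := hA.p_pos
  set μ := volume.restrict Ω
  have hIoc : volume.restrict (Ioc t₀ T) ≤ volume.restrict (Ioi t₀) :=
    Measure.restrict_mono Ioc_subset_Ioi_self le_rfl
  have hprod : volume.restrict (Ω ×ˢ Ioi t₀) = μ.prod (volume.restrict (Ioi t₀)) := by
    rw [Measure.volume_eq_prod, Measure.prod_restrict]
  have hprodT : μ.prod (volume.restrict (Ioc t₀ T)) ≤ volume.restrict (Ω ×ˢ Ioi t₀) := by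
    rw [hprod]
    exact Measure.prod_mono le_rfl hIoc
  -- measurable representatives
  obtain ⟨w', hw'm, hww'⟩ := hw2.aestronglyMeasurable
  obtain ⟨A, hAm, hAe⟩ := hu₀.aestronglyMeasurable
  have hw'i : Integrable w' (μ.prod (volume.restrict (Ioc t₀ T))) :=
    ((hw2.ae_eq hww').mono_measure hprodT).integrable (by norm_num)
  have hsec : ∀ᵐ x ∂μ, ∀ᵐ τ ∂volume.restrict (Ioi t₀), w (x, τ) = w' (x, τ) := by
    rw [hprod] at hww'
    exact Measure.ae_ae_of_ae_prod hww'
  -- The exceptional set may depend on `t`; this is harmless because only integrals over `Ω` at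
  -- fixed times are compared.
  have hW : ∀ t, t₀ ≤ t → ∀ᵐ x ∂μ, H h (u x t) = timePrimitive A w' t₀ x t := by
    intro t ht
    filter_upwards [hwH t ht, hAe, hsec] with x h1 h2 h3
    rw [h1, timePrimitive, ← h2, intervalIntegral.integral_of_le ht,
      intervalIntegral.integral_of_le ht]
    congr 1
    exact integral_congr_ae (ae_mono (Measure.restrict_mono Ioc_subset_Ioi_self le_rfl) h3)
  have hWm : ∀ t, Measurable fun x => timePrimitive A w' t₀ x t := fun t =>
    (measurable_timePrimitive hAm.measurable hw'm.measurable).comp measurable_prodMk_right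
  have hW0 : ∀ t, t₀ ≤ t → ∀ᵐ x ∂μ, 0 ≤ timePrimitive A w' t₀ x t := by
    intro t ht
    filter_upwards [hW t ht, hunn t ht] with x h1 h2
    rw [← h1]
    exact hA.model.H_nonneg h2
  have hAp : Integrable (fun x => A x ^ (p + 1)) μ := by
    have h1 := (hu₀.ae_eq hAe).integrable_norm_rpow (by simpa using by linarith)
      ENNReal.ofReal_ne_top
    rw [ENNReal.toReal_ofReal (by linarith)] at h1
    refine h1.congr ?_
    filter_upwards [hW0 t₀ le_rfl] with x hx
    rw [timePrimitive_self] at hx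
    rw [Real.norm_of_nonneg hx]
  -- almost every time slice
  have hFli : Integrable (fun z : Euc N × ℝ => F h a (u z.1 z.2) * l z)
      (μ.prod (volume.restrict (Ioc t₀ T))) := (hFl.mono_measure hprodT).integrable (by norm_num)
  have hle : ∀ᵐ τ ∂volume.restrict (Ioc t₀ T), ∀ᵐ x ∂μ,
      w' (x, τ) - F h a (u x τ) * l (x, τ) ≤ 0 := by
    have h1 : ∀ᵐ z ∂μ.prod (volume.restrict (Ioc t₀ T)),
        w' z - F h a (u z.1 z.2) * l z ≤ 0 := by
      filter_upwards [ae_mono hprodT hineq, ae_mono hprodT hww'] with z h2 h3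
      rwa [← h3]
    -- The factors are exchanged so that Fubini yields a statement for almost every time first.
    have h2 := (Measure.measurePreserving_swap (μ := volume.restrict (Ioc t₀ T))
      (ν := μ)).quasiMeasurePreserving.ae h1
    exact Measure.ae_ae_of_ae_prod h2
  have hslice : ∀ᵐ τ ∂volume.restrict (Ioc t₀ T),
      IsSlice Ω h a p (fun x => u x τ) (fun x => l (x, τ)) := by
    filter_upwards [ae_restrict_mem measurableSet_Ioc, ae_mono hIoc hlap, hFli.prod_left_ae,
      ae_mono hIoc hub] with τ h1 h2 h3 h4
    exact ⟨hunn τ h1.1.le, h2, h3, h4⟩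
  have hwτ := hw'i.prod_left_ae
  obtain ⟨hint, D, hD, hDle, hDeq⟩ := EinsteinModel.exists_dissipation hp.le hAm.measurable
    hw'm.measurable hw'i hT hW0 hAp
    (fun k => by
      filter_upwards [ae_restrict_mem measurableSet_Ioc, hslice, hle, hwτ] with τ h1 h2 h3 h4
      exact h2.integral_truncPow_mul_nonpos hΩ hA (hW τ h1.1.le) (hWm τ).aestronglyMeasurable h4
        h3 (Nat.cast_nonneg k))
    (fun k => by
      filter_upwards [ae_restrict_mem measurableSet_Ioc, hslice, hle, hwτ] with τ h1 h2 h3 h4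
      exact h2.integral_truncPow_mul_antitone hΩ hA (hW τ h1.1.le) (hWm τ).aestronglyMeasurable h4
        h3 (Nat.cast_nonneg k) (Nat.cast_le.2 (Nat.le_succ k)))
  have hYW : ∀ t, t₀ ≤ t → Y Ω h p u t = ∫ x, timePrimitive A w' t₀ x t ^ (p + 1) ∂μ := by
    intro t ht
    refine integral_congr_ae ?_
    filter_upwards [hW t ht] with x hx
    rw [hx]
  have hint' : ∀ t ∈ Icc t₀ T, IntegrableOn (fun x => H h (u x t) ^ (p + 1)) Ω := by
    intro t ht
    refine (hint t ht).congr ?_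
    filter_upwards [hW t ht.1] with x hx
    rw [hx]
  refine ⟨hint', D, hD, ?_, fun s t hs hst ht => ?_⟩
  · filter_upwards [ae_restrict_mem measurableSet_Ioc, hslice, hle, hwτ, hDle] with τ h1 h2 h3 h4 h5
    exact h2.rpow_integral_le hN hΩ hΩ0 hR0 hR hA hθ (hW τ h1.1.le) (hWm τ).aestronglyMeasurable h4
      h3 (hint' τ (Ioc_subset_Icc_self h1)) h5
  · rw [hYW s hs, hYW t (hs.trans hst)]
    exact hDeq s t hs hst ht

end EinsteinModel

end

/-! ### The scalar differential inequality -/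

noncomputable section

namespace EinsteinModel

/-- The convex function `v ↦ v^(-β)` lies above its tangent at `w`; this follows from `log x ≤ x -
1` and `exp x ≥ 1 + x`. -/
theorem mul_one_sub_div_le_rpow_neg_sub {v w β : ℝ} (hv : 0 < v) (hw : 0 < w) (hβ : 0 ≤ β) :
    β * w ^ (-β) * (1 - v / w) ≤ v ^ (-β) - w ^ (-β) := by
  have h1 : 1 + β * (1 - v / w) ≤ (v / w) ^ (-β) := by
    have hvw : 0 < v / w := div_pos hv hw
    have h2 := Real.log_le_sub_one_of_pos hvw
    have h3 := Real.add_one_le_exp (Real.log (v / w) * -β)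
    rw [← Real.rpow_def_of_pos hvw] at h3
    nlinarith
  have h4 : v ^ (-β) = w ^ (-β) * (v / w) ^ (-β) := by
    rw [← Real.mul_rpow hw.le (div_pos hv hw).le, mul_div_cancel₀ _ hw.ne']
  rw [h4]
  nlinarith [Real.rpow_pos_of_pos hw (-β)]

/-- On every interval `[t₀, T]` the nonnegative function `y` is absolutely continuous with
`-y' ≥ c y^θ` almost everywhere. -/
structure IsDecaying (y : ℝ → ℝ) (t₀ c θ : ℝ) : Prop where
  nonneg : ∀ t, t₀ ≤ t → 0 ≤ y t
  c_pos : 0 < c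
  one_lt : 1 < θ
  exists_rate : ∀ T, t₀ ≤ T → ∃ D : ℝ → ℝ, IntegrableOn D (Ioc t₀ T) ∧
    (∀ᵐ τ ∂volume.restrict (Ioc t₀ T), c * y τ ^ θ ≤ D τ) ∧
    ∀ s t, t₀ ≤ s → s ≤ t → t ≤ T → y s - y t = ∫ τ in s..t, D τ

namespace IsDecaying

variable {y : ℝ → ℝ} {t₀ c θ : ℝ}

theorem le_of_le (hy : IsDecaying y t₀ c θ) {s t : ℝ} (hs : t₀ ≤ s) (hst : s ≤ t) : y t ≤ y s := by
  obtain ⟨D, -, hD, hDeq⟩ := hy.exists_rate t (hs.trans hst)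
  rw [← sub_nonneg, hDeq s t hs hst le_rfl, intervalIntegral.integral_of_le hst]
  refine integral_nonneg_of_ae (ae_mono (Measure.restrict_mono (Ioc_subset_Ioc_left hs) le_rfl) ?_)
  filter_upwards [hD, ae_restrict_mem measurableSet_Ioc] with τ h1 h2
  exact (mul_nonneg hy.c_pos.le (Real.rpow_nonneg (hy.nonneg τ h2.1.le) _)).trans h1

/-- As `y` is nonincreasing, its least value on `[s, t]` is `y t`. This integrated form holds for
all times, and so gives the derivative inequality at every point of differentiability rather than
almost everywhere. -/
theorem mul_le_sub (hy : IsDecaying y t₀ c θ) {s t : ℝ} (hs : t₀ ≤ s) (hst : s ≤ t) :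
    c * y t ^ θ * (t - s) ≤ y s - y t := by
  obtain ⟨D, hDi, hD, hDeq⟩ := hy.exists_rate t (hs.trans hst)
  have hle : volume.restrict (Ioc s t) ≤ volume.restrict (Ioc t₀ t) :=
    Measure.restrict_mono (Ioc_subset_Ioc_left hs) le_rfl
  have h0 : ∫ _ in s..t, c * y t ^ θ = c * y t ^ θ * (t - s) := by
    rw [intervalIntegral.integral_const, smul_eq_mul, mul_comm]
  rw [hDeq s t hs hst le_rfl, ← h0, intervalIntegral.integral_of_le hst,
    intervalIntegral.integral_of_le hst]
  refine integral_mono_ae (integrable_const _) (Integrable.mono_measure hDi hle) ?_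
  filter_upwards [ae_mono hle hD, ae_restrict_mem measurableSet_Ioc] with τ h1 h2
  refine le_trans ?_ h1
  have h3 := hy.nonneg t (hs.trans hst)
  have h4 := hy.le_of_le (hs.trans h2.1.le) h2.2
  have h5 := hy.c_pos.le
  have h6 := hy.one_lt
  gcongr

theorem absolutelyContinuousOnInterval (hy : IsDecaying y t₀ c θ) {T : ℝ} (hT : t₀ ≤ T) :
    AbsolutelyContinuousOnInterval y t₀ T := by
  obtain ⟨D, hDi, -, hDeq⟩ := hy.exists_rate T hT
  have hD : IntervalIntegrable D volume t₀ T := (intervalIntegrable_iff_integrableOn_Ioc_of_le hT).2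
    hDi
  refine AbsolutelyContinuousOnInterval.of_dist_le (B := 1)
    (hD.absolutelyContinuousOnInterval_intervalIntegral (c := t₀) left_mem_uIcc)
    fun s hs t ht => ?_
  rw [uIcc_of_le hT] at hs ht
  rw [← hDeq t₀ s le_rfl hs.1 hs.2, ← hDeq t₀ t le_rfl ht.1 ht.2, one_mul, Real.dist_eq,
    Real.dist_eq, abs_sub_comm]
  exact le_of_eq (congrArg _ (by ring))

theorem ae_differentiableAt (hy : IsDecaying y t₀ c θ) :
    ∀ᵐ t ∂volume.restrict (Ioi t₀), DifferentiableAt ℝ y t := by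
  rw [ae_restrict_iff' measurableSet_Ioi]
  have h : ∀ n : ℕ, ∀ᵐ t : ℝ, t ∈ uIcc t₀ (t₀ + n) → DifferentiableAt ℝ y t := fun n =>
    (hy.absolutelyContinuousOnInterval (by simp)).ae_differentiableAt
  filter_upwards [ae_all_iff.2 h] with t ht htt
  obtain ⟨n, hn⟩ := exists_nat_ge (t - t₀)
  refine ht n ?_
  rw [uIcc_of_le (by simp)]
  exact ⟨le_of_lt htt, by linarith⟩

theorem deriv_add_le (hy : IsDecaying y t₀ c θ) {t : ℝ} (ht : t₀ < t)
    (hd : DifferentiableAt ℝ y t) : deriv y t + c * y t ^ θ ≤ 0 := by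
  -- Left difference quotients are used because `mul_le_sub` involves the value at the right
  -- endpoint, which here stays fixed at `t`.
  have h1 : Tendsto (slope y t) (𝓝[<] t) (𝓝 (deriv y t)) :=
    (hasDerivAt_iff_tendsto_slope.1 hd.hasDerivAt).mono_left
      (nhdsWithin_mono t fun s hs => ne_of_lt hs)
  have h2 : deriv y t ≤ -(c * y t ^ θ) := by
    refine le_of_tendsto h1 ?_
    filter_upwards [Ioo_mem_nhdsLT ht] with s hs
    have h3 := hy.mul_le_sub hs.1.le hs.2.le
    rw [slope_comm, slope_def_field, div_le_iff₀ (by linarith [hs.2])]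
    linarith
  linarith

/-- The substitution `y^(-(θ-1))` linearises the inequality: its growth rate is at least `c (θ -
1)`. A comparison of right slopes with an affine function proves this; it is meaningful because
positivity at `t` forces positivity at all earlier times. -/
theorem rpow_neg_le (hy : IsDecaying y t₀ c θ) {t : ℝ} (ht : t₀ ≤ t) (hyt : 0 < y t) :
    c * (θ - 1) * (t - t₀) + y t₀ ^ (-(θ - 1)) ≤ y t ^ (-(θ - 1)) := by
  have hβ : 0 < θ - 1 := by linarith [hy.one_lt]
  have hyc : ContinuousOn y (Icc t₀ t) := by
    have := (hy.absolutelyContinuousOnInterval ht).continuousOn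
    rwa [uIcc_of_le ht] at this
  have hpos : ∀ s ∈ Icc t₀ t, 0 < y s := fun s hs => hyt.trans_le (hy.le_of_le hs.1 hs.2)
  have hgc : ContinuousOn (fun s => -(y s ^ (-(θ - 1)))) (Icc t₀ t) :=
    (hyc.rpow_const fun s hs => Or.inl (hpos s hs).ne').neg
  have h := image_le_of_liminf_slope_right_le_deriv_boundary hgc
    (B := fun s => -(y t₀ ^ (-(θ - 1))) - c * (θ - 1) * (s - t₀)) (B' := fun _ => -(c * (θ - 1)))
    (by simp) (by fun_prop)
    (fun x _ => by
      have h1 := (((hasDerivAt_id x).sub_const t₀).const_mul (c * (θ - 1))).const_sub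
        (-(y t₀ ^ (-(θ - 1))))
      simpa using h1.hasDerivWithinAt)
    (fun x hx r hr => by
      have hx' : x ∈ Icc t₀ t := Ico_subset_Icc_self hx
      have hyx := hpos x hx'
      have hcx : ContinuousWithinAt y (Ioi x) x :=
        ((hyc x hx').mono_of_mem_nhdsWithin (Icc_mem_nhdsGT_of_mem hx))
      -- The bound on the slope carries `y z` in place of `y x`; right continuity makes the
      -- resulting factor `(y z / y x)^θ` tend to `1`.
      have hlim : Tendsto (fun z => -(c * (θ - 1) * (y z / y x) ^ θ)) (𝓝[>] x)
          (𝓝 (-(c * (θ - 1)))) := by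
        have h2 := (((hcx.tendsto.div_const (y x)).rpow_const
          (Or.inr (by linarith : 0 ≤ θ))).const_mul (c * (θ - 1))).neg
        rwa [div_self hyx.ne', Real.one_rpow, mul_one] at h2
      refine Eventually.frequently ?_
      filter_upwards [hlim.eventually (gt_mem_nhds hr), Ioo_mem_nhdsGT hx.2] with z hz hzx
      refine lt_of_le_of_lt ?_ hz
      have hyz := hpos z ⟨hx.1.trans hzx.1.le, hzx.2.le⟩
      have hzx0 : 0 < z - x := by linarith [hzx.1]
      have h3 := hy.mul_le_sub hx.1 hzx.1.le
      have h4 := mul_one_sub_div_le_rpow_neg_sub hyz hyx hβ.le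
      rw [slope_def_field, div_le_iff₀ hzx0]
      have h5 : y x ^ (-(θ - 1)) * (1 - y z / y x) = y x ^ (-θ) * (y x - y z) := by
        have : y x ^ (-(θ - 1)) = y x ^ (-θ) * y x := by
          rw [← Real.rpow_add_one hyx.ne']
          congr 1
          ring
        rw [this]
        field_simp
      have h6 : y x ^ (-θ) * y z ^ θ = (y z / y x) ^ θ := by
        rw [Real.div_rpow hyz.le hyx.le, Real.rpow_neg hyx.le]
        field_simp
      have h7 := mul_le_mul_of_nonneg_left h3
        (mul_nonneg hβ.le (Real.rpow_nonneg hyx.le (-θ)))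
      have h8 : (θ - 1) * y x ^ (-θ) * (c * y z ^ θ * (z - x)) =
          c * (θ - 1) * (y z / y x) ^ θ * (z - x) := by
        rw [← h6]
        ring
      have h9 : (θ - 1) * y x ^ (-(θ - 1)) * (1 - y z / y x) =
          (θ - 1) * y x ^ (-θ) * (y x - y z) := by
        rw [mul_assoc, h5, mul_assoc]
      linarith) (right_mem_Icc.2 ht)
  linarith

theorem le_rpow (hy : IsDecaying y t₀ c θ) (h0 : 0 < y t₀) {t : ℝ} (ht : t₀ ≤ t) :
    y t ≤ (c * (θ - 1) * (t - t₀) + y t₀ ^ (-(θ - 1))) ^ (-(1 / (θ - 1))) := by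
  have hβ : 0 < θ - 1 := by linarith [hy.one_lt]
  have hX : 0 < c * (θ - 1) * (t - t₀) + y t₀ ^ (-(θ - 1)) :=
    add_pos_of_nonneg_of_pos (mul_nonneg (mul_nonneg hy.c_pos.le hβ.le) (sub_nonneg.2 ht))
      (Real.rpow_pos_of_pos h0 _)
  rcases (hy.nonneg t ht).eq_or_lt with h1 | h1
  · rw [← h1]
    exact Real.rpow_nonneg hX.le _
  · have h2 := Real.rpow_le_rpow_of_nonpos hX (hy.rpow_neg_le ht h1)
      (neg_nonpos.2 (one_div_pos.2 hβ).le)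
    rwa [← Real.rpow_mul h1.le, neg_mul_neg, mul_one_div_cancel hβ.ne', Real.rpow_one] at h2

theorem tendsto_zero (hy : IsDecaying y t₀ c θ) : Tendsto y atTop (𝓝 0) := by
  have hβ : 0 < θ - 1 := by linarith [hy.one_lt]
  rcases (hy.nonneg t₀ le_rfl).eq_or_lt with h0 | h0
  · refine tendsto_const_nhds.congr' ?_
    filter_upwards [eventually_ge_atTop t₀] with t ht
    exact le_antisymm (hy.nonneg t ht) (h0 ▸ hy.le_of_le le_rfl ht)
  · have h1 : Tendsto (fun t => c * (θ - 1) * (t - t₀) + y t₀ ^ (-(θ - 1))) atTop atTop :=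
      tendsto_atTop_add_const_right _ _ ((tendsto_atTop_add_const_right _ (-t₀)
        tendsto_id).const_mul_atTop (mul_pos hy.c_pos hβ))
    refine tendsto_of_tendsto_of_tendsto_of_le_of_le' tendsto_const_nhds
      ((tendsto_rpow_neg_atTop (one_div_pos.2 hβ)).comp h1) ?_ ?_
    · filter_upwards [eventually_ge_atTop t₀] with t ht using hy.nonneg t ht
    · filter_upwards [eventually_ge_atTop t₀] with t ht using hy.le_rpow h0 ht

end IsDecaying

end EinsteinModel

end

/-! ### The decay theorem -/

theorem mainTheorem3 {N : ℕ} (hN : 0 < N) (Ω : Set (EinsteinModel.Euc N))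
    (hΩ_open : IsOpen Ω) (hΩ_conn : IsConnected Ω) (hΩ_bdd : Bornology.IsBounded Ω)
    (p₁ q₁ γ₁ c₃ c₄ δ₁ : ℝ) (hp₁ : 0 < p₁) (hq₁ : 0 < q₁) (hγ₁ : 0 < γ₁)
    (hc₃ : 0 < c₃) (hc₄ : 0 < c₄)
    (hδ₁ : δ₁ = (p₁ + 1) / (γ₁ + 1)) (hδ₁_ge : 1 ≤ δ₁) (hδ₁_lt : δ₁ < 2) :
    ∃ c : ℝ, 0 < c ∧
      ∀ (h a : ℝ → ℝ), EinsteinModel.IsModel h a →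
        EinsteinModel.LowerStructure h a p₁ q₁ c₃ →
        EinsteinModel.UpperStructure h γ₁ (q₁ / 2) c₄ →
      ∀ (t₀ : ℝ) (u₀ : EinsteinModel.Euc N → ℝ) (u : EinsteinModel.Euc N → ℝ → ℝ),
        EinsteinModel.IsStrongSolution Ω h a t₀ u₀ u →
        EinsteinModel.ZeroBoundary Ω h a p₁ t₀ u →
        MemLp (fun x => EinsteinModel.H h (u₀ x)) (ENNReal.ofReal (p₁ + 1))
          (volume.restrict Ω) →
        (∀ t : ℝ, t₀ ≤ t →
          IntegrableOn (fun x => EinsteinModel.H h (u x t) ^ (p₁ + 1)) Ω) ∧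
        (∀ T : ℝ, t₀ ≤ T →
          AbsolutelyContinuousOnInterval (EinsteinModel.Y Ω h p₁ u) t₀ T) ∧
        (∀ᵐ t ∂volume.restrict (Ioi t₀),
          DifferentiableAt ℝ (EinsteinModel.Y Ω h p₁ u) t) ∧
        (∀ t : ℝ, t₀ < t → DifferentiableAt ℝ (EinsteinModel.Y Ω h p₁ u) t →
          deriv (EinsteinModel.Y Ω h p₁ u) t
            + c * EinsteinModel.Y Ω h p₁ u t ^ (2 / δ₁) ≤ 0) ∧
        (0 < EinsteinModel.Y Ω h p₁ u t₀ → ∀ t : ℝ, t₀ ≤ t →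
          EinsteinModel.Y Ω h p₁ u t ≤
            (c * ((2 - δ₁) / δ₁) * (t - t₀)
              + EinsteinModel.Y Ω h p₁ u t₀ ^ (-((2 - δ₁) / δ₁))) ^ (-(δ₁ / (2 - δ₁)))) ∧
        Tendsto (EinsteinModel.Y Ω h p₁ u) atTop (𝓝 0) := by
  subst hδ₁
  have hθ : 1 < 2 / ((p₁ + 1) / (γ₁ + 1)) := by
    rwa [one_lt_div (by linarith)]
  obtain ⟨R, hR0, hR⟩ := hΩ_bdd.exists_pos_norm_le
  have hΩ_fin : volume Ω ≠ ⊤ := hΩ_bdd.measure_lt_top.ne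
  have hΩ_pos : 0 < volume.real Ω :=
    ENNReal.toReal_pos (hΩ_open.measure_pos volume hΩ_conn.nonempty).ne' hΩ_fin
  have : IsFiniteMeasure (volume.restrict Ω) := isFiniteMeasure_restrict.2 hΩ_fin
  -- The factor `p₁ + 1` comes from differentiating the power, the quotient from the structure
  -- conditions and Poincaré's inequality, and the power of the volume from Hölder's inequality. The
  -- domain enters only through `R` and its volume.
  refine ⟨(p₁ + 1) * (c₃ / (4 * R ^ 2 * c₄ ^ 2)) *
    volume.real Ω ^ (1 - 2 / ((p₁ + 1) / (γ₁ + 1))), by positivity, ?_⟩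
  intro h a hM hl hu t₀ u₀ u hsol hbdry hu₀
  have hA : EinsteinModel.IsAdmissible h a p₁ q₁ γ₁ c₃ c₄ :=
    ⟨hM, hp₁, hq₁, hγ₁, hc₃, hc₄, hl, hu⟩
  have key := fun T (hT : t₀ ≤ T) =>
    hsol.exists_dissipation hN hΩ_open hΩ_pos hR0 hR hA hθ hbdry hu₀ hT
  have hY : EinsteinModel.IsDecaying (EinsteinModel.Y Ω h p₁ u) t₀
      ((p₁ + 1) * (c₃ / (4 * R ^ 2 * c₄ ^ 2)) *
        volume.real Ω ^ (1 - 2 / ((p₁ + 1) / (γ₁ + 1)))) (2 / ((p₁ + 1) / (γ₁ + 1))) := by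
    refine ⟨fun t ht => integral_nonneg_of_ae ?_, by positivity, hθ, fun T hT => (key T hT).2⟩
    filter_upwards [hsol.2.1 t ht] with x hx
    exact Real.rpow_nonneg (hM.H_nonneg hx) _
  have hβ : 2 / ((p₁ + 1) / (γ₁ + 1)) - 1 =
      (2 - (p₁ + 1) / (γ₁ + 1)) / ((p₁ + 1) / (γ₁ + 1)) := by
    field_simp
  refine ⟨fun t ht => (key t ht).1 t (right_mem_Icc.2 ht),
    fun T hT => hY.absolutelyContinuousOnInterval hT, hY.ae_differentiableAt,
    fun t ht hd => hY.deriv_add_le ht hd, fun h0 t ht => ?_, hY.tendsto_zero⟩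
  have h1 := hY.le_rpow h0 ht
  rwa [hβ, one_div_div] at h1
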